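/- **Setting.** Let $\mathscr L$ be a real Hilbert space, $\mathscr H\subset\mathscr L$ a Hilbert space and $\tilde{\mathscr H}\subset\mathscr H$ an inner product space, with $\|\cdot\|_{\mathscr L}\le\|\cdot\|_{\mathscr H}$ on $\mathscr H$ and $\|\cdot\|_{\mathscr H}\le\|\cdot\|_{\tilde{\mathscr H}}$ on $\tilde{\mathscr H}$. Let $\mathcal E:\mathscr L\to(-\infty,+\infty]$, let $\mathscr F^-,\mathscr F^+\subset\mathscr L$ be nonempty and closed, let $a<0$, $r_0^\pm>0$, $C^\pm>1$, and put $\ell^-:=a$, $\ell^+:=0$. For $r>0$ let $\mathscr F^\pm_r=\{v\in\mathscr L:\mathrm{dist}_{\mathscr L}(v,\mathscr F^\pm)\le r\}$ and $\mathscr F^\pm_{\mathscr H,r}=\{v\in\mathscr H:\mathrm{dist}_{\mathscr H}(v,\mathscr F^\pm)\le r\}$. Assume: 1. (*Unbalanced potential*) $\mathcal E$ is sequentially weakly lower semicontinuous on $\mathscr L$; $\mathcal E\ge a$ on $\mathscr L$, $\mathcal E=a$ on $\mathscr F^-$; every point of $\mathscr F^+$ is a local minimizer of $\mathcal E$, with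 $\mathcal E=0$ on $\mathscr F^+$; $\mathscr F^+_{r_0^+}\cap\mathscr F^-_{r_0^-}=\emptyset$; $(C^\pm)^{-1}\mathrm{dist}_{\mathscr L}(v,\mathscr F^\pm)^2\le\mathcal E(v)-\ell^\pm$ for $v\in\mathscr F^\pm_{r_0^\pm}$; every $v\in\mathscr F^\pm_{r_0^\pm}$ has a unique $\mathscr L$-nearest point $P^\pm(v)$ in $\mathscr F^\pm$, and $P^\pm$ is $C^2$ on $\mathscr F^\pm_{r_0^\pm}$ for the $\mathscr L$-norm. 2. (*Smaller spaces*) $\mathscr H=\{v\in\mathscr L:\mathcal E(v)<+\infty\}$; $\mathcal E$ is $C^1$ on $(\mathscr H,\|\cdot\|_{\mathscr H})$; there is a continuous map $D_{\mathscr L}\mathcal E:\tilde{\mathscr H}\to\mathscr L$ with $\langle D_{\mathscr L}\mathcal E(v),w\rangle_{\mathscr L}=D\mathcal E(v)(w)$ for $v\in\tilde{\mathscr H}$, $w\in\mathscr H$. 3. (*Compactness*) $\mathscr L$-bounded subsets of $\mathscr F^\pm$ are relatively compact in $\mathscr H$. 4. (*Inverse projections*) For each sign, either $\mathscr F^\pm$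 is $\mathscr L$-bounded, or for all $v\in\mathscr F^\pm_{r_0^\pm}$ and $\mathbf v\in\mathscr F^\pm$ there is a differentiable $\hat P:\mathscr L\to\mathscr L$ with $P^\pm(\hat P(v))=\mathbf v$ and, for all $w,w_1,w_2\in\mathscr L$, $\mathrm{dist}_{\mathscr L}(\hat P(w),\mathscr F^\pm)=\mathrm{dist}_{\mathscr L}(w,\mathscr F^\pm)$, $\|D\hat P(w_1)w_2\|_{\mathscr L}=\|w_2\|_{\mathscr L}$ and $\mathcal E(\hat P(w))=\mathcal E(w)$. 5. (*Projections in $\mathscr H$*) Every $v\in\mathscr F^\pm_{\mathscr H,r_0^\pm}$ has a unique $\mathscr H$-nearest point $P^\pm_{\mathscr H}(v)$ in $\mathscr F^\pm$; $P^\pm_{\mathscr H}$ is $C^1$ on $\mathscr F^\pm_{\mathscr H,r_0^\pm}$ for the $\mathscr H$-norm; for $v\in\mathscr F^\pm_{\mathscr H,r_0^\pm}$, $\|P^\pm(v)-P^\pm_{\mathscr H}(v)\|_{\mathscr H}\le C^\pm\|v-P^\pm_{\mathscr H}(v)\|_{\mathscr H}$ and $(C^\pm)^{-2}\|v-P^\pm_{\mathscr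 H}(v)\|_{\mathscr H}^2\le\mathcal E(v)-\ell^\pm\le(C^\pm)^2\|v-P^\pm_{\mathscr H}(v)\|^2_{\mathscr H}$; for each $r\in(0,r_0^\pm]$ there is a constant $\beta^\pm(r)>0$ such that $v\in\mathscr F^\pm_{r_0^\pm}$ and $\mathcal E(v)\le\ell^\pm+\beta^\pm(r)$ imply $v\in\mathscr F^\pm_{\mathscr H,r}$. 6. (*Regularity*) There is $\mathfrak P:\mathscr L\to\mathscr L$ with $\mathcal E(\mathfrak P(v))\le\mathcal E(v)$ for all $v$; for $v$ with $\mathcal E(v)<+\infty$, equality holds iff $\mathfrak P(v)=v$; $\|\mathfrak P(v_1)-\mathfrak P(v_2)\|_{\mathscr L}\le\|v_1-v_2\|_{\mathscr L}$; and $\mathfrak P=\mathrm{Id}$ on $\mathscr F^-\cup\mathscr F^+$. For every $c>0$, every bounded open interval $I\ne\emptyset$ and every local minimizer $\mathbf W$ of $\mathbf E_c(\cdot;I)$ with $\mathbf W=\mathfrak P(\mathbf W)$ on $I$, one has $\mathbf W\in\mathcal A(I)$ and $\mathbf W''-D_{\mathscr L}\mathcal E(\mathbf W)=-c\mathbf W'$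 in $I$. 7. (*Level sets*) $-a<\mathcal E^-_{\max}$ and $\{v\in\mathscr H:\mathcal E(v)<0\}\subset\mathscr F^-_{r_0^- /2}$. Here $\mathbf E_c(U;I)=\int_I\big[\tfrac12\|U'(t)\|^2_{\mathscr L}+\mathcal E(U(t))\big]e^{ct}\,dt$ and $\mathbf E_c(U)=\mathbf E_c(U;\mathbb R)$ for $U\in H^1_{\rm loc}$ (continuous representative), well defined when the positive and negative parts of the integrand do not both have infinite integral. $U\in H^1_{\rm loc}(I,\mathscr L)$ is a *local minimizer* of $\mathbf E_c(\cdot;I)$ if $\mathbf E_c(U;I)$ is well defined and finite and, for some $\delta>0$, every $\phi\in C^1_c(I,\mathscr H)$ with $\max_I\|\phi\|_{\mathscr H}<\delta$ is such that $\mathbf E_c(U+\phi;I)$ is well defined and $\ge\mathbf E_c(U;I)$. Moreover $\mathcal A(O)=C^2(O,\mathscr L)\cap C^1(O,\mathscr H)\cap C^0(O,\tilde{\mathscr H})$ for $O\subset\mathbb R$ open, $\kappa^-_r=\inf\{\mathcal E(v):\mathrm{dist}_{\mathscr L}(v,\mathscr F^-)\in[r,r_0^-]\}$, $$\eta_0^-=\min\Big\{\sqrt{e^{-1}\tfrac{r_0^-}{4}\sqrt{2(\kappa^-_{r_0^-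 /4}-a)}},\ \tfrac{r_0^-}{4}\Big\},\qquad \hat r^-=\frac{r_0^-}{C^-+1},$$ $$\mathcal E^-_{\max}=\frac{1}{(C^-)^2(C^-+1)}\min\Big\{\tfrac{(\eta_0^-)^2}{4},\ \kappa^-_{\eta_0^-}-a,\ \beta^-(\hat r^-),\ \beta^-(\eta_0^-)\Big\},$$ and $X$ is the set of $U\in H^1_{\rm loc}(\mathbb R,\mathscr L)$ for which there is $T\ge1$ with $\mathrm{dist}_{\mathscr L}(U(t),\mathscr F^+)\le r_0^+/2$ for $t\ge T$ and $\mathrm{dist}_{\mathscr L}(U(t),\mathscr F^-)\le r_0^- /2$ for $t\le-T$. **Theorem.** Under these assumptions there exist $c^\star>0$ and $\mathbf U\in\mathcal A(\mathbb R)\cap X$ such that: 1. (*Existence*) $\mathbf U''-D_{\mathscr L}\mathcal E(\mathbf U)=-c^\star\mathbf U'$ in $\mathbb R$; $\mathbf U(t)\in\mathscr F^-_{r_0^- /2}$ for all $t\le T^-$ and $\mathbf U(t)\in\mathscr F^+_{r_0^+/2}$ for all $t\ge T^+$, for some $T^\pm\in\mathbb R$; $\mathbf U$ minimizes $\mathbf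 E_{c^\star}$ over $X$, and $\mathbf E_{c^\star}(\mathbf U)=0$; and $\mathbf U(t)=\mathfrak P(\mathbf U(t))$ for all $t\in\mathbb R$. 2. (*Uniqueness of the speed*) If $\overline c>0$ satisfies $\inf_{U\in X}\mathbf E_{\overline c}(U)=0$ and there is $\overline{\mathbf U}\in\mathcal A(\mathbb R)\cap X$ with $\overline{\mathbf U}''-D_{\mathscr L}\mathcal E(\overline{\mathbf U})=-\overline c\,\overline{\mathbf U}'$ in $\mathbb R$ and $\mathbf E_{\overline c}(\overline{\mathbf U})<+\infty$, then $\overline c=c^\star$. 3. (*Exponential convergence*) There are $M^+>0$ and $\mathbf v^+\in\mathscr F^+$ with $\|\mathbf U(t)-\mathbf v^+\|_{\mathscr L}\le M^+e^{-c^\star t}$ for all $t\in\mathbb R$. -/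

import Mathlib

open Set Filter Topology MeasureTheory

noncomputable section

namespace AbstractWave

/-- The closed `r`-tube around a set `F` in a metric space: points at distance at most `r` from `F`. -/
def tube {α : Type*} [PseudoMetricSpace α] (F : Set α) (r : ℝ) : Set α :=
  {v | Metric.infDist v F ≤ r}

open Classical in
/-- The nearest-point projection onto `F` (meaningful where a unique nearest point exists;
the value where no nearest point exists is irrelevant). -/
def proj {α : Type*} [PseudoMetricSpace α] (F : Set α) (v : α) : α :=
  if h : ∃ w ∈ F, dist v w = Metric.infDist v F then h.choose else v

/-- Every point of the tube of radius `r` has exactly one nearest point in `F`. -/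
def UniqueProj {α : Type*} [PseudoMetricSpace α] (F : Set α) (r : ℝ) : Prop :=
  ∀ v ∈ tube F r, ∃! w, w ∈ F ∧ dist v w = Metric.infDist v F

/-- One of the two minimum sets, with the constants attached to it: the radius `r₀`,
the constant `C`, and the thresholds `β r` for `0 < r ≤ r₀`. -/
structure Well (L : Type*) where
  F : Set L
  r₀ : ℝ
  C : ℝ
  β : ℝ → ℝ

/-- The data of the abstract problem. `H` is a subspace of `L` through the injection `ι`, and `K`
(the still smaller space) is a subspace of `H` through the injection `κ`. `E` is the potential,
`gradE` its `L`-gradient on `K`, `a` its minimum value, `trunc` the truncation map.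
All hypotheses on these data are the separate predicates below. -/
structure Setting (L H K : Type*)
    [NormedAddCommGroup L] [InnerProductSpace ℝ L] [NormedAddCommGroup H] [InnerProductSpace ℝ H]
    [NormedAddCommGroup K] [InnerProductSpace ℝ K] where
  ι : H →L[ℝ] L
  ι_injective : Function.Injective ι
  κ : K →L[ℝ] H
  κ_injective : Function.Injective κ
  E : L → EReal
  gradE : K → L
  a : ℝ
  minus : Well L
  plus : Well L
  trunc : L → L

/-- `U` is (the continuous representative of) an element of `H¹_loc(I, L)`, for an interval `I`:
it is the primitive of a function that is square integrable on compact subintervals of `I`. -/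
def H1Loc {L : Type*} [NormedAddCommGroup L] [NormedSpace ℝ L] (U : ℝ → L) (I : Set ℝ) : Prop :=
  ∃ g : ℝ → L, ∀ s ∈ I, ∀ t ∈ I, s ≤ t →
    MemLp g 2 (volume.restrict (Icc s t)) ∧ U t - U s = ∫ x in s..t, g x

/-- Sequential weak lower semicontinuity of an extended-valued function on a Hilbert space. -/
def WeaklyLSC {L : Type*} [NormedAddCommGroup L] [InnerProductSpace ℝ L] (E : L → EReal) : Prop :=
  ∀ (u : ℕ → L) (v : L),
    (∀ y : L, Tendsto (fun n => inner ℝ (u n) y) atTop (𝓝 (inner ℝ v y))) →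
      E v ≤ liminf (fun n => E (u n)) atTop

namespace Setting

variable {L H K : Type*}
  [NormedAddCommGroup L] [InnerProductSpace ℝ L] [NormedAddCommGroup H] [InnerProductSpace ℝ H]
  [NormedAddCommGroup K] [InnerProductSpace ℝ K] (S : Setting L H K)

/-- The conditions on one well at energy level `ℓ` with respect to the norm of `L`. -/
structure WellL (w : Well L) (ℓ : ℝ) : Prop where
  nonempty : w.F.Nonempty
  closed : IsClosed w.F
  r₀_pos : 0 < w.r₀
  one_lt_C : 1 < w.C
  energy_eq : ∀ v ∈ w.F, S.E v = (ℓ : EReal)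
  localMin : ∀ v ∈ w.F, IsLocalMin S.E v
  coercive : ∀ v ∈ tube w.F w.r₀,
    ((w.C⁻¹ * Metric.infDist v w.F ^ 2 + ℓ : ℝ) : EReal) ≤ S.E v
  uniqueProj : UniqueProj w.F w.r₀
  proj_contDiff : ContDiffOn ℝ 2 (proj w.F) (tube w.F w.r₀)

/-- `E` is an unbalanced double-well potential: the global minimum `a < 0` is taken on the set
`F⁻`, and the points of the set `F⁺` are local minimizers at level `0`. -/
structure Unbalanced : Prop where
  wlsc : WeaklyLSC S.E
  a_neg : S.a < 0
  a_le : ∀ v, (S.a : EReal) ≤ S.E v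
  wellMinus : S.WellL S.minus S.a
  wellPlus : S.WellL S.plus 0
  disjoint : Disjoint (tube S.plus.F S.plus.r₀) (tube S.minus.F S.minus.r₀)

/-- The potential, as a real function on `H`. -/
def EH (x : H) : ℝ := (S.E (S.ι x)).toReal

/-- `H` is the finiteness domain of `E`, the norms are ordered, `E` is `C¹` on `H`, and its
differential at points of `K` is represented in `L` by the continuous map `gradE`. -/
structure SmallerSpace : Prop where
  range_eq : range S.ι = {v | S.E v < ⊤}
  norm_ι_le : ∀ x, ‖S.ι x‖ ≤ ‖x‖
  norm_κ_le : ∀ x, ‖S.κ x‖ ≤ ‖x‖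
  contDiff : ContDiff ℝ 1 S.EH
  grad_continuous : Continuous S.gradE
  grad_eq : ∀ (x : K) (y : H), inner ℝ (S.gradE x) (S.ι y) = fderiv ℝ S.EH (S.κ x) y

/-- `L`-bounded subsets of `F⁻` and of `F⁺` are relatively compact in `H`. -/
def Compactness : Prop :=
  ∀ w ∈ ({S.minus, S.plus} : Set (Well L)), ∀ B ⊆ w.F, Bornology.IsBounded B →
    IsCompact (closure (S.ι ⁻¹' B))

/-- Each of the two sets `F` is bounded, or its projection can be inverted by means of
energy-preserving differentiable maps that also preserve the distance to `F`. -/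
def ProjectionsInverse : Prop :=
  ∀ w ∈ ({S.minus, S.plus} : Set (Well L)),
    Bornology.IsBounded w.F ∨
    ∀ v ∈ tube w.F w.r₀, ∀ z ∈ w.F, ∃ Q : L → L,
      proj w.F (Q v) = z ∧
      (∀ x, Metric.infDist (Q x) w.F = Metric.infDist x w.F) ∧
      Differentiable ℝ Q ∧
      (∀ x y, ‖fderiv ℝ Q x y‖ = ‖y‖) ∧
      ∀ x, S.E (Q x) = S.E x

/-- The set of a well, seen in `H`. -/
def FH (w : Well L) : Set H := S.ι ⁻¹' w.F

/-- The conditions on one well at energy level `ℓ` with respect to the norm of `H`. -/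
structure WellH (w : Well L) (ℓ : ℝ) : Prop where
  uniqueProj : UniqueProj (S.FH w) w.r₀
  proj_contDiff : ContDiffOn ℝ 1 (proj (S.FH w)) (tube (S.FH w) w.r₀)
  proj_sub_le : ∀ x ∈ tube (S.FH w) w.r₀, ∀ y : H, S.ι y = proj w.F (S.ι x) →
    ‖y - proj (S.FH w) x‖ ≤ w.C * ‖x - proj (S.FH w) x‖
  β_pos : ∀ r ∈ Ioc 0 w.r₀, 0 < w.β r
  mem_of_le : ∀ r ∈ Ioc 0 w.r₀, ∀ v ∈ tube w.F w.r₀, S.E v ≤ ((ℓ + w.β r : ℝ) : EReal) →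
    v ∈ S.ι '' tube (S.FH w) r
  lower : ∀ x ∈ tube (S.FH w) w.r₀,
    (((w.C ^ 2)⁻¹ * ‖x - proj (S.FH w) x‖ ^ 2 + ℓ : ℝ) : EReal) ≤ S.E (S.ι x)
  upper : ∀ x ∈ tube (S.FH w) w.r₀,
    S.E (S.ι x) ≤ ((w.C ^ 2 * ‖x - proj (S.FH w) x‖ ^ 2 + ℓ : ℝ) : EReal)

/-- The hypothesis on the projections in `H`. -/
def ProjectionsH : Prop := S.WellH S.minus S.a ∧ S.WellH S.plus 0

/-- The energy density `(‖U'(t)‖² / 2 + E(U(t))) e^{ct}`, with values in `(-∞, +∞]`. -/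
def density (c : ℝ) (U : ℝ → L) (t : ℝ) : EReal :=
  (((‖deriv U t‖ ^ 2 / 2 : ℝ) : EReal) + S.E (U t)) * ((Real.exp (c * t) : ℝ) : EReal)

/-- The integral over `I` of the positive part of the energy density. -/
def energyPos (c : ℝ) (U : ℝ → L) (I : Set ℝ) : ENNReal :=
  ∫⁻ t in I, (S.density c U t).toENNReal

/-- The integral over `I` of the negative part of the energy density. -/
def energyNeg (c : ℝ) (U : ℝ → L) (I : Set ℝ) : ENNReal :=
  ∫⁻ t in I, (-S.density c U t).toENNReal

/-- The energy over `I` is well defined: the positive and the negative part of the density are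
not both of infinite integral. -/
def EnergyDefined (c : ℝ) (U : ℝ → L) (I : Set ℝ) : Prop :=
  S.energyPos c U I ≠ ⊤ ∨ S.energyNeg c U I ≠ ⊤

/-- The energy of `U` over `I`, as an extended real. -/
def energyOn (c : ℝ) (U : ℝ → L) (I : Set ℝ) : EReal :=
  (S.energyPos c U I : EReal) - (S.energyNeg c U I : EReal)

/-- The energy of `U` over the whole line. -/
def energy (c : ℝ) (U : ℝ → L) : EReal := S.energyOn c U univ

/-- `U` is a local minimizer of the energy with parameter `c` on the interval `(α, β)`. -/
def IsLocalMinimizer (c : ℝ) (U : ℝ → L) (α β : ℝ) : Prop :=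
  H1Loc U (Ioo α β) ∧
  S.EnergyDefined c U (Ioo α β) ∧ S.energyOn c U (Ioo α β) ≠ ⊤ ∧ S.energyOn c U (Ioo α β) ≠ ⊥ ∧
  ∃ δ > 0, ∀ φ : ℝ → H, ContDiff ℝ 1 φ → HasCompactSupport φ → tsupport φ ⊆ Ioo α β →
    (∀ t ∈ Ioo α β, ‖φ t‖ < δ) →
      S.EnergyDefined c (fun t => U t + S.ι (φ t)) (Ioo α β) ∧
      S.energyOn c U (Ioo α β) ≤ S.energyOn c (fun t => U t + S.ι (φ t)) (Ioo α β)

/-- The class `C²(O, L) ∩ C¹(O, H) ∩ C⁰(O, K)` for an open set `O`. -/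
def RegularOn (U : ℝ → L) (O : Set ℝ) : Prop :=
  ContDiffOn ℝ 2 U O ∧
  (∃ V : ℝ → H, ContDiffOn ℝ 1 V O ∧ ∀ t ∈ O, S.ι (V t) = U t) ∧
  ∃ W : ℝ → K, ContinuousOn W O ∧ ∀ t ∈ O, S.ι (S.κ (W t)) = U t

/-- `U'' - gradE(U) = -c U'` on `O`. -/
def SolvesOn (c : ℝ) (U : ℝ → L) (O : Set ℝ) : Prop :=
  ∀ t ∈ O, ∃ x : K, S.ι (S.κ x) = U t ∧ deriv (deriv U) t - S.gradE x = -(c • deriv U t)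

/-- The truncation map decreases the energy (strictly where it moves a point of finite energy),
is nonexpansive, and fixes `F⁻` and `F⁺`; local minimizers with values in its set of fixed points
are regular and solve the equation. -/
structure Regularity : Prop where
  energy_le : ∀ v, S.E (S.trunc v) ≤ S.E v
  energy_eq_iff : ∀ v, S.E v < ⊤ → (S.E (S.trunc v) = S.E v ↔ S.trunc v = v)
  nonexpansive : ∀ v₁ v₂, ‖S.trunc v₁ - S.trunc v₂‖ ≤ ‖v₁ - v₂‖
  fix_minus : ∀ v ∈ S.minus.F, S.trunc v = v
  fix_plus : ∀ v ∈ S.plus.F, S.trunc v = v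
  regular : ∀ c > 0, ∀ α β : ℝ, α < β → ∀ W : ℝ → L, S.IsLocalMinimizer c W α β →
    (∀ t ∈ Ioo α β, W t = S.trunc (W t)) →
      S.RegularOn W (Ioo α β) ∧ S.SolvesOn c W (Ioo α β)

/-- The infimum of `E` over the points whose distance to `F⁻` lies in `[r, r₀⁻]`. -/
def kappaMinus (r : ℝ) : ℝ :=
  sInf {y : ℝ | ∃ v : L, Metric.infDist v S.minus.F ∈ Icc r S.minus.r₀ ∧ S.E v = (y : EReal)}

/-- The constant `η₀⁻`. -/
def etaMinus : ℝ :=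
  min (√((Real.exp 1)⁻¹ * (S.minus.r₀ / 4) * √(2 * (S.kappaMinus (S.minus.r₀ / 4) - S.a))))
    (S.minus.r₀ / 4)

/-- The radius `r₀⁻ / (C⁻ + 1)`. -/
def rHatMinus : ℝ := S.minus.r₀ / (S.minus.C + 1)

/-- The upper bound `E⁻_max` for `-a`. -/
def EmaxMinus : ℝ :=
  1 / (S.minus.C ^ 2 * (S.minus.C + 1)) *
    min (min (S.etaMinus ^ 2 / 4) (S.kappaMinus S.etaMinus - S.a))
      (min (S.minus.β S.rHatMinus) (S.minus.β S.etaMinus))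

/-- The level-set hypothesis. -/
structure LevelSets : Prop where
  neg_a_lt : -S.a < S.EmaxMinus
  negative_subset : {v | S.E v < 0} ⊆ tube S.minus.F (S.minus.r₀ / 2)

/-- The space `X` of admissible curves. -/
def X : Set (ℝ → L) :=
  {U | H1Loc U univ ∧ ∃ T : ℝ, 1 ≤ T ∧
    (∀ t ≥ T, Metric.infDist (U t) S.plus.F ≤ S.plus.r₀ / 2) ∧
    (∀ t ≤ -T, Metric.infDist (U t) S.minus.F ≤ S.minus.r₀ / 2)}

end Setting

end AbstractWave

end

open Set Filter Topology MeasureTheory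

noncomputable section

namespace AbstractWave

set_option linter.unusedSectionVars false

/-! ### Curves in `H¹_loc`: derivative, time change, gluing -/

section

section H1

variable {L : Type*} [NormedAddCommGroup L] [NormedSpace ℝ L]

/-! The wave is a minimizer of the weighted energy at the critical speed, the supremum of the speeds
at which some curve ending near F⁺ has negative energy.

Everything is phrased through a nonnegative quantity. If the potential is nonnegative after time t₀,
adding -a to it up to t₀ makes the integrand nonnegative and costs exactly -a e^{c t₀}/c. So the
sign of the energy is the sign of `shiftedEnergy` minus this constant, and no difference of infinite
quantities appears.

The set of speeds admitting a negative curve is nonempty (an affine ramp with a small speed,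
`exists_negativeCurve`), bounded (after the last negative time the curve must cross a potential
barrier around F⁻ at a cost bounded below, against a budget -a/c, `Profile.speed_le`), and has no
maximum (time rescaling, `NegativeCurve.exists_faster`). At its supremum c the energy is therefore
nonnegative on X.

For a minimizer, take speeds increasing to c with negative curves. Each is translated so that its
last negative time is 0. It then reaches F⁺ for good within a uniform time (`Profile.tail_bound`),
can be moved to have a bounded value at that time (`exists_bounded_profile`), and can be kept near
F⁻ before 0: an excursion away from F⁻ costs more than a direct connection from a point of F⁻
(`excursion_le`, `exists_connection`). This last comparison is where the smallness of -a enters.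
After rescaling to speed c, the curves have a weak limit. Lower semicontinuity, together with the
weak closedness of the tubes, puts it in X with energy at most 0 (`exists_limit_profile`).

Applying `trunc` to the minimizer cannot lower its energy, so the minimizer is pointwise fixed. It
is then a local minimizer on each bounded interval, and the regularity hypothesis makes it a
solution. For a solution, k = ‖U'‖² and e = E(U) satisfy (k/2 - e)' = -c k. Integrating against
e^{dt} with d < c shows that its energy at speed d is negative, hence uniqueness of the speed. With
the weight e^{2ct}, the same identity gives exponential decay of the tail energy, hence convergence.
-/

theorem locallyIntegrable_of_memLp_Icc {g : ℝ → L}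
    (hg : ∀ s t : ℝ, MemLp g 2 (volume.restrict (Icc s t))) : LocallyIntegrable g volume := by
  rw [locallyIntegrable_iff]
  intro k hk
  obtain ⟨a, ha⟩ := hk.bddBelow
  obtain ⟨b, hb⟩ := hk.bddAbove
  have h1 : IntegrableOn g (Icc a b) := (hg a b).integrable (by norm_num)
  exact h1.mono_set fun x hx => ⟨ha hx, hb hx⟩

theorem H1Loc.exists_primitive {U : ℝ → L} (h : H1Loc U univ) :
    ∃ g : ℝ → L, (∀ s t : ℝ, MemLp g 2 (volume.restrict (Icc s t))) ∧
      ∀ s t : ℝ, U t - U s = ∫ x in s..t, g x := by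
  obtain ⟨g, hg⟩ := h
  refine ⟨g, fun s t => ?_, fun s t => ?_⟩
  · rcases le_total s t with hst | hst
    · exact (hg s trivial t trivial hst).1
    · have hsub : Icc s t ⊆ Icc t s := fun x hx => ⟨hst.trans hx.1, hx.2.trans hst⟩
      exact ((hg t trivial s trivial hst).1).mono_measure (Measure.restrict_mono hsub le_rfl)
  · rcases le_total s t with hst | hst
    · exact (hg s trivial t trivial hst).2
    · rw [intervalIntegral.integral_symm, ← (hg t trivial s trivial hst).2]; abel

theorem h1Loc_of_primitive {U g : ℝ → L} (hg : ∀ s t : ℝ, MemLp g 2 (volume.restrict (Icc s t)))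
    (hU : ∀ t : ℝ, U t = U 0 + ∫ x in (0 : ℝ)..t, g x) : H1Loc U univ := by
  have hli := locallyIntegrable_of_memLp_Icc hg
  have hi : ∀ x y, IntervalIntegrable g volume x y := fun x y =>
    intervalIntegrable_iff.mpr <|
      (hli.integrableOn_isCompact isCompact_uIcc).mono_set uIoc_subset_uIcc
  refine ⟨g, fun s _ t _ _ => ⟨hg s t, ?_⟩⟩
  rw [hU t, hU s, add_sub_add_left_eq_sub, intervalIntegral.integral_interval_sub_left (hi _ _) (hi _ _)]

variable [CompleteSpace L]

/-- Lebesgue differentiation identifies the unspecified density of `H1Loc` with `deriv U` almost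
everywhere, so that later estimates, like the energy itself, involve only `deriv U`. -/
theorem H1Loc.ae_hasDerivAt {U : ℝ → L} (h : H1Loc U univ) :
    ∃ g : ℝ → L, (∀ s t : ℝ, MemLp g 2 (volume.restrict (Icc s t))) ∧
      (∀ s t : ℝ, U t - U s = ∫ x in s..t, g x) ∧ ∀ᵐ t, HasDerivAt U (g t) t := by
  obtain ⟨g, hg, hU⟩ := h.exists_primitive
  refine ⟨g, hg, hU, ?_⟩
  filter_upwards [LocallyIntegrable.ae_hasDerivAt_integral (locallyIntegrable_of_memLp_Icc hg)] with t ht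
  have : U = fun x => U 0 + ∫ (t : ℝ) in (0 : ℝ)..x, g t := by
    funext x; rw [← hU 0 x]; abel
  rw [this]
  exact (ht 0).const_add _

theorem H1Loc.hasDerivAt_deriv {U : ℝ → L} (h : H1Loc U univ) :
    ∀ᵐ t, HasDerivAt U (deriv U t) t := by
  obtain ⟨g, -, -, hd⟩ := h.ae_hasDerivAt
  filter_upwards [hd] with t ht
  exact ht.differentiableAt.hasDerivAt

theorem H1Loc.memLp {U : ℝ → L} (h : H1Loc U univ) (s t : ℝ) :
    MemLp (deriv U) 2 (volume.restrict (Icc s t)) := by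
  obtain ⟨g, hg, -, hd⟩ := h.ae_hasDerivAt
  refine (hg s t).ae_eq (ae_restrict_of_ae ?_)
  filter_upwards [hd] with t ht using ht.deriv.symm

theorem H1Loc.sub_eq {U : ℝ → L} (h : H1Loc U univ) (s t : ℝ) :
    U t - U s = ∫ x in s..t, deriv U x := by
  obtain ⟨g, hg, hU, hd⟩ := h.ae_hasDerivAt
  rw [hU s t]
  refine intervalIntegral.integral_congr_ae ?_
  filter_upwards [hd] with t ht _ using ht.deriv.symm

theorem H1Loc.locallyIntegrable {U : ℝ → L} (h : H1Loc U univ) :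
    LocallyIntegrable (deriv U) volume := locallyIntegrable_of_memLp_Icc h.memLp

theorem H1Loc.intervalIntegrable {U : ℝ → L} (h : H1Loc U univ) (s t : ℝ) :
    IntervalIntegrable (deriv U) volume s t :=
  intervalIntegrable_iff.mpr <|
    (h.locallyIntegrable.integrableOn_isCompact isCompact_uIcc).mono_set uIoc_subset_uIcc

theorem H1Loc.intervalIntegrable_sq {U : ℝ → L} (h : H1Loc U univ) (s t : ℝ) :
    IntervalIntegrable (fun x => ‖deriv U x‖ ^ 2) volume s t := by
  rw [intervalIntegrable_iff]
  have h1 : IntegrableOn (fun x => ‖deriv U x‖ ^ 2) (Icc (min s t) (max s t)) :=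
    (h.memLp _ _).integrable_norm_pow (by norm_num)
  exact h1.mono_set Ioc_subset_Icc_self

theorem H1Loc.continuous {U : ℝ → L} (h : H1Loc U univ) : Continuous U := by
  have : U = fun x => U 0 + ∫ (t : ℝ) in (0 : ℝ)..x, deriv U t := by
    funext x; rw [← h.sub_eq 0 x]; abel
  rw [this]
  exact continuous_const.add
    (intervalIntegral.continuous_primitive (fun a b => h.intervalIntegrable a b) 0)

theorem measurable_norm_deriv (U : ℝ → L) : Measurable fun t => ‖deriv U t‖ := by
  borelize L
  exact (measurable_deriv U).norm

theorem H1Loc.comp_affine {U : ℝ → L} (h : H1Loc U univ) {l : ℝ} (hl : 0 < l) (b : ℝ) :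
    H1Loc (fun t => U (l * t + b)) univ := by
  obtain ⟨g, hg, hU⟩ := h.exists_primitive
  refine h1Loc_of_primitive (g := fun t => l • g (l * t + b)) (fun s t => ?_) fun t => ?_
  · refine MemLp.const_smul ?_ l
    have he : MeasurableEmbedding fun t : ℝ => l * t + b :=
      ((Homeomorph.mulLeft₀ l hl.ne').trans (Homeomorph.addRight b)).measurableEmbedding
    have h1 := hg (l * s + b) (l * t + b)
    have h2 : (fun x : ℝ => l * x + b) ⁻¹' Icc (l * s + b) (l * t + b) = Icc s t := by
      ext x; simp [hl]
    have h3 : Measure.map (fun t : ℝ => l * t + b) (volume.restrict (Icc s t)) =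
        ENNReal.ofReal l⁻¹ • volume.restrict (Icc (l * s + b) (l * t + b)) := by
      rw [← h2, ← he.restrict_map, ← Measure.restrict_smul]
      congr 1
      have : (fun t : ℝ => l * t + b) = (fun x => x + b) ∘ fun t => l * t := rfl
      rw [this, ← Measure.map_map (measurable_add_const b) (measurable_const_mul l),
        Real.map_volume_mul_left hl.ne', Measure.map_smul, map_add_right_eq_self,
        abs_of_pos (inv_pos.2 hl)]
    have h4 : MemLp g 2 (Measure.map (fun t : ℝ => l * t + b) (volume.restrict (Icc s t))) := by
      rw [h3]; exact h1.smul_measure ENNReal.ofReal_ne_top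
    exact (he.memLp_map_measure_iff).1 h4
  · have h1 := hU b (l * t + b)
    simp only [mul_zero, zero_add, intervalIntegral.integral_smul,
      intervalIntegral.smul_integral_comp_mul_add]
    rw [← h1]; abel

theorem h1Loc_affine (p v : L) (b : ℝ) : H1Loc (fun t => p + (t - b) • v) univ := by
  refine h1Loc_of_primitive (g := fun _ => v) (fun s t => memLp_const v) fun t => ?_
  simp [sub_smul]
  abel

theorem h1Loc_const (p : L) : H1Loc (fun _ => p) univ := by
  simpa using h1Loc_affine p 0 0

/-- The curve equal to `V` before time `b` and to `U` from then on. -/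
def glue (V U : ℝ → L) (b : ℝ) (t : ℝ) : L := if t < b then V t else U t

theorem glue_of_lt (V U : ℝ → L) {b t : ℝ} (h : t < b) : glue V U b t = V t := if_pos h

theorem glue_of_ge (V U : ℝ → L) {b t : ℝ} (h : b ≤ t) : glue V U b t = U t := if_neg h.not_gt

theorem glue_of_le {V U : ℝ → L} {b t : ℝ} (hb : V b = U b) (h : t ≤ b) : glue V U b t = V t := by
  rcases h.lt_or_eq with h | rfl
  · exact glue_of_lt V U h
  · rw [glue_of_ge V U le_rfl, hb]

theorem deriv_glue_of_lt (V U : ℝ → L) {b t : ℝ} (h : t < b) :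
    deriv (glue V U b) t = deriv V t := by
  refine Filter.EventuallyEq.deriv_eq ?_
  filter_upwards [Iio_mem_nhds h] with x hx using glue_of_lt V U hx

theorem deriv_glue_of_gt (V U : ℝ → L) {b t : ℝ} (h : b < t) :
    deriv (glue V U b) t = deriv U t := by
  refine Filter.EventuallyEq.deriv_eq ?_
  filter_upwards [Ioi_mem_nhds h] with x hx using glue_of_ge V U hx.le

theorem H1Loc.glue {V U : ℝ → L} (hV : H1Loc V univ) (hU : H1Loc U univ) {b : ℝ}
    (hb : V b = U b) : H1Loc (AbstractWave.glue V U b) univ := by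
  set g : ℝ → L := (Iio b).piecewise (deriv V) (deriv U) with hgdef
  have hg : ∀ s t : ℝ, MemLp g 2 (volume.restrict (Icc s t)) := fun s t =>
    MemLp.piecewise measurableSet_Iio ((hV.memLp s t).restrict _) ((hU.memLp s t).restrict _)
  have hli := locallyIntegrable_of_memLp_Icc hg
  have hi : ∀ x y, IntervalIntegrable g volume x y := fun x y =>
    intervalIntegrable_iff.mpr <|
      (hli.integrableOn_isCompact isCompact_uIcc).mono_set uIoc_subset_uIcc
  have key : ∀ t, AbstractWave.glue V U b t = U b + ∫ x in b..t, g x := by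
    intro t
    rcases le_total t b with h | h
    · rw [glue_of_le hb h, ← hb]
      have : ∫ x in b..t, g x = ∫ x in b..t, deriv V x := by
        refine intervalIntegral.integral_congr_ae ?_
        have : ∀ᵐ x : ℝ, x ≠ b := by simp [ae_iff, measure_singleton]
        filter_upwards [this] with x hx hx'
        rw [uIoc_of_ge h] at hx'
        exact piecewise_eq_of_mem _ _ _ (lt_of_le_of_ne hx'.2 hx)
      rw [this, ← hV.sub_eq]; abel
    · rw [glue_of_ge _ _ h]
      have : ∫ x in b..t, g x = ∫ x in b..t, deriv U x := by
        refine intervalIntegral.integral_congr_ae (ae_of_all _ fun x hx' => ?_)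
        rw [uIoc_of_le h] at hx'
        exact piecewise_eq_of_notMem _ _ _ (not_lt.2 hx'.1.le)
      rw [this, ← hU.sub_eq]; abel
  refine h1Loc_of_primitive hg fun t => ?_
  rw [key t, key 0, add_assoc, intervalIntegral.integral_add_adjacent_intervals (hi _ _) (hi _ _)]

end H1

end

/-! ### Crossings, travel costs, weak compactness in a Hilbert space -/

section

/-- A continuous function going from a value at most `α` to a value at least `β` has a
subinterval on which it goes from `α` to `β` while staying strictly between them. -/
theorem exists_crossing {f : ℝ → ℝ} (hf : Continuous f) {s t α β : ℝ} (hst : s ≤ t) (hαβ : α < β)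
    (hs : f s ≤ α) (ht : β ≤ f t) :
    ∃ s' t', s ≤ s' ∧ s' < t' ∧ t' ≤ t ∧ f s' = α ∧ f t' = β ∧ ∀ x ∈ Ioo s' t', α < f x ∧ f x < β := by
  set B : Set ℝ := Icc s t ∩ f ⁻¹' Ici β with hB
  have hBc : IsCompact B := isCompact_Icc.inter_right (isClosed_Ici.preimage hf)
  have hBn : B.Nonempty := ⟨t, ⟨hst, le_rfl⟩, ht⟩
  obtain ⟨t', ⟨ht'1, ht'2⟩, ht'min⟩ := hBc.exists_isLeast hBn
  have ht'β : f t' = β := by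
    refine le_antisymm ?_ ht'2
    by_contra! hlt
    obtain ⟨x, hx, hfx⟩ := intermediate_value_Icc ht'1.1 hf.continuousOn
      ⟨hs.trans hαβ.le, hlt.le⟩
    have := ht'min (⟨⟨hx.1, hx.2.trans ht'1.2⟩, hfx.ge⟩ : x ∈ B)
    have : x = t' := le_antisymm hx.2 this
    rw [this] at hfx; exact hlt.ne' hfx
  set A : Set ℝ := Icc s t' ∩ f ⁻¹' Iic α with hA
  have hAc : IsCompact A := isCompact_Icc.inter_right (isClosed_Iic.preimage hf)
  obtain ⟨s', ⟨hs'1, hs'2⟩, hs'max⟩ := hAc.exists_isGreatest ⟨s, ⟨le_rfl, ht'1.1⟩, hs⟩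
  have hs'α : f s' = α := by
    refine le_antisymm hs'2 ?_
    by_contra! hlt
    obtain ⟨x, hx, hfx⟩ := intermediate_value_Icc hs'1.2 hf.continuousOn
      ⟨hlt.le, hαβ.le.trans ht'β.ge⟩
    have := hs'max (⟨⟨hs'1.1.trans hx.1, hx.2⟩, hfx.le⟩ : x ∈ A)
    have : x = s' := le_antisymm this hx.1
    rw [this] at hfx; exact hlt.ne hfx
  refine ⟨s', t', hs'1.1, lt_of_le_of_ne hs'1.2 ?_, ht'1.2, hs'α, ht'β, fun x hx => ⟨?_, ?_⟩⟩
  · rintro rfl; rw [hs'α] at ht'β; exact hαβ.ne ht'β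
  · by_contra! h
    exact absurd (hs'max (⟨⟨hs'1.1.trans hx.1.le, hx.2.le⟩, h⟩ : x ∈ A)) (not_le.2 hx.1)
  · by_contra! h
    exact absurd (ht'min (⟨⟨hs'1.1.trans hx.1.le, hx.2.le.trans ht'1.2⟩, h⟩ : x ∈ B))
      (not_le.2 hx.2)

section Travel

variable {L : Type*} [NormedAddCommGroup L] [NormedSpace ℝ L] [CompleteSpace L]

theorem H1Loc.norm_sub_le {U : ℝ → L} (h : H1Loc U univ) {s t : ℝ} (hst : s ≤ t) :
    ‖U t - U s‖ ≤ ∫ x in s..t, ‖deriv U x‖ := by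
  rw [h.sub_eq]
  exact intervalIntegral.norm_integral_le_integral_norm hst

theorem H1Loc.intervalIntegrable_weighted {U : ℝ → L} (h : H1Loc U univ) (c s t : ℝ) :
    IntervalIntegrable (fun x => Real.exp (c * x) * ‖deriv U x‖ ^ 2) volume s t :=
  (h.intervalIntegrable_sq s t).continuousOn_mul (by fun_prop)

/-- Cauchy–Schwarz against the weight, with ∫_s^t e^{-cx} dx ≤ e^{-cs}/c. The bound does not depend
on the length of the interval. -/
theorem H1Loc.norm_sub_sq_le {U : ℝ → L} (h : H1Loc U univ) {c : ℝ} (hc : 0 < c) {s t : ℝ}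
    (hst : s ≤ t) :
    c * Real.exp (c * s) * ‖U t - U s‖ ^ 2 ≤ ∫ x in s..t, Real.exp (c * x) * ‖deriv U x‖ ^ 2 := by
  set I := ∫ x in s..t, Real.exp (c * x) * ‖deriv U x‖ ^ 2 with hI
  have hI0 : 0 ≤ I := intervalIntegral.integral_nonneg hst fun x _ => by positivity
  set d := ‖U t - U s‖ with hd
  rcases (norm_nonneg _ : 0 ≤ d).eq_or_lt with h0 | h0
  · have h0' : d = 0 := h0.symm
    rw [h0']; simpa using hI0
  have hexp : ∫ x in s..t, Real.exp (-(c * x)) ≤ Real.exp (-(c * s)) / c := by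
    have : ∀ x ∈ uIcc s t, HasDerivAt (fun x => -(Real.exp (-(c * x)) / c)) (Real.exp (-(c * x))) x := by
      intro x _
      have h1 : HasDerivAt (fun x : ℝ => -(c * x)) (-c) x := by
        simpa using ((hasDerivAt_id' x).const_mul c).fun_neg
      refine ((h1.exp.div_const c).fun_neg).congr_deriv ?_
      field_simp
    rw [intervalIntegral.integral_eq_sub_of_hasDerivAt this
      (Continuous.intervalIntegrable (by fun_prop) _ _)]
    have : 0 < Real.exp (-(c * t)) / c := by positivity
    linarith
  -- Cauchy–Schwarz is obtained from Young's inequality with parameter θ. This value makes the term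
  -- without I equal to d/2, which is absorbed on the left.
  set θ := Real.exp (-(c * s)) / (c * d) with hθ
  have hθ0 : 0 < θ := by positivity
  have key : d ≤ θ / 2 * I + 1 / (2 * θ) * (Real.exp (-(c * s)) / c) := by
    calc d ≤ ∫ x in s..t, ‖deriv U x‖ := h.norm_sub_le hst
      _ ≤ ∫ x in s..t, (θ / 2 * (Real.exp (c * x) * ‖deriv U x‖ ^ 2)
            + 1 / (2 * θ) * Real.exp (-(c * x))) := by
          refine intervalIntegral.integral_mono_on hst (h.intervalIntegrable s t).norm
            (((h.intervalIntegrable_weighted c s t).const_mul _).add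
              (Continuous.intervalIntegrable (by fun_prop) _ _)) fun x _ => ?_
          rw [Real.exp_neg]
          have he := Real.exp_pos (c * x)
          have : θ / 2 * (Real.exp (c * x) * ‖deriv U x‖ ^ 2)
              + 1 / (2 * θ) * (Real.exp (c * x))⁻¹ - ‖deriv U x‖
              = (θ * Real.exp (c * x) * ‖deriv U x‖ - 1) ^ 2 / (2 * θ * Real.exp (c * x)) := by
            field_simp; ring
          have h2 : 0 ≤ (θ * Real.exp (c * x) * ‖deriv U x‖ - 1) ^ 2 / (2 * θ * Real.exp (c * x)) := by
            positivity
          linarith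
      _ = θ / 2 * I + 1 / (2 * θ) * ∫ x in s..t, Real.exp (-(c * x)) := by
          rw [intervalIntegral.integral_add ((h.intervalIntegrable_weighted c s t).const_mul _)
              (Continuous.intervalIntegrable (by fun_prop) _ _),
            intervalIntegral.integral_const_mul, intervalIntegral.integral_const_mul]
      _ ≤ _ := by gcongr
  have e1 : 1 / (2 * θ) * (Real.exp (-(c * s)) / c) = d / 2 := by
    rw [hθ]; field_simp
  have e2 : θ / 2 * I = I / (2 * (c * Real.exp (c * s) * d)) := by
    rw [hθ, Real.exp_neg]; field_simp
  rw [e1, e2] at key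
  have h3 : d / 2 ≤ I / (2 * (c * Real.exp (c * s) * d)) := by linarith
  rw [le_div_iff₀ (by positivity)] at h3
  nlinarith

/-- The weighted kinetic energy density. -/
def kin (c : ℝ) (U : ℝ → L) (t : ℝ) : ENNReal :=
  ENNReal.ofReal (Real.exp (c * t)) * ENNReal.ofReal (‖deriv U t‖ ^ 2 / 2)

theorem measurable_kin (c : ℝ) (U : ℝ → L) : Measurable (kin c U) := by
  have := measurable_norm_deriv U
  unfold kin
  fun_prop

theorem kin_eq (c : ℝ) (U : ℝ → L) (t : ℝ) :
    kin c U t = ENNReal.ofReal (Real.exp (c * t) * (‖deriv U t‖ ^ 2 / 2)) :=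
  (ENNReal.ofReal_mul (Real.exp_pos _).le).symm

theorem H1Loc.ofReal_norm_sub_sq_le {U : ℝ → L} (h : H1Loc U univ) {c : ℝ} (hc : 0 < c) {s t : ℝ}
    (hst : s ≤ t) :
    ENNReal.ofReal (c / 2 * Real.exp (c * s) * ‖U t - U s‖ ^ 2) ≤ ∫⁻ x in Ioc s t, kin c U x := by
  have h1 := h.norm_sub_sq_le hc hst
  have h2 := (h.intervalIntegrable_weighted c s t).div_const 2
  simp_rw [kin_eq, ← mul_div_assoc]
  rw [← ofReal_integral_eq_lintegral_ofReal ((intervalIntegrable_iff_integrableOn_Ioc_of_le hst).1 h2)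
    (ae_of_all _ fun x => by positivity), ← intervalIntegral.integral_of_le hst,
    intervalIntegral.integral_div]
  exact ENNReal.ofReal_le_ofReal (by linarith)

/-- Since √(2k)‖U'‖ ≤ ‖U'‖²/2 + k, travelling where the potential is at least k costs at least √(2k)
times the distance covered, whatever the time taken. -/
theorem H1Loc.ofReal_norm_sub_le {U : ℝ → L} (h : H1Loc U univ) {c : ℝ} (hc : 0 < c) {s t : ℝ}
    (hst : s ≤ t) {k : ℝ} (hk : 0 ≤ k) :
    ENNReal.ofReal (Real.exp (c * s) * √(2 * k) * ‖U t - U s‖) ≤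
      ∫⁻ x in Ioc s t, (kin c U x + ENNReal.ofReal (Real.exp (c * x)) * ENNReal.ofReal k) := by
  have h2 : IntervalIntegrable
      (fun x => Real.exp (c * x) * (‖deriv U x‖ ^ 2 / 2) + Real.exp (c * x) * k) volume s t := by
    refine IntervalIntegrable.add ?_ (Continuous.intervalIntegrable (by fun_prop) _ _)
    simpa only [mul_div_assoc] using (h.intervalIntegrable_weighted c s t).div_const 2
  have h3 : ∀ x, kin c U x + ENNReal.ofReal (Real.exp (c * x)) * ENNReal.ofReal k =
      ENNReal.ofReal (Real.exp (c * x) * (‖deriv U x‖ ^ 2 / 2) + Real.exp (c * x) * k) := by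
    intro x
    rw [kin_eq, ← ENNReal.ofReal_mul (Real.exp_pos _).le, ← ENNReal.ofReal_add] <;> positivity
  simp_rw [h3]
  rw [← ofReal_integral_eq_lintegral_ofReal ((intervalIntegrable_iff_integrableOn_Ioc_of_le hst).1 h2)
    (ae_of_all _ fun x => by positivity), ← intervalIntegral.integral_of_le hst]
  refine ENNReal.ofReal_le_ofReal ?_
  calc Real.exp (c * s) * √(2 * k) * ‖U t - U s‖
      ≤ Real.exp (c * s) * √(2 * k) * ∫ x in s..t, ‖deriv U x‖ := by
        gcongr; exact h.norm_sub_le hst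
    _ = ∫ x in s..t, Real.exp (c * s) * √(2 * k) * ‖deriv U x‖ := by
        rw [intervalIntegral.integral_const_mul]
    _ ≤ _ := by
        refine intervalIntegral.integral_mono_on hst ((h.intervalIntegrable s t).norm.const_mul _) h2
          fun x hx => ?_
        have h4 : Real.exp (c * s) ≤ Real.exp (c * x) :=
          Real.exp_le_exp.2 (mul_le_mul_of_nonneg_left hx.1 hc.le)
        have h5 : √(2 * k) * ‖deriv U x‖ ≤ ‖deriv U x‖ ^ 2 / 2 + k := by
          nlinarith [sq_nonneg (√(2 * k) - ‖deriv U x‖), Real.sq_sqrt (by positivity : 0 ≤ 2 * k)]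
        calc Real.exp (c * s) * √(2 * k) * ‖deriv U x‖
            = Real.exp (c * s) * (√(2 * k) * ‖deriv U x‖) := by ring
          _ ≤ Real.exp (c * x) * (‖deriv U x‖ ^ 2 / 2 + k) := by gcongr
          _ = _ := by ring

end Travel

section Weak

variable {X : Type*} [NormedAddCommGroup X] [InnerProductSpace ℝ X]

/-- Weak convergence of a sequence in an inner product space. -/
def WeakTendsto (u : ℕ → X) (v : X) : Prop :=
  ∀ y, Tendsto (fun n => inner ℝ (u n) y) atTop (𝓝 (inner ℝ v y))

theorem WeakTendsto.comp {u : ℕ → X} {v : X} (h : WeakTendsto u v) {φ : ℕ → ℕ}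
    (hφ : StrictMono φ) : WeakTendsto (u ∘ φ) v := fun y => (h y).comp hφ.tendsto_atTop

theorem WeakTendsto.norm_le {u : ℕ → X} {v : X} (h : WeakTendsto u v) {r : ℝ}
    (hr : ∃ᶠ n in atTop, ‖u n‖ ≤ r) : ‖v‖ ≤ r := by
  rcases (norm_nonneg v).eq_or_lt with h0 | h0
  · obtain ⟨n, hn⟩ := hr.exists
    rw [← h0]; exact (norm_nonneg _).trans hn
  have h1 : inner ℝ v v ≤ r * ‖v‖ := by
    by_contra! hlt
    have h2 := (h v).eventually (lt_mem_nhds hlt)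
    obtain ⟨n, hn1, hn2⟩ := (hr.and_eventually h2).exists
    have := real_inner_le_norm (u n) v
    nlinarith
  rw [real_inner_self_eq_norm_sq] at h1
  nlinarith

theorem WeakTendsto.sub_of_tendsto {u w : ℕ → X} {v z : X} (h : WeakTendsto u v)
    (hw : Tendsto w atTop (𝓝 z)) : WeakTendsto (fun n => u n - w n) (v - z) := fun y => by
  simp_rw [inner_sub_left]
  exact (h y).sub (hw.inner tendsto_const_nhds)

/-- No separability is assumed: the extraction only has to make the products with the countably many
vectors `u k` converge. The set of y on which the products converge is then a closed subspace
containing all `u k`, and its orthogonal complement is contained in it, so it is the whole space. -/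
theorem exists_weakTendsto_subseq [CompleteSpace X] (u : ℕ → X) {R : ℝ} (hR : ∀ n, ‖u n‖ ≤ R) :
    ∃ v : X, ∃ φ : ℕ → ℕ, StrictMono φ ∧ WeakTendsto (u ∘ φ) v := by
  have hR0 : 0 ≤ R := (norm_nonneg _).trans (hR 0)
  -- A countable product of compact intervals is sequentially compact; this replaces the diagonal
  -- extraction.
  have hcpt : IsCompact (Set.pi univ fun _ : ℕ => Icc (-(R * R)) (R * R)) :=
    isCompact_univ_pi fun _ => isCompact_Icc
  obtain ⟨f, -, φ, hφ, hf⟩ := hcpt.tendsto_subseq (x := fun n k => (inner ℝ (u n) (u k) : ℝ))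
    fun n k _ => abs_le.1 ((abs_real_inner_le_norm _ _).trans
      (mul_le_mul (hR n) (hR k) (norm_nonneg _) hR0))
  rw [tendsto_pi_nhds] at hf
  let M : Submodule ℝ X :=
    { carrier := {y | CauchySeq fun n => (inner ℝ (u (φ n)) y : ℝ)}
      add_mem' := fun {a b} ha hb => by
        change CauchySeq _ at ha hb ⊢
        simp only [inner_add_right]
        exact ha.add hb
      zero_mem' := by simpa using cauchySeq_const (0 : ℝ)
      smul_mem' := fun r a ha => by
        change CauchySeq _ at ha ⊢
        simp only [inner_smul_right]
        exact (uniformContinuous_const_smul r).comp_cauchySeq ha }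
  have hM : ∀ y, y ∈ M ↔ CauchySeq fun n => (inner ℝ (u (φ n)) y : ℝ) := fun y => Iff.rfl
  have hclosed : IsClosed (M : Set X) := by
    refine isClosed_of_closure_subset fun y hy => ?_
    change CauchySeq _
    rw [Metric.cauchySeq_iff']
    intro ε hε
    obtain ⟨z, hz, hyz⟩ := Metric.mem_closure_iff.1 hy (ε / (4 * (R + 1))) (by positivity)
    obtain ⟨N, hN⟩ := Metric.cauchySeq_iff'.1 ((hM z).1 hz) (ε / 2) (by positivity)
    refine ⟨N, fun n hn => ?_⟩
    have h1 := hN n hn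
    rw [Real.dist_eq] at h1 ⊢
    have h2 : ∀ m, |(inner ℝ (u (φ m)) (y - z) : ℝ)| < ε / 4 := fun m => by
      calc |(inner ℝ (u (φ m)) (y - z) : ℝ)| ≤ ‖u (φ m)‖ * ‖y - z‖ := abs_real_inner_le_norm _ _
        _ ≤ (R + 1) * ‖y - z‖ := by gcongr; linarith [hR (φ m)]
        _ < (R + 1) * (ε / (4 * (R + 1))) := by
            rw [dist_eq_norm] at hyz; gcongr
        _ = ε / 4 := by field_simp
    have h3 := h2 n
    have h4 := h2 N
    rw [inner_sub_right] at h3 h4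
    rw [abs_lt] at *
    constructor <;> linarith [h1.1, h1.2, h3.1, h3.2, h4.1, h4.2]
  have hu : ∀ k, u k ∈ M := fun k => (hf k).cauchySeq
  have htop : M = ⊤ := by
    have : CompleteSpace M := hclosed.completeSpace_coe
    rw [← Submodule.orthogonal_eq_bot_iff, Submodule.eq_bot_iff]
    intro z hz
    have h0 : ∀ k, (inner ℝ (u k) z : ℝ) = 0 := fun k => (Submodule.mem_orthogonal M z).1 hz _ (hu k)
    -- A vector orthogonal to all `u k` has constant zero products with them, hence lies in M and is
    -- orthogonal to itself.
    have hzM : z ∈ M := by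
      rw [hM]; simp_rw [h0]; exact cauchySeq_const 0
    exact inner_self_eq_zero.1 ((Submodule.mem_orthogonal M z).1 hz z hzM)
  have hlim : ∀ y, ∃ l, Tendsto (fun n => (inner ℝ (u (φ n)) y : ℝ)) atTop (𝓝 l) := fun y =>
    cauchySeq_tendsto_of_complete ((hM y).1 (htop ▸ Submodule.mem_top))
  choose l hl using hlim
  let T : X →L[ℝ] ℝ := continuousLinearMapOfTendsto (fun n => innerSL ℝ (u (φ n))) (f := l)
    (tendsto_pi_nhds.2 hl)
  refine ⟨(InnerProductSpace.toDual ℝ X).symm T, φ, hφ, fun y => ?_⟩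
  rw [InnerProductSpace.toDual_symm_apply]
  exact hl y

end Weak

end

/-! ### Weak compactness in `L²`, nonexpansive images of curves -/

section

section L2

variable {L : Type*} [NormedAddCommGroup L] [InnerProductSpace ℝ L] [CompleteSpace L]
  {μ : Measure ℝ}

theorem inner_toLp_toLp {f g : ℝ → L} (hf : MemLp f 2 μ) (hg : MemLp g 2 μ) :
    (inner ℝ (hf.toLp f) (hg.toLp g) : ℝ) = ∫ x, inner ℝ (f x) (g x) ∂μ := by
  rw [L2.inner_def]
  refine integral_congr_ae ?_
  filter_upwards [hf.coeFn_toLp, hg.coeFn_toLp] with x h1 h2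
  rw [h1, h2]

theorem norm_toLp_sq {f : ℝ → L} (hf : MemLp f 2 μ) :
    ‖hf.toLp f‖ ^ 2 = ∫ x, ‖f x‖ ^ 2 ∂μ := by
  rw [← real_inner_self_eq_norm_sq, inner_toLp_toLp]
  simp_rw [real_inner_self_eq_norm_sq]

/-- Weak sequential compactness of bounded sequences of square integrable functions. -/
theorem exists_weak_subseq_L2 {f : ℕ → ℝ → L} (hf : ∀ n, MemLp (f n) 2 μ) {B : ℝ}
    (hB : ∀ n, ∫ x, ‖f n x‖ ^ 2 ∂μ ≤ B) :
    ∃ g : ℝ → L, MemLp g 2 μ ∧ ∃ φ : ℕ → ℕ, StrictMono φ ∧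
      (∀ ψ : ℝ → L, MemLp ψ 2 μ →
        Tendsto (fun n => ∫ x, inner ℝ (f (φ n) x) (ψ x) ∂μ) atTop
          (𝓝 (∫ x, inner ℝ (g x) (ψ x) ∂μ))) ∧
      ∃ κ, Tendsto (fun n => ∫ x, ‖f (φ n) x‖ ^ 2 ∂μ) atTop (𝓝 κ) ∧ ∫ x, ‖g x‖ ^ 2 ∂μ ≤ κ := by
  have hbound : ∀ n, ‖(hf n).toLp (f n)‖ ≤ √B := fun n =>
    Real.le_sqrt_of_sq_le ((norm_toLp_sq (hf n)).le.trans (hB n))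
  obtain ⟨v, φ, hφ, hv⟩ := exists_weakTendsto_subseq (fun n => (hf n).toLp (f n)) hbound
  have hnn : ∀ n, 0 ≤ ∫ x, ‖f n x‖ ^ 2 ∂μ := fun n => integral_nonneg fun x => by positivity
  -- A second extraction makes the squared norms converge, not merely stay bounded. Their limit is
  -- later subtracted from the total energy.
  obtain ⟨κ, hκ, φ', hφ', hlim⟩ := (isCompact_Icc (a := 0) (b := B)).tendsto_subseq
    (x := fun n => ∫ x, ‖f (φ n) x‖ ^ 2 ∂μ) fun n => ⟨hnn _, hB _⟩
  have hvm : MemLp v 2 μ := Lp.memLp v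
  have hve : hvm.toLp v = v := Lp.toLp_coeFn v hvm
  have hv' := hv.comp hφ'
  refine ⟨v, hvm, φ ∘ φ', hφ.comp hφ', fun ψ hψ => ?_, κ, hlim, ?_⟩
  · have := hv' (hψ.toLp ψ)
    rw [← hve, inner_toLp_toLp] at this
    simpa only [Function.comp_apply, inner_toLp_toLp] using this
  · rw [← norm_toLp_sq hvm, hve]
    refine le_of_forall_pos_le_add fun ε hε => ?_
    have hev := hlim.eventually (gt_mem_nhds (lt_add_of_pos_right κ hε))
    have := hv'.norm_le (r := √(κ + ε)) (hev.mono fun n hn =>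
      Real.le_sqrt_of_sq_le ((norm_toLp_sq (hf (φ (φ' n)))).le.trans (le_of_lt hn))).frequently
    have hκ0 := hκ.1
    calc ‖v‖ ^ 2 ≤ √(κ + ε) ^ 2 := by gcongr
      _ = κ + ε := Real.sq_sqrt (by linarith)

end L2

section Lipschitz

variable {L : Type*} [NormedAddCommGroup L] [InnerProductSpace ℝ L] [CompleteSpace L]

theorem H1Loc.norm_sub_sq_le_length {U : ℝ → L} (h : H1Loc U univ) {s t : ℝ} (hst : s < t) :
    ‖U t - U s‖ ^ 2 ≤ (t - s) * ∫ x in s..t, ‖deriv U x‖ ^ 2 := by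
  set I := ∫ x in s..t, ‖deriv U x‖ ^ 2 with hI
  have hI0 : 0 ≤ I := intervalIntegral.integral_nonneg hst.le fun x _ => by positivity
  set d := ‖U t - U s‖ with hd
  have hd0 : 0 ≤ d := norm_nonneg _
  have hts := sub_pos.2 hst
  have key : ∫ x in s..t, (2 * d / (t - s) * ‖deriv U x‖) ≤
      ∫ x in s..t, (‖deriv U x‖ ^ 2 + (d / (t - s)) ^ 2) := by
    refine intervalIntegral.integral_mono_on hst.le ((h.intervalIntegrable s t).norm.const_mul _)
      ((h.intervalIntegrable_sq s t).add (by simp)) fun x _ => ?_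
    have := two_mul_le_add_sq (d / (t - s)) ‖deriv U x‖
    rw [mul_div_assoc]; linarith
  rw [intervalIntegral.integral_const_mul, intervalIntegral.integral_add (h.intervalIntegrable_sq s t)
    (by simp), intervalIntegral.integral_const, smul_eq_mul] at key
  have h1 := h.norm_sub_le hst.le
  have h2 : 2 * d / (t - s) * d ≤ I + (t - s) * (d / (t - s)) ^ 2 :=
    le_trans (by gcongr) key
  have h3 : (t - s) * (d / (t - s)) ^ 2 = d ^ 2 / (t - s) := by field_simp
  have h4 : 2 * d / (t - s) * d = 2 * (d ^ 2 / (t - s)) := by field_simp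
  have h5 : d ^ 2 / (t - s) ≤ I := by linarith
  rw [div_le_iff₀ hts] at h5
  linarith

theorem tendsto_average_right {V : ℝ → L} (hV : Continuous V) (t : ℝ) :
    Tendsto (fun n : ℕ => ((n : ℝ) + 1) • ∫ x in t..(t + 1 / ((n : ℝ) + 1)), V x) atTop
      (𝓝 (V t)) := by
  have h1 : HasDerivAt (fun u => ∫ x in t..u, V x) (V t) t :=
    intervalIntegral.integral_hasDerivAt_right (hV.intervalIntegrable _ _)
      hV.stronglyMeasurable.stronglyMeasurableAtFilter hV.continuousAt
  rw [hasDerivAt_iff_tendsto_slope_zero] at h1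
  have h2 : Tendsto (fun n : ℕ => 1 / ((n : ℝ) + 1)) atTop (𝓝[≠] 0) :=
    tendsto_nhdsWithin_iff.2 ⟨tendsto_one_div_add_atTop_nhds_zero_nat,
      Eventually.of_forall fun n => by
        simp only [mem_compl_iff, mem_singleton_iff]; positivity⟩
  exact (h1.comp h2).congr fun n => by simp

variable {U V : ℝ → L}

/-- The difference quotients of V are bounded in `L²(a, b)` by those of U, hence by the kinetic
energy of U on a slightly larger interval. A weak limit of them is the derivative of V; this uses
the Hilbert structure, as Lipschitz control alone would not give a derivative in a general Banach
space. -/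
theorem exists_derivative_on_Icc (hU : H1Loc U univ) (hVU : ∀ s t, ‖V t - V s‖ ≤ ‖U t - U s‖)
    (a b : ℝ) : ∃ g : ℝ → L, MemLp g 2 (volume.restrict (Icc a b)) ∧
      ∀ s ∈ Icc a b, ∀ t ∈ Icc a b, s ≤ t → V t - V s = ∫ x in s..t, g x := by
  rcases lt_or_ge b a with hab | hab
  · exact ⟨0, MemLp.zero, fun s hs => absurd (hs.1.trans hs.2) (not_le.2 hab)⟩
  have hUc := hU.continuous
  have hVc : Continuous V := by
    refine continuous_iff_continuousAt.2 fun x => ?_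
    rw [ContinuousAt, tendsto_iff_norm_sub_tendsto_zero]
    exact squeeze_zero (fun _ => norm_nonneg _) (fun y => hVU x y)
      (tendsto_iff_norm_sub_tendsto_zero.1 hUc.continuousAt)
  set h : ℕ → ℝ := fun n => 1 / ((n : ℝ) + 1) with hh
  have hpos : ∀ n, 0 < h n := fun n => by simp only [hh]; positivity
  have hle : ∀ n, h n ≤ 1 := fun n => by
    simp only [hh]; rw [div_le_one (by positivity)]; linarith [n.cast_nonneg (α := ℝ)]
  set D : ℕ → ℝ → L := fun n x => ((n : ℝ) + 1) • (V (x + h n) - V x) with hD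
  have hDc : ∀ n, Continuous (D n) := fun n => by simp only [hD]; fun_prop
  have hDm : ∀ n, MemLp (D n) 2 (volume.restrict (Icc a b)) := fun n => by
    obtain ⟨C, hC⟩ := isCompact_Icc.exists_bound_of_continuousOn (hDc n).continuousOn (s := Icc a b)
    exact MemLp.of_bound (hDc n).aestronglyMeasurable C
      ((ae_restrict_iff' measurableSet_Icc).2 (ae_of_all _ hC))
  set J : ℝ → ℝ := fun x => ∫ y in a..x, ‖deriv U y‖ ^ 2 with hJ
  have hJc : Continuous J :=
    intervalIntegral.continuous_primitive (fun s t => hU.intervalIntegrable_sq s t) a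
  have hJsub : ∀ s t, J t - J s = ∫ y in s..t, ‖deriv U y‖ ^ 2 := fun s t =>
    intervalIntegral.integral_interval_sub_left (hU.intervalIntegrable_sq _ _)
      (hU.intervalIntegrable_sq _ _)
  have hJmono : Monotone J := fun s t hst => by
    have : 0 ≤ J t - J s := by
      rw [hJsub]; exact intervalIntegral.integral_nonneg hst fun x _ => by positivity
    linarith
  have hJa : J a = 0 := by simp [hJ]
  -- The squared quotient is at most (J(x + h) - J(x))/h with J the primitive of ‖U'‖². Its integral
  -- telescopes to averages of J near b and near a, and J is monotone with J(a) = 0.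
  have hDb : ∀ n, ∫ x, ‖D n x‖ ^ 2 ∂(volume.restrict (Icc a b)) ≤ J (b + 1) := fun n => by
    rw [integral_Icc_eq_integral_Ioc, ← intervalIntegral.integral_of_le hab]
    have e1 : ∫ x in a..b, J (x + h n) = ∫ x in (a + h n)..(b + h n), J x :=
      intervalIntegral.integral_comp_add_right _ _
    have ii : ∀ s t, IntervalIntegrable J volume s t := fun s t => hJc.intervalIntegrable s t
    calc ∫ x in a..b, ‖D n x‖ ^ 2
        ≤ ∫ x in a..b, ((n : ℝ) + 1) * (J (x + h n) - J x) := by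
          refine intervalIntegral.integral_mono_on hab
            (Continuous.intervalIntegrable (by fun_prop) _ _)
            (Continuous.intervalIntegrable (by fun_prop) _ _) fun x _ => ?_
          simp only [hD]
          rw [norm_smul, mul_pow, Real.norm_eq_abs, sq_abs, hJsub]
          have h1 : ‖V (x + h n) - V x‖ ^ 2 ≤ h n * ∫ y in x..(x + h n), ‖deriv U y‖ ^ 2 := by
            have := hU.norm_sub_sq_le_length (lt_add_of_pos_right x (hpos n))
            rw [add_sub_cancel_left] at this
            exact le_trans (by gcongr; exact hVU _ _) this
          have h2 : ((n : ℝ) + 1) * h n = 1 := by simp only [hh]; field_simp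
          calc ((n : ℝ) + 1) ^ 2 * ‖V (x + h n) - V x‖ ^ 2
              ≤ ((n : ℝ) + 1) ^ 2 * (h n * ∫ y in x..(x + h n), ‖deriv U y‖ ^ 2) := by gcongr
            _ = ((n : ℝ) + 1) * (((n : ℝ) + 1) * h n) * ∫ y in x..(x + h n), ‖deriv U y‖ ^ 2 := by
              ring
            _ = _ := by rw [h2, mul_one]
      _ = ((n : ℝ) + 1) * ((∫ x in b..(b + h n), J x) - ∫ x in a..(a + h n), J x) := by
          rw [intervalIntegral.integral_const_mul, intervalIntegral.integral_sub
            (Continuous.intervalIntegrable (by fun_prop) _ _) (ii _ _), e1,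
            intervalIntegral.integral_interval_sub_interval_comm (ii _ _) (ii _ _) (ii _ _),
            intervalIntegral.integral_symm a (a + h n), intervalIntegral.integral_symm b (b + h n)]
          ring
      _ ≤ ((n : ℝ) + 1) * (h n * J (b + 1) - 0) := by
          gcongr
          · calc ∫ x in b..(b + h n), J x ≤ ∫ x in b..(b + h n), J (b + 1) := by
                  refine intervalIntegral.integral_mono_on (by linarith [hpos n]) (ii _ _) (by simp)
                    fun x hx => hJmono (hx.2.trans (by linarith [hle n]))
              _ = _ := by simp
          · refine intervalIntegral.integral_nonneg (by linarith [hpos n]) fun x hx => ?_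
            rw [← hJa]; exact hJmono hx.1
      _ = J (b + 1) := by simp only [hh]; field_simp; ring
  obtain ⟨g, hg, φ, hφ, hweak, -⟩ := exists_weak_subseq_L2 hDm hDb
  refine ⟨g, hg, fun s hs t ht hst => ?_⟩
  have hgi : IntegrableOn g (Ioc s t) := by
    have : IntegrableOn g (Icc a b) := hg.integrable (by norm_num)
    exact this.mono_set fun x hx => ⟨hs.1.trans hx.1.le, hx.2.trans ht.2⟩
  have hsub : Ioc s t ⊆ Icc a b := fun x hx => ⟨hs.1.trans hx.1.le, hx.2.trans ht.2⟩
  refine ext_inner_right ℝ fun y => ?_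
  -- Testing against y on (s, t] turns the integral of a difference quotient into the difference of
  -- the averages of V just after t and just after s, which tends to V t - V s.
  set ψ : ℝ → L := (Ioc s t).indicator fun _ => y with hψ
  have hψm : MemLp ψ 2 (volume.restrict (Icc a b)) := (memLp_const y).indicator measurableSet_Ioc
  have hint : ∀ f : ℝ → L, IntegrableOn f (Ioc s t) →
      ∫ x, inner ℝ (f x) (ψ x) ∂(volume.restrict (Icc a b)) = inner ℝ (∫ x in s..t, f x) y := by
    intro f hf
    have h1 : (fun x => (inner ℝ (f x) (ψ x) : ℝ)) =
        (Ioc s t).indicator fun x => inner ℝ (f x) y := by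
      funext x
      by_cases hx : x ∈ Ioc s t <;> simp [hψ, hx]
    rw [h1, integral_indicator measurableSet_Ioc, Measure.restrict_restrict measurableSet_Ioc,
      inter_eq_left.2 hsub,
      intervalIntegral.integral_of_le hst]
    simp_rw [real_inner_comm y]
    exact integral_inner hf y
  have lim1 := hweak ψ hψm
  rw [hint g hgi] at lim1
  have lim2 : Tendsto (fun n => ∫ x, inner ℝ (D (φ n) x) (ψ x) ∂(volume.restrict (Icc a b))) atTop
      (𝓝 (inner ℝ (V t - V s) y)) := by
    have e : ∀ n, ∫ x, inner ℝ (D n x) (ψ x) ∂(volume.restrict (Icc a b)) =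
        inner ℝ (((n : ℝ) + 1) • (∫ x in t..(t + 1 / ((n : ℝ) + 1)), V x) -
          ((n : ℝ) + 1) • ∫ x in s..(s + 1 / ((n : ℝ) + 1)), V x) y := by
      intro n
      have ii : ∀ s t, IntervalIntegrable V volume s t := fun s t => hVc.intervalIntegrable s t
      have e1 : ∫ x in s..t, V (x + h n) = ∫ x in (s + h n)..(t + h n), V x :=
        intervalIntegral.integral_comp_add_right _ _
      rw [hint _ ((hDc n).integrableOn_Ioc)]
      congr 1
      simp only [hD]
      rw [intervalIntegral.integral_smul, intervalIntegral.integral_sub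
        (Continuous.intervalIntegrable (by fun_prop) _ _) (ii _ _), e1,
        intervalIntegral.integral_interval_sub_interval_comm (ii _ _) (ii _ _) (ii _ _), ← smul_sub,
        intervalIntegral.integral_symm s (s + h n), intervalIntegral.integral_symm t (t + h n)]
      congr 1
      abel
    simp_rw [e]
    exact (((tendsto_average_right hVc t).sub (tendsto_average_right hVc s)).comp
      hφ.tendsto_atTop).inner tendsto_const_nhds
  exact tendsto_nhds_unique lim2 lim1

/-- A curve whose increments are dominated by those of an `H¹_loc` curve is in `H¹_loc`. -/
theorem H1Loc.of_norm_sub_le (hU : H1Loc U univ) (hVU : ∀ s t, ‖V t - V s‖ ≤ ‖U t - U s‖) :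
    H1Loc V univ ∧ ∀ᵐ t, ‖deriv V t‖ ≤ ‖deriv U t‖ := by
  have loc : ∀ a b : ℝ, ∃ W : ℝ → L, H1Loc W univ ∧ ∀ x ∈ Icc a b, V x = W x := by
    intro a b
    rcases lt_or_ge b a with hab | hab
    · exact ⟨fun _ => 0, h1Loc_const 0, fun x hx => absurd (hx.1.trans hx.2) (not_le.2 hab)⟩
    obtain ⟨g, hg, hgV⟩ := exists_derivative_on_Icc hU hVU a b
    set g' := (Icc a b).indicator g with hg'
    have hg'm : MemLp g' 2 volume := (memLp_indicator_iff_restrict measurableSet_Icc).2 hg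
    have hint : ∀ s t, IntervalIntegrable g' volume s t := fun s t => by
      rw [intervalIntegrable_iff]
      have h1 : IntegrableOn g' (Icc (min s t) (max s t)) :=
        (hg'm.restrict _).integrable (by norm_num)
      exact h1.mono_set Ioc_subset_Icc_self
    refine ⟨fun t => V a + ∫ x in a..t, g' x, ?_, fun x hx => ?_⟩
    · refine h1Loc_of_primitive (g := g') (fun s t => hg'm.restrict _) fun t => ?_
      rw [add_assoc, intervalIntegral.integral_add_adjacent_intervals (hint _ _) (hint _ _)]
    · rw [← sub_eq_iff_eq_add', hgV a ⟨le_rfl, hab⟩ x hx hx.1]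
      refine intervalIntegral.integral_congr fun y hy => ?_
      rw [uIcc_of_le hx.1] at hy
      exact (indicator_of_mem (s := Icc a b) ⟨hy.1, hy.2.trans hx.2⟩ g).symm
  have hderiv : ∀ (a b : ℝ) (W : ℝ → L), (∀ x ∈ Icc a b, V x = W x) →
      ∀ x ∈ Ioo a b, V =ᶠ[𝓝 x] W := fun a b W hW x hx => by
    filter_upwards [Icc_mem_nhds hx.1 hx.2] with y hy using hW y hy
  have hdiff : ∀ᵐ t, DifferentiableAt ℝ V t := by
    have h1 : ∀ n : ℕ, ∀ᵐ t : ℝ, t ∈ Ioo (-(n : ℝ)) n → DifferentiableAt ℝ V t := by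
      intro n
      obtain ⟨W, hW, hVW⟩ := loc (-(n : ℝ)) n
      filter_upwards [hW.hasDerivAt_deriv] with t ht hmem
      exact (hderiv _ _ W hVW t hmem).differentiableAt_iff.2 ht.differentiableAt
    filter_upwards [ae_all_iff.2 h1] with t ht
    obtain ⟨n, hn⟩ := exists_nat_gt |t|
    exact ht n (abs_lt.1 hn)
  constructor
  · have hmem : ∀ s t : ℝ, MemLp (deriv V) 2 (volume.restrict (Icc s t)) := by
      intro s t
      obtain ⟨W, hW, hVW⟩ := loc (s - 1) (t + 1)
      refine (hW.memLp s t).ae_eq ?_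
      rw [EventuallyEq, ae_restrict_iff' measurableSet_Icc]
      exact ae_of_all _ fun x hx => ((hderiv _ _ W hVW x
        ⟨by linarith [hx.1], by linarith [hx.2]⟩).deriv_eq).symm
    refine ⟨deriv V, fun s _ t _ hst => ⟨hmem s t, ?_⟩⟩
    obtain ⟨W, hW, hVW⟩ := loc (s - 1) (t + 1)
    rw [hVW s ⟨by linarith, by linarith⟩, hVW t ⟨by linarith, by linarith⟩, hW.sub_eq]
    refine intervalIntegral.integral_congr fun x hx => ?_
    rw [uIcc_of_le hst] at hx
    exact ((hderiv _ _ W hVW x ⟨by linarith [hx.1], by linarith [hx.2]⟩).deriv_eq).symm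
  · filter_upwards [hdiff, hU.hasDerivAt_deriv] with t hVt hUt
    have h1 := (hasDerivAt_iff_tendsto_slope.1 hVt.hasDerivAt).norm
    have h2 := (hasDerivAt_iff_tendsto_slope.1 hUt).norm
    refine le_of_tendsto_of_tendsto h1 h2 (Eventually.of_forall fun x => ?_)
    simp only [slope, vsub_eq_sub, norm_smul]
    gcongr
    exact hVU _ _

end Lipschitz

end

/-! ### The shifted energy and the sign of the energy -/

section

theorem lintegral_comp_affine (f : ℝ → ENNReal) {l : ℝ} (hl : 0 < l) (b : ℝ) :
    ∫⁻ t, f (l * t + b) = ENNReal.ofReal l⁻¹ * ∫⁻ t, f t := by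
  have he : MeasurableEmbedding fun t : ℝ => l * t + b :=
    ((Homeomorph.mulLeft₀ l hl.ne').trans (Homeomorph.addRight b)).measurableEmbedding
  have h3 : Measure.map (fun t : ℝ => l * t + b) volume = ENNReal.ofReal l⁻¹ • volume := by
    have : (fun t : ℝ => l * t + b) = (fun x => x + b) ∘ fun t => l * t := rfl
    rw [this, ← Measure.map_map (measurable_add_const b) (measurable_const_mul l),
      Real.map_volume_mul_left hl.ne', Measure.map_smul, map_add_right_eq_self,
      abs_of_pos (inv_pos.2 hl)]
  rw [← he.lintegral_map, h3, lintegral_smul_measure, smul_eq_mul]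

theorem lintegral_exp_Iic {c : ℝ} (hc : 0 < c) (t : ℝ) :
    ∫⁻ x in Iic t, ENNReal.ofReal (Real.exp (c * x)) = ENNReal.ofReal (Real.exp (c * t) / c) := by
  rw [← ofReal_integral_eq_lintegral_ofReal (integrableOn_exp_mul_Iic hc t)
    (ae_of_all _ fun x => (Real.exp_pos _).le), integral_exp_mul_Iic hc]

namespace Setting

variable {L H K : Type*}
  [NormedAddCommGroup L] [InnerProductSpace ℝ L] [CompleteSpace L]
  [NormedAddCommGroup H] [InnerProductSpace ℝ H]
  [NormedAddCommGroup K] [InnerProductSpace ℝ K] {S : Setting L H K}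

theorem lowerSemicontinuous_of_weaklyLSC {E : L → EReal} (h : WeaklyLSC E) :
    LowerSemicontinuous E := by
  rw [lowerSemicontinuous_iff_isClosed_preimage]
  intro y
  refine IsSeqClosed.isClosed fun u v hu huv => ?_
  refine (h u v fun y => huv.inner tendsto_const_nhds).trans ?_
  refine (liminf_le_liminf (Eventually.of_forall fun n => hu n)).trans ?_
  simp

theorem Unbalanced.measurable_comp (hS : S.Unbalanced) {U : ℝ → L} (hU : Continuous U) :
    Measurable fun t => S.E (U t) :=
  ((lowerSemicontinuous_of_weaklyLSC hS.wlsc).comp hU).measurable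

theorem Unbalanced.E_cases (hS : S.Unbalanced) (v : L) :
    S.E v = ⊤ ∨ ∃ e : ℝ, S.a ≤ e ∧ S.E v = e := by
  have h := hS.a_le v
  induction hE : S.E v with
  | bot => rw [hE] at h; simp at h
  | top => exact Or.inl rfl
  | coe x => rw [hE] at h; exact Or.inr ⟨x, by exact_mod_cast h, rfl⟩

variable (S) in
/-- The constant added to the potential up to time `t₀` to make it nonnegative there. -/
def shift (t₀ t : ℝ) : ℝ := if t ≤ t₀ then -S.a else 0

variable (S) in
/-- The positive part of the potential, shifted up to time `t₀`. -/
def exc (U : ℝ → L) (t₀ t : ℝ) : ENNReal := (S.E (U t) + ((S.shift t₀ t : ℝ) : EReal)).toENNReal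

variable (S) in
/-- The integral of the energy density with the potential replaced by its positive part, after the
addition of `-a` up to time `t₀`. -/
def shiftedEnergy (c : ℝ) (U : ℝ → L) (t₀ : ℝ) : ENNReal :=
  ∫⁻ t, (kin c U t + ENNReal.ofReal (Real.exp (c * t)) * S.exc U t₀ t)

theorem shift_of_le {t₀ t : ℝ} (h : t ≤ t₀) : S.shift t₀ t = -S.a := if_pos h

theorem shift_of_gt {t₀ t : ℝ} (h : t₀ < t) : S.shift t₀ t = 0 := if_neg h.not_ge

theorem Unbalanced.shift_nonneg (hS : S.Unbalanced) (t₀ t : ℝ) : 0 ≤ S.shift t₀ t := by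
  have := hS.a_neg
  unfold shift; split_ifs <;> linarith

theorem measurable_shift (t₀ : ℝ) : Measurable (S.shift t₀) :=
  Measurable.ite measurableSet_Iic measurable_const measurable_const

theorem Unbalanced.measurable_exc (hS : S.Unbalanced) {U : ℝ → L} (hU : Continuous U) (t₀ : ℝ) :
    Measurable (S.exc U t₀) :=
  ((hS.measurable_comp hU).add (measurable_shift t₀).coe_real_ereal).ereal_toENNReal

theorem exc_top {U : ℝ → L} {t₀ t : ℝ} (h : S.E (U t) = ⊤) : S.exc U t₀ t = ⊤ := by
  simp [exc, h]

theorem exc_coe {U : ℝ → L} {t₀ t e : ℝ} (h : S.E (U t) = e) :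
    S.exc U t₀ t = ENNReal.ofReal (e + S.shift t₀ t) := by
  rw [exc, h, ← EReal.coe_add, EReal.real_coe_toENNReal]

theorem ofReal_le_exc {U : ℝ → L} {t₀ t r : ℝ} (h : (r : EReal) ≤ S.E (U t)) :
    ENNReal.ofReal (r + S.shift t₀ t) ≤ S.exc U t₀ t := by
  rw [exc, ← EReal.real_coe_toENNReal, EReal.coe_add]
  exact EReal.toENNReal_le_toENNReal (by gcongr)

theorem exc_le_ofReal {U : ℝ → L} {t₀ t r : ℝ} (h : S.E (U t) ≤ (r : EReal)) :
    S.exc U t₀ t ≤ ENNReal.ofReal (r + S.shift t₀ t) := by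
  rw [exc, ← EReal.real_coe_toENNReal, EReal.coe_add]
  exact EReal.toENNReal_le_toENNReal (by gcongr)

theorem lintegral_shift (hS : S.Unbalanced) {c : ℝ} (hc : 0 < c) (t₀ : ℝ) :
    ∫⁻ t, ENNReal.ofReal (S.shift t₀ t * Real.exp (c * t)) =
      ENNReal.ofReal (-S.a * Real.exp (c * t₀) / c) := by
  have ha := hS.a_neg
  have h1 : (fun t => ENNReal.ofReal (S.shift t₀ t * Real.exp (c * t))) =
      (Iic t₀).indicator fun t => ENNReal.ofReal (-S.a) * ENNReal.ofReal (Real.exp (c * t)) := by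
    funext t
    by_cases h : t ≤ t₀
    · rw [indicator_of_mem (s := Iic t₀) h, shift_of_le h, ENNReal.ofReal_mul (by linarith)]
    · rw [indicator_of_notMem (s := Iic t₀) h, shift_of_gt (not_le.1 h)]; simp
  rw [h1, lintegral_indicator measurableSet_Iic, lintegral_const_mul _ (by fun_prop),
    lintegral_exp_Iic hc, ← ENNReal.ofReal_mul (by linarith), mul_div_assoc]

theorem density_of_coe {U : ℝ → L} {c t e : ℝ} (h : S.E (U t) = e) :
    S.density c U t = (((‖deriv U t‖ ^ 2 / 2 + e) * Real.exp (c * t) : ℝ) : EReal) := by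
  rw [density, h, EReal.coe_mul, EReal.coe_add]

theorem density_of_top {U : ℝ → L} {c t : ℝ} (h : S.E (U t) = ⊤) : S.density c U t = ⊤ := by
  rw [density, h, EReal.coe_add_top, EReal.top_mul_coe_of_pos (Real.exp_pos _)]

/-- Replacing the shifted potential by its positive part can only increase it. The inequality is
written additively to avoid subtraction in `ENNReal`. It requires no sign of the potential, which
matters for weak limits: their potential may be negative at some positive times. -/
theorem density_add_le (hS : S.Unbalanced) (c : ℝ) (U : ℝ → L) (t₀ t : ℝ) :
    (S.density c U t).toENNReal + ENNReal.ofReal (S.shift t₀ t * Real.exp (c * t)) ≤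
      kin c U t + ENNReal.ofReal (Real.exp (c * t)) * S.exc U t₀ t +
        (-S.density c U t).toENNReal := by
  have he := Real.exp_pos (c * t)
  have hb := hS.shift_nonneg t₀ t
  rcases hS.E_cases (U t) with h | ⟨e, -, h⟩
  · rw [exc_top h, ENNReal.mul_top (by simpa using he)]; simp
  · rw [exc_coe h, kin_eq, ← ENNReal.ofReal_mul he.le, density_of_coe h, ← EReal.coe_neg,
      EReal.real_coe_toENNReal, EReal.real_coe_toENNReal]
    have hk : 0 ≤ ‖deriv U t‖ ^ 2 / 2 := by positivity
    set k := ‖deriv U t‖ ^ 2 / 2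
    set b := S.shift t₀ t
    have h0 := ENNReal.ofReal_add_le (p := Real.exp (c * t) * k) (q := Real.exp (c * t) * (e + b))
    rcases le_total 0 ((k + e) * Real.exp (c * t)) with hx | hx
    · refine le_trans ?_ (le_add_of_nonneg_right (zero_le))
      rw [← ENNReal.ofReal_add hx (by positivity)]
      refine le_trans (ENNReal.ofReal_le_ofReal (by linarith)) h0
    · rw [ENNReal.ofReal_of_nonpos hx, zero_add]
      refine le_trans ?_ (add_le_add_left h0 _)
      refine le_trans (ENNReal.ofReal_le_ofReal (le_of_eq ?_)) ENNReal.ofReal_add_le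
      ring

/-- When the potential is nonnegative after t₀ the shifted potential is nonnegative everywhere, so
taking positive parts loses nothing. -/
theorem density_add_eq (hS : S.Unbalanced) (c : ℝ) {U : ℝ → L} {t₀ t : ℝ}
    (hU : t₀ < t → 0 ≤ S.E (U t)) :
    kin c U t + ENNReal.ofReal (Real.exp (c * t)) * S.exc U t₀ t + (-S.density c U t).toENNReal =
      (S.density c U t).toENNReal + ENNReal.ofReal (S.shift t₀ t * Real.exp (c * t)) := by
  refine le_antisymm ?_ (density_add_le hS c U t₀ t)
  have he := Real.exp_pos (c * t)
  have hb := hS.shift_nonneg t₀ t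
  rcases hS.E_cases (U t) with h | ⟨e, hae, h⟩
  · rw [density_of_top h]; simp
  · rw [exc_coe h, kin_eq, ← ENNReal.ofReal_mul he.le, density_of_coe h, ← EReal.coe_neg,
      EReal.real_coe_toENNReal, EReal.real_coe_toENNReal]
    have hk : 0 ≤ ‖deriv U t‖ ^ 2 / 2 := by positivity
    have heb : 0 ≤ e + S.shift t₀ t := by
      rcases le_or_gt t t₀ with h1 | h1
      · rw [shift_of_le h1]; linarith
      · rw [shift_of_gt h1]
        have := hU h1
        rw [h] at this
        have : 0 ≤ e := by exact_mod_cast this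
        linarith
    set k := ‖deriv U t‖ ^ 2 / 2
    set b := S.shift t₀ t
    rw [← ENNReal.ofReal_add (by positivity) (by positivity)]
    rcases le_total 0 ((k + e) * Real.exp (c * t)) with hx | hx
    · rw [ENNReal.ofReal_of_nonpos (p := -((k + e) * Real.exp (c * t))) (by linarith), add_zero,
        ← ENNReal.ofReal_add hx (by positivity)]
      exact ENNReal.ofReal_le_ofReal (by linarith)
    · rw [ENNReal.ofReal_of_nonpos hx, zero_add, ← ENNReal.ofReal_add (by nlinarith) (by linarith)]
      exact ENNReal.ofReal_le_ofReal (by linarith)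

theorem measurable_shiftedDensity (hS : S.Unbalanced) (c : ℝ) {U : ℝ → L} (hU : Continuous U)
    (t₀ : ℝ) : Measurable fun t => kin c U t + ENNReal.ofReal (Real.exp (c * t)) * S.exc U t₀ t := by
  have h1 := measurable_kin c U
  have h2 := hS.measurable_exc hU t₀
  fun_prop

theorem measurable_shift_exp (c t₀ : ℝ) :
    Measurable fun t => ENNReal.ofReal (S.shift t₀ t * Real.exp (c * t)) := by
  have := measurable_shift (S := S) t₀
  fun_prop

theorem energyPos_add_le (hS : S.Unbalanced) {c : ℝ} (hc : 0 < c) {U : ℝ → L} (hU : Continuous U)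
    (t₀ : ℝ) : S.energyPos c U univ + ENNReal.ofReal (-S.a * Real.exp (c * t₀) / c) ≤
      S.shiftedEnergy c U t₀ + S.energyNeg c U univ := by
  rw [← lintegral_shift hS hc, energyPos, energyNeg, Measure.restrict_univ, shiftedEnergy,
    ← lintegral_add_right _ (measurable_shift_exp c t₀),
    ← lintegral_add_left (measurable_shiftedDensity hS c hU t₀)]
  exact lintegral_mono fun t => density_add_le hS c U t₀ t

theorem energyPos_add_eq (hS : S.Unbalanced) {c : ℝ} (hc : 0 < c) {U : ℝ → L} (hU : Continuous U)
    {t₀ : ℝ} (h : ∀ t > t₀, 0 ≤ S.E (U t)) :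
    S.shiftedEnergy c U t₀ + S.energyNeg c U univ =
      S.energyPos c U univ + ENNReal.ofReal (-S.a * Real.exp (c * t₀) / c) := by
  rw [← lintegral_shift hS hc, energyPos, energyNeg, Measure.restrict_univ, shiftedEnergy,
    ← lintegral_add_right _ (measurable_shift_exp c t₀),
    ← lintegral_add_left (measurable_shiftedDensity hS c hU t₀)]
  exact lintegral_congr fun t => density_add_eq hS c fun ht => h t ht

/-- The negative part of the density is dominated by the shift times e^{ct}, which is integrable at
-∞ because c > 0. Energies of such curves are therefore always well defined. -/
theorem energyNeg_ne_top (hS : S.Unbalanced) {c : ℝ} (hc : 0 < c) {U : ℝ → L}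
    {t₀ : ℝ} (h : ∀ t > t₀, 0 ≤ S.E (U t)) (I : Set ℝ) : S.energyNeg c U I ≠ ⊤ := by
  have h1 : S.energyNeg c U univ ≤ ENNReal.ofReal (-S.a * Real.exp (c * t₀) / c) := by
    rw [← lintegral_shift hS hc, energyNeg, Measure.restrict_univ]
    refine lintegral_mono fun t => ?_
    have he := Real.exp_pos (c * t)
    rcases hS.E_cases (U t) with h' | ⟨e, hae, h'⟩
    · rw [density_of_top h']; simp
    · rw [density_of_coe h', ← EReal.coe_neg, EReal.real_coe_toENNReal]
      refine ENNReal.ofReal_le_ofReal ?_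
      have hk : 0 ≤ ‖deriv U t‖ ^ 2 / 2 := by positivity
      have heb : 0 ≤ e + S.shift t₀ t := by
        rcases le_or_gt t t₀ with h1 | h1
        · rw [shift_of_le h1]; linarith
        · rw [shift_of_gt h1]
          have := h t h1
          rw [h'] at this
          have : 0 ≤ e := by exact_mod_cast this
          linarith
      nlinarith
  have h2 : S.energyNeg c U I ≤ S.energyNeg c U univ := lintegral_mono_set (subset_univ I)
  exact ((h2.trans h1).trans_lt ENNReal.ofReal_lt_top).ne

theorem energy_nonpos_of_shiftedEnergy_le (hS : S.Unbalanced) {c : ℝ} (hc : 0 < c) {U : ℝ → L}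
    (hU : Continuous U) {t₀ : ℝ}
    (hG : S.shiftedEnergy c U t₀ ≤ ENNReal.ofReal (-S.a * Real.exp (c * t₀) / c)) :
    S.energy c U ≤ 0 := by
  rw [energy, energyOn, EReal.sub_nonpos, EReal.coe_ennreal_le_coe_ennreal_iff]
  have h1 := energyPos_add_le hS hc hU t₀
  have h2 : S.energyPos c U univ + ENNReal.ofReal (-S.a * Real.exp (c * t₀) / c) ≤
      S.energyNeg c U univ + ENNReal.ofReal (-S.a * Real.exp (c * t₀) / c) :=
    h1.trans (by rw [add_comm]; gcongr)
  exact (ENNReal.add_le_add_iff_right ENNReal.ofReal_ne_top).1 h2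

theorem energy_nonneg_of_le_shiftedEnergy (hS : S.Unbalanced) {c : ℝ} (hc : 0 < c) {U : ℝ → L}
    (hU : Continuous U) {t₀ : ℝ} (h : ∀ t > t₀, 0 ≤ S.E (U t))
    (hG : ENNReal.ofReal (-S.a * Real.exp (c * t₀) / c) ≤ S.shiftedEnergy c U t₀) :
    0 ≤ S.energy c U := by
  have hn := energyNeg_ne_top hS hc h univ
  rw [energy, energyOn, EReal.sub_nonneg (Or.inr (by simpa using hn)) (Or.inr (by simp)),
    EReal.coe_ennreal_le_coe_ennreal_iff]
  have h1 := energyPos_add_eq hS hc hU h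
  have h2 : S.energyNeg c U univ + ENNReal.ofReal (-S.a * Real.exp (c * t₀) / c) ≤
      S.energyPos c U univ + ENNReal.ofReal (-S.a * Real.exp (c * t₀) / c) := by
    rw [← h1, add_comm]; gcongr
  exact (ENNReal.add_le_add_iff_right ENNReal.ofReal_ne_top).1 h2

/-- Under t ↦ lt + b with speed multiplied by l the weight only gains the factor e^{-cb}. The
kinetic part gains l²/l = l and the potential part 1/l, which is at most l since l ≥ 1. -/
theorem shiftedEnergy_comp_affine_le {c : ℝ} (U : ℝ → L) {l : ℝ} (hl : 1 ≤ l) (b t₀ : ℝ) :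
    S.shiftedEnergy (l * c) (fun t => U (l * t + b)) t₀ ≤
      ENNReal.ofReal (Real.exp (-(c * b)) * l) * S.shiftedEnergy c U (l * t₀ + b) := by
  have hl0 : 0 < l := by linarith
  have hd : ∀ t, deriv (fun t => U (l * t + b)) t = l • deriv U (l * t + b) := by
    intro t
    have := deriv_comp_mul_left l (fun x => U (x + b)) t
    rw [this, deriv_comp_add_const]
  have hexp : ∀ t, ENNReal.ofReal (Real.exp (l * c * t)) =
      ENNReal.ofReal (Real.exp (-(c * b))) * ENNReal.ofReal (Real.exp (c * (l * t + b))) := by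
    intro t
    rw [← ENNReal.ofReal_mul (Real.exp_pos _).le, ← Real.exp_add]
    congr 2; ring
  have hsh : ∀ t, S.exc (fun t => U (l * t + b)) t₀ t = S.exc U (l * t₀ + b) (l * t + b) := by
    intro t
    have : S.shift t₀ t = S.shift (l * t₀ + b) (l * t + b) := by
      simp [shift, hl0]
    rw [exc, exc, this]
  have hpt : ∀ t, kin (l * c) (fun t => U (l * t + b)) t +
      ENNReal.ofReal (Real.exp (l * c * t)) * S.exc (fun t => U (l * t + b)) t₀ t ≤
      ENNReal.ofReal (Real.exp (-(c * b)) * l ^ 2) * (fun s => kin c U s +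
        ENNReal.ofReal (Real.exp (c * s)) * S.exc U (l * t₀ + b) s) (l * t + b) := by
    intro t
    simp only [kin]
    rw [hd, hexp, hsh, mul_add (ENNReal.ofReal (Real.exp (-(c * b)) * l ^ 2)),
      ENNReal.ofReal_mul (Real.exp_pos _).le, norm_smul, mul_pow,
      Real.norm_eq_abs, sq_abs, mul_div_assoc, ENNReal.ofReal_mul (by positivity : 0 ≤ l ^ 2)]
    refine add_le_add (le_of_eq (by ring)) ?_
    rw [mul_assoc, mul_assoc]
    have h1 : 1 ≤ ENNReal.ofReal (l ^ 2) := by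
      rw [← ENNReal.ofReal_one]
      exact ENNReal.ofReal_le_ofReal (one_le_pow₀ hl)
    exact mul_le_mul' le_rfl (le_mul_of_one_le_left' h1)
  refine (lintegral_mono hpt).trans ?_
  rw [lintegral_const_mul' _ _ ENNReal.ofReal_ne_top, lintegral_comp_affine (fun s => kin c U s +
      ENNReal.ofReal (Real.exp (c * s)) * S.exc U (l * t₀ + b) s) hl0, ← mul_assoc,
    ← ENNReal.ofReal_mul (by positivity), shiftedEnergy]
  gcongr ENNReal.ofReal ?_ * _
  refine le_of_eq ?_
  field_simp

theorem shiftedEnergy_mono {c t₀ : ℝ} {U V : ℝ → L} (hd : ∀ᵐ t, ‖deriv V t‖ ≤ ‖deriv U t‖)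
    (hE : ∀ t, S.E (V t) ≤ S.E (U t)) : S.shiftedEnergy c V t₀ ≤ S.shiftedEnergy c U t₀ := by
  refine lintegral_mono_ae ?_
  filter_upwards [hd] with t ht
  unfold kin exc
  gcongr
  exact EReal.toENNReal_le_toENNReal (by gcongr; exact hE t)

end Setting

end

/-! ### Geometry near F⁻ and a priori bounds on negative curves -/

section

theorem proj_spec {α : Type*} [PseudoMetricSpace α] {F : Set α} {r : ℝ} (h : UniqueProj F r)
    {v : α} (hv : v ∈ tube F r) :
    proj F v ∈ F ∧ dist v (proj F v) = Metric.infDist v F ∧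
      ∀ w ∈ F, dist v w = Metric.infDist v F → w = proj F v := by
  have hex : ∃ w ∈ F, dist v w = Metric.infDist v F := (h v hv).exists
  have h1 : proj F v ∈ F ∧ dist v (proj F v) = Metric.infDist v F := by
    rw [proj, dif_pos hex]; exact hex.choose_spec
  exact ⟨h1.1, h1.2, fun w hw hd => (h v hv).unique ⟨hw, hd⟩ h1⟩

namespace Setting

variable {L H K : Type*}
  [NormedAddCommGroup L] [InnerProductSpace ℝ L] [CompleteSpace L]
  [NormedAddCommGroup H] [InnerProductSpace ℝ H]
  [NormedAddCommGroup K] [InnerProductSpace ℝ K] {S : Setting L H K}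

section Minus

/-- The level-set hypothesis after clearing denominators. Positivity of -a forces the minimum in
`EmaxMinus` to be positive, hence η > 0. As η is at most a square root containing κ - a, this in
turn forces κ - a > 0. -/
theorem etaMinus_facts (hU : S.Unbalanced) (hL : S.LevelSets) :
    S.minus.C ^ 2 * (S.minus.C + 1) * -S.a < S.etaMinus ^ 2 / 4 ∧
    S.minus.C ^ 2 * (S.minus.C + 1) * -S.a < S.minus.β S.etaMinus ∧
    0 < S.etaMinus ∧ S.etaMinus ≤ S.minus.r₀ / 4 ∧
    S.etaMinus ^ 2 ≤
      (Real.exp 1)⁻¹ * (S.minus.r₀ / 4) * √(2 * (S.kappaMinus (S.minus.r₀ / 4) - S.a)) ∧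
    0 < S.kappaMinus (S.minus.r₀ / 4) - S.a := by
  have hC := hU.wellMinus.one_lt_C
  have hr := hU.wellMinus.r₀_pos
  have ha := hU.a_neg
  have hpos : 0 < S.minus.C ^ 2 * (S.minus.C + 1) := by positivity
  have h := hL.neg_a_lt
  rw [EmaxMinus, one_div, ← div_eq_inv_mul, lt_div_iff₀ hpos, mul_comm, lt_min_iff, lt_min_iff,
    lt_min_iff] at h
  obtain ⟨⟨h1, -⟩, -, h2⟩ := h
  have hA : 0 < S.minus.C ^ 2 * (S.minus.C + 1) * -S.a := mul_pos hpos (by linarith)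
  have hne : S.etaMinus ≠ 0 := by
    intro h0; rw [h0] at h1; norm_num at h1; nlinarith
  have hnn : 0 ≤ S.etaMinus := le_min (Real.sqrt_nonneg _) (by positivity)
  have hle : S.etaMinus ^ 2 ≤
      (Real.exp 1)⁻¹ * (S.minus.r₀ / 4) * √(2 * (S.kappaMinus (S.minus.r₀ / 4) - S.a)) := by
    have := min_le_left (√((Real.exp 1)⁻¹ * (S.minus.r₀ / 4) *
      √(2 * (S.kappaMinus (S.minus.r₀ / 4) - S.a)))) (S.minus.r₀ / 4)
    calc S.etaMinus ^ 2 ≤ (√((Real.exp 1)⁻¹ * (S.minus.r₀ / 4) *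
          √(2 * (S.kappaMinus (S.minus.r₀ / 4) - S.a)))) ^ 2 := by gcongr; exact this
      _ = _ := Real.sq_sqrt (by positivity)
  have hp := lt_of_le_of_ne hnn hne.symm
  refine ⟨h1, h2, hp, min_le_right _ _, hle, ?_⟩
  by_contra! hk
  rw [Real.sqrt_eq_zero_of_nonpos (by linarith), mul_zero] at hle
  have : 0 < S.etaMinus ^ 2 := by positivity
  linarith

theorem exists_preimage (hS : S.SmallerSpace) {v : L} (hv : S.E v < ⊤) : ∃ x, S.ι x = v := by
  have : v ∈ range S.ι := by rw [hS.range_eq]; exact hv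
  exact this

theorem infDist_ι_le (hU : S.Unbalanced) (hS : S.SmallerSpace) (x : H) :
    Metric.infDist (S.ι x) S.minus.F ≤ Metric.infDist x (S.FH S.minus) := by
  have hne : (S.FH S.minus).Nonempty := by
    obtain ⟨v, hv⟩ := hU.wellMinus.nonempty
    obtain ⟨y, hy⟩ := exists_preimage hS (v := v) (by
      rw [hU.wellMinus.energy_eq v hv]; exact EReal.coe_lt_top _)
    exact ⟨y, by rw [FH, mem_preimage, hy]; exact hv⟩
  refine le_of_forall_pos_le_add fun ε hε => ?_
  obtain ⟨y, hy, hxy⟩ := (Metric.infDist_lt_iff hne).1 (lt_add_of_pos_right _ hε)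
  have hy' : S.ι y ∈ S.minus.F := hy
  refine (Metric.infDist_le_dist_of_mem hy').trans (le_trans ?_ hxy.le)
  rw [dist_eq_norm, dist_eq_norm, ← map_sub]
  exact hS.norm_ι_le _

theorem exists_near_minus (hP : S.ProjectionsH) (hU : S.Unbalanced)
    (hL : S.LevelSets) {v : L} (hv : Metric.infDist v S.minus.F ≤ S.minus.r₀)
    (hE : S.E v ≤ ((S.a + S.minus.β S.etaMinus : ℝ) : EReal)) :
    ∃ x, S.ι x = v ∧ Metric.infDist x (S.FH S.minus) ≤ S.etaMinus := by
  obtain ⟨-, -, h1, h2, -, -⟩ := etaMinus_facts hU hL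
  have hr := hU.wellMinus.r₀_pos
  obtain ⟨x, hx, rfl⟩ := hP.1.mem_of_le S.etaMinus ⟨h1, by linarith⟩ v hv hE
  exact ⟨x, rfl, hx⟩

theorem exists_near_minus_of_nonpos (hP : S.ProjectionsH) (hU : S.Unbalanced)
    (hL : S.LevelSets) {v : L} (hv : Metric.infDist v S.minus.F ≤ S.minus.r₀) (hE : S.E v ≤ 0) :
    ∃ x, S.ι x = v ∧ Metric.infDist x (S.FH S.minus) ≤ S.etaMinus := by
  refine exists_near_minus hP hU hL hv (hE.trans ?_)
  obtain ⟨-, h2, -⟩ := etaMinus_facts hU hL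
  have hC := hU.wellMinus.one_lt_C
  have ha := hU.a_neg
  have : 1 ≤ S.minus.C ^ 2 * (S.minus.C + 1) := by nlinarith
  have : 0 ≤ S.a + S.minus.β S.etaMinus := by nlinarith
  exact_mod_cast this

/-- The first bound is the definition of κ. For the second, a point this far from F⁻ is outside the
η-tube of `H`, so E > a + β(η) > -a. Averaging this with E ≥ κ bounds E below by a quarter of κ - a
relative to level 0, not a; this is needed after time 0, where no shift is added. -/
theorem le_energy_of_infDist (hP : S.ProjectionsH) (hU : S.Unbalanced) (hS : S.SmallerSpace)
    (hL : S.LevelSets) {v : L} (h1 : S.minus.r₀ / 4 < Metric.infDist v S.minus.F)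
    (h2 : Metric.infDist v S.minus.F ≤ S.minus.r₀) :
    ((S.kappaMinus (S.minus.r₀ / 4) : ℝ) : EReal) ≤ S.E v ∧
      (((S.kappaMinus (S.minus.r₀ / 4) - S.a) / 4 : ℝ) : EReal) ≤ S.E v := by
  obtain ⟨-, hβ, hη, hη2, -, hk⟩ := etaMinus_facts hU hL
  have hC := hU.wellMinus.one_lt_C
  have ha := hU.a_neg
  rcases hU.E_cases v with h | ⟨e, hae, h⟩
  · rw [h]; exact ⟨le_top, le_top⟩
  have hκ : S.kappaMinus (S.minus.r₀ / 4) ≤ e := by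
    refine csInf_le ⟨S.a, ?_⟩ ⟨v, ⟨h1.le, h2⟩, h⟩
    rintro y ⟨w, -, hw⟩
    have := hU.a_le w
    rw [hw] at this
    exact_mod_cast this
  have hlt : S.a + S.minus.β S.etaMinus < e := by
    by_contra! hle
    obtain ⟨x, hx, hx2⟩ := exists_near_minus hP hU hL h2 (by rw [h]; exact_mod_cast hle)
    have := infDist_ι_le hU hS x
    rw [hx] at this
    linarith
  have : 2 ≤ S.minus.C ^ 2 * (S.minus.C + 1) := by nlinarith
  have h3 : S.a + 2 * -S.a < e := by nlinarith
  rw [h]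
  constructor
  · exact_mod_cast hκ
  · have : (S.kappaMinus (S.minus.r₀ / 4) - S.a) / 4 ≤ e := by linarith
    exact_mod_cast this

/-- On the segment from x to its nearest point p, the triangle inequality and uniqueness of
projections show that p remains the nearest point. The quadratic upper bound on the energy thus
applies along the whole segment with the same p. -/
theorem segment_to_minus (hP : S.ProjectionsH) (hU : S.Unbalanced) (hS : S.SmallerSpace) {x : H}
    (hx : x ∈ tube (S.FH S.minus) S.minus.r₀) {θ : ℝ} (h0 : 0 ≤ θ) (h1 : θ ≤ 1) :
    S.E (S.ι (proj (S.FH S.minus) x + θ • (x - proj (S.FH S.minus) x))) ≤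
      ((S.minus.C ^ 2 * ‖x - proj (S.FH S.minus) x‖ ^ 2 + S.a : ℝ) : EReal) ∧
    Metric.infDist (S.ι (proj (S.FH S.minus) x + θ • (x - proj (S.FH S.minus) x))) S.minus.F ≤
      Metric.infDist x (S.FH S.minus) := by
  obtain ⟨hp1, hp2, -⟩ := proj_spec hP.1.uniqueProj hx
  set p := proj (S.FH S.minus) x
  set y := p + θ • (x - p) with hy
  have hd : ‖x - p‖ = Metric.infDist x (S.FH S.minus) := by rw [← hp2, dist_eq_norm]
  have hyp : dist y p = θ * ‖x - p‖ := by
    rw [dist_eq_norm, hy, add_sub_cancel_left, norm_smul, Real.norm_of_nonneg h0]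
  have hxy : dist x y = (1 - θ) * ‖x - p‖ := by
    have : x - y = (1 - θ) • (x - p) := by rw [hy]; module
    rw [dist_eq_norm, this, norm_smul, Real.norm_of_nonneg (by linarith)]
  have hle : Metric.infDist y (S.FH S.minus) ≤ θ * ‖x - p‖ := by
    rw [← hyp]; exact Metric.infDist_le_dist_of_mem hp1
  have hge : θ * ‖x - p‖ ≤ Metric.infDist y (S.FH S.minus) := by
    have := Metric.infDist_le_infDist_add_dist (s := S.FH S.minus) (x := x) (y := y)
    rw [hxy, ← hd] at this
    linarith
  have hn := norm_nonneg (x - p)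
  have hle' : Metric.infDist y (S.FH S.minus) ≤ Metric.infDist x (S.FH S.minus) := by
    rw [← hd]; nlinarith
  have hyt : y ∈ tube (S.FH S.minus) S.minus.r₀ := hle'.trans hx
  obtain ⟨-, -, huniq⟩ := proj_spec hP.1.uniqueProj hyt
  have hpy := huniq p hp1 (by rw [hyp]; exact le_antisymm hge hle)
  refine ⟨(hP.1.upper y hyt).trans ?_, (infDist_ι_le hU hS y).trans hle'⟩
  rw [← hpy, ← dist_eq_norm, hyp]
  have : (θ * ‖x - p‖) ^ 2 ≤ ‖x - p‖ ^ 2 := by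
    have : θ * ‖x - p‖ ≤ ‖x - p‖ := by nlinarith
    gcongr
  have : S.minus.C ^ 2 * (θ * ‖x - p‖) ^ 2 + S.a ≤ S.minus.C ^ 2 * ‖x - p‖ ^ 2 + S.a := by gcongr
  exact_mod_cast this

end Minus

variable (S) in
/-- An admissible curve at the right end whose energy is negative. -/
structure NegativeCurve (c : ℝ) (U : ℝ → L) : Prop where
  h1Loc : H1Loc U univ
  tail : ∃ T : ℝ, ∀ t ≥ T, Metric.infDist (U t) S.plus.F ≤ S.plus.r₀ / 2
  negative : S.energyPos c U univ < S.energyNeg c U univ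

variable (S) in
/-- A curve with negative energy along which the potential is negative for the last time at `0`. -/
structure Profile (c : ℝ) (U : ℝ → L) : Prop where
  h1Loc : H1Loc U univ
  tail : ∃ T : ℝ, ∀ t ≥ T, Metric.infDist (U t) S.plus.F ≤ S.plus.r₀ / 2
  nonneg : ∀ t > 0, 0 ≤ S.E (U t)
  mem_closure : (0 : ℝ) ∈ closure {t | S.E (U t) < 0}
  lt : S.shiftedEnergy c U 0 < ENNReal.ofReal (-S.a / c)

theorem energyPos_lt_energyNeg_iff (hU : S.Unbalanced) {c : ℝ} (hc : 0 < c) {U : ℝ → L}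
    (hUc : Continuous U) {t₀ : ℝ} (h : ∀ t > t₀, 0 ≤ S.E (U t)) :
    S.energyPos c U univ < S.energyNeg c U univ ↔
      S.shiftedEnergy c U t₀ < ENNReal.ofReal (-S.a * Real.exp (c * t₀) / c) := by
  have h1 := energyPos_add_eq hU hc hUc h
  have h2 := energyNeg_ne_top hU hc h univ
  set m := ENNReal.ofReal (-S.a * Real.exp (c * t₀) / c) with hm
  have hmt : m ≠ ⊤ := ENNReal.ofReal_ne_top
  constructor
  · intro hlt
    have : S.energyPos c U univ + m < S.energyNeg c U univ + m := by
      rwa [ENNReal.add_lt_add_iff_right hmt]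
    rw [← h1, add_comm _ m] at this
    exact (ENNReal.add_lt_add_iff_right h2).1 this
  · intro hlt
    have : S.shiftedEnergy c U t₀ + S.energyNeg c U univ < m + S.energyNeg c U univ := by
      rwa [ENNReal.add_lt_add_iff_right h2]
    rw [h1, add_comm m] at this
    exact (ENNReal.add_lt_add_iff_right hmt).1 this

theorem nonneg_of_mem_plus (hU : S.Unbalanced) {v : L}
    (hv : Metric.infDist v S.plus.F ≤ S.plus.r₀ / 2) : 0 ≤ S.E v := by
  have h1 := hU.wellPlus.r₀_pos
  have h2 := hU.wellPlus.one_lt_C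
  refine le_trans ?_ (hU.wellPlus.coercive v (show Metric.infDist v S.plus.F ≤ S.plus.r₀ by linarith))
  have : 0 ≤ S.plus.C⁻¹ * Metric.infDist v S.plus.F ^ 2 + 0 := by positivity
  exact_mod_cast this

theorem not_mem_minus (hU : S.Unbalanced) {v : L}
    (hv : Metric.infDist v S.plus.F ≤ S.plus.r₀ / 2) : S.minus.r₀ < Metric.infDist v S.minus.F := by
  have h1 := hU.wellPlus.r₀_pos
  by_contra! h
  exact disjoint_left.1 hU.disjoint (show Metric.infDist v S.plus.F ≤ S.plus.r₀ by linarith) h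

/-- Translate the last time of negative potential to 0; it exists because the potential is
nonnegative near F⁺. Translation multiplies both the shifted energy and its threshold by the same
exponential, so negativity is preserved. -/
theorem NegativeCurve.exists_profile (hU : S.Unbalanced) {c : ℝ} (hc : 0 < c) {U : ℝ → L}
    (h : S.NegativeCurve c U) : ∃ V, S.Profile c V := by
  have hUc := h.h1Loc.continuous
  obtain ⟨T, hT⟩ := h.tail
  set N := {t | S.E (U t) < 0} with hN
  -- Were the potential nonnegative throughout, the negative part of the energy would vanish and
  -- could not exceed the positive part.
  have hNne : N.Nonempty := by
    by_contra hemp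
    rw [not_nonempty_iff_eq_empty] at hemp
    have h0 : S.energyNeg c U univ = 0 := by
      rw [energyNeg]
      refine lintegral_eq_zero_of_ae_eq_zero (ae_of_all _ fun t => ?_)
      have ht : ¬ S.E (U t) < 0 := fun ht => by
        have : t ∈ N := ht
        rw [hemp] at this; exact this
      change (-S.density c U t).toENNReal = 0
      rcases hU.E_cases (U t) with h' | ⟨e, -, h'⟩
      · simp [density_of_top h']
      · rw [density_of_coe h', ← EReal.coe_neg, EReal.real_coe_toENNReal]
        refine ENNReal.ofReal_of_nonpos ?_
        rw [h'] at ht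
        have : 0 ≤ e := by exact_mod_cast not_lt.1 ht
        have := Real.exp_pos (c * t)
        rw [neg_nonpos]; positivity
    have := h.negative
    rw [h0] at this
    exact not_lt_zero this
  have hNbdd : BddAbove N := ⟨T, fun t ht => by
    by_contra! hlt
    exact absurd (nonneg_of_mem_plus hU (hT t hlt.le)) (not_le.2 ht)⟩
  set t₀ := sSup N with ht₀
  have hcl : t₀ ∈ closure N := csSup_mem_closure hNne hNbdd
  have hnn : ∀ t > t₀, 0 ≤ S.E (U t) := fun t ht => by
    by_contra! hlt
    exact absurd (le_csSup hNbdd (show t ∈ N from hlt)) (not_le.2 ht)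
  have hlt := (energyPos_lt_energyNeg_iff hU hc hUc hnn).1 h.negative
  refine ⟨fun t => U (1 * t + t₀), h.h1Loc.comp_affine one_pos t₀, ⟨T - t₀, fun t ht => ?_⟩,
    fun t ht => ?_, ?_, ?_⟩
  · exact hT _ (by linarith)
  · exact hnn _ (by linarith)
  · have : {t | S.E (U (1 * t + t₀)) < 0} = (Homeomorph.addRight t₀) ⁻¹' N := by
      ext t; simp [hN]
    rw [this, ← Homeomorph.preimage_closure]
    simpa using hcl
  · have h2 := shiftedEnergy_comp_affine_le (S := S) (c := c) U le_rfl t₀ 0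
    rw [one_mul, mul_zero, zero_add] at h2
    refine h2.trans_lt ?_
    have h3 : ENNReal.ofReal (-S.a / c) = ENNReal.ofReal (Real.exp (-(c * t₀)) * 1) *
        ENNReal.ofReal (-S.a * Real.exp (c * t₀) / c) := by
      rw [← ENNReal.ofReal_mul (by positivity), Real.exp_neg]
      congr 1; field_simp
    rw [h3]
    refine ENNReal.mul_lt_mul_right ?_ ENNReal.ofReal_ne_top hlt
    simpa using Real.exp_pos _

/-- Points of negative potential lie near F⁻ in `L`, and the threshold β(η) brings them within η.
Lower semicontinuity and continuity of the distance extend both facts to limit times. -/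
theorem near_minus_of_mem_closure (hP : S.ProjectionsH) (hU : S.Unbalanced) (hS : S.SmallerSpace)
    (hL : S.LevelSets) {U : ℝ → L} (hUc : Continuous U) {t : ℝ}
    (ht : t ∈ closure {t | S.E (U t) < 0}) :
    S.E (U t) ≤ 0 ∧ Metric.infDist (U t) S.minus.F ≤ S.etaMinus := by
  have hr := hU.wellMinus.r₀_pos
  constructor
  · have hcl : IsClosed {t | S.E (U t) ≤ 0} :=
      ((lowerSemicontinuous_of_weaklyLSC hU.wlsc).comp hUc).isClosed_preimage 0
    exact closure_minimal (fun s (hs : S.E (U s) < 0) => hs.le) hcl ht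
  · have hcl : IsClosed {t | Metric.infDist (U t) S.minus.F ≤ S.etaMinus} :=
      isClosed_le ((Metric.continuous_infDist_pt _).comp hUc) continuous_const
    refine closure_minimal (fun s (hs : S.E (U s) < 0) => ?_) hcl ht
    have h1 : Metric.infDist (U s) S.minus.F ≤ S.minus.r₀ / 2 := hL.negative_subset hs
    obtain ⟨x, hx, hx2⟩ := exists_near_minus_of_nonpos hP hU hL (v := U s) (by linarith) hs.le
    have := infDist_ι_le hU hS x
    rw [hx] at this
    exact this.trans hx2

theorem infDist_sub_le (F : Set L) (v w : L) :
    Metric.infDist v F - Metric.infDist w F ≤ ‖v - w‖ := by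
  have := Metric.infDist_le_infDist_add_dist (s := F) (x := v) (y := w)
  rw [dist_eq_norm] at this
  linarith

theorem setLIntegral_le_shiftedEnergy (c : ℝ) (U : ℝ → L) (t₀ : ℝ) (I : Set ℝ) :
    ∫⁻ t in I, (kin c U t + ENNReal.ofReal (Real.exp (c * t)) * S.exc U t₀ t) ≤
      S.shiftedEnergy c U t₀ := setLIntegral_le_lintegral _ _

/-- At time 0 the curve is within η ≤ r₀/4 of F⁻, and later it is farther than r₀. Crossing from
r₀/4 to r₀ after time 0 costs at least √(2κ')·(3r₀/4) with κ' = (κ - a)/4. By the definition of η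
this is at least 3η², hence at least 12 C²(C+1)(-a), while the budget is -a/c. -/
theorem Profile.speed_le (hP : S.ProjectionsH) (hU : S.Unbalanced) (hS : S.SmallerSpace)
    (hL : S.LevelSets) {c : ℝ} (hc : 0 < c) {U : ℝ → L} (h : S.Profile c U) :
    c * (12 * (S.minus.C ^ 2 * (S.minus.C + 1))) ≤ 1 := by
  obtain ⟨hη1, -, hη, hη2, hη3, hk⟩ := etaMinus_facts hU hL
  have hUc := h.h1Loc.continuous
  have hr := hU.wellMinus.r₀_pos
  have hC := hU.wellMinus.one_lt_C
  have ha := hU.a_neg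
  obtain ⟨T, hT⟩ := h.tail
  have h0 := (near_minus_of_mem_closure hP hU hS hL hUc h.mem_closure).2
  have hend := not_mem_minus hU (hT (max T 0) (le_max_left _ _))
  obtain ⟨s, t, hs0, hst, -, hfs, hft, hmid⟩ := exists_crossing
    (f := fun t => Metric.infDist (U t) S.minus.F) ((Metric.continuous_infDist_pt _).comp hUc)
    (le_max_right T 0) (by linarith : S.minus.r₀ / 4 < S.minus.r₀) (by linarith) hend.le
  set k := S.kappaMinus (S.minus.r₀ / 4) - S.a with hkdef
  have hd : 3 / 4 * S.minus.r₀ ≤ ‖U t - U s‖ := by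
    have := infDist_sub_le S.minus.F (U t) (U s)
    rw [hfs, hft] at this; linarith
  have h1 := h.h1Loc.ofReal_norm_sub_le hc hst.le (by positivity : 0 ≤ k / 4)
  have h2 : ∫⁻ x in Ioc s t, (kin c U x + ENNReal.ofReal (Real.exp (c * x)) * ENNReal.ofReal (k / 4))
      ≤ S.shiftedEnergy c U 0 := by
    refine le_trans (setLIntegral_mono' measurableSet_Ioc fun x hx => ?_)
      (setLIntegral_le_shiftedEnergy c U 0 (Ioc s t))
    have hx1 : S.minus.r₀ / 4 < Metric.infDist (U x) S.minus.F ∧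
        Metric.infDist (U x) S.minus.F ≤ S.minus.r₀ := by
      rcases hx.2.lt_or_eq with h' | rfl
      · exact ⟨(hmid x ⟨hx.1, h'⟩).1, (hmid x ⟨hx.1, h'⟩).2.le⟩
      · rw [hft]; exact ⟨by linarith, le_rfl⟩
    have := ofReal_le_exc (t₀ := 0) (le_energy_of_infDist hP hU hS hL hx1.1 hx1.2).2
    rw [shift_of_gt (by linarith [hx.1]), add_zero] at this
    gcongr
  have h3 := (h1.trans h2).trans_lt h.lt
  rw [ENNReal.ofReal_lt_ofReal_iff_of_nonneg (by positivity)] at h3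
  have hsq : √(2 * (k / 4)) = √(2 * k) / 2 := by
    rw [show 2 * (k / 4) = 2 * k / 2 ^ 2 by ring, Real.sqrt_div' _ (by positivity),
      Real.sqrt_sq (by norm_num)]
  have he1 : 1 ≤ Real.exp (c * s) := Real.one_le_exp (by positivity)
  have hexp : 2 ≤ Real.exp 1 := by linarith [Real.add_one_le_exp (1 : ℝ)]
  have h4 : 2 * S.etaMinus ^ 2 ≤ S.minus.r₀ / 4 * √(2 * k) := by
    rw [mul_assoc, inv_mul_eq_div, le_div_iff₀ (Real.exp_pos 1)] at hη3
    nlinarith [sq_nonneg S.etaMinus]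
  have h5 : √(2 * k) / 2 * (3 / 4 * S.minus.r₀) ≤
      Real.exp (c * s) * √(2 * (k / 4)) * ‖U t - U s‖ := by
    rw [hsq]
    calc √(2 * k) / 2 * (3 / 4 * S.minus.r₀) = 1 * (√(2 * k) / 2) * (3 / 4 * S.minus.r₀) := by ring
      _ ≤ _ := by gcongr
  have h6 : 12 * (S.minus.C ^ 2 * (S.minus.C + 1) * -S.a) ≤ -S.a / c := by linarith
  rw [le_div_iff₀ hc] at h6
  nlinarith

theorem lintegral_exp_Ioi_eq_top {c ε : ℝ} (hc : 0 < c) (hε : 0 < ε) (M : ℝ) :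
    ∫⁻ t in Ioi M, ENNReal.ofReal (Real.exp (c * t)) * ENNReal.ofReal ε = ⊤ := by
  refine top_le_iff.1 ?_
  have h1 : ∫⁻ t in Ioi M, ENNReal.ofReal (Real.exp (c * M)) * ENNReal.ofReal ε = ⊤ := by
    rw [setLIntegral_const, Real.volume_Ioi, ENNReal.mul_top]
    have := Real.exp_pos (c * M)
    simp [this, hε]
  rw [← h1]
  refine setLIntegral_mono' measurableSet_Ioi fun t ht => ?_
  have : M ≤ t := le_of_lt ht
  gcongr

/-- A curve outside the half tube at time t must later come within r₀/4 of F⁺: otherwise, being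
eventually in the half tube, it would have infinite weighted energy by coercivity. This move costs
at least (c/2) e^{ct} (r₀/4)², and e^{ct} ≥ ct while the budget is -a/c. -/
theorem Profile.tail_bound (hU : S.Unbalanced) {c : ℝ} (hc : 0 < c) {U : ℝ → L}
    (h : S.Profile c U) {t : ℝ} (ht : 0 < t)
    (htd : S.plus.r₀ / 2 < Metric.infDist (U t) S.plus.F) :
    t ≤ 32 * -S.a / (c ^ 3 * S.plus.r₀ ^ 2) := by
  have hr := hU.wellPlus.r₀_pos
  have hC := hU.wellPlus.one_lt_C
  have ha := hU.a_neg
  obtain ⟨T, hT⟩ := h.tail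
  obtain ⟨t', htt', ht'⟩ : ∃ t' > t, Metric.infDist (U t') S.plus.F ≤ S.plus.r₀ / 4 := by
    by_contra! hcon
    have hlt := h.lt
    have htop : S.shiftedEnergy c U 0 = ⊤ := by
      refine top_le_iff.1 ?_
      rw [← lintegral_exp_Ioi_eq_top hc (ε := S.plus.C⁻¹ * (S.plus.r₀ / 4) ^ 2) (by positivity)
        (max t T)]
      refine le_trans (setLIntegral_mono' measurableSet_Ioi fun s hs => ?_)
        (setLIntegral_le_shiftedEnergy c U 0 (Ioi (max t T)))
      have hs1 : t < s := lt_of_le_of_lt (le_max_left _ _) hs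
      have hs2 : T < s := lt_of_le_of_lt (le_max_right _ _) hs
      have h1 := hU.wellPlus.coercive (U s)
        (show Metric.infDist (U s) S.plus.F ≤ S.plus.r₀ by linarith [hT s hs2.le])
      have h2 := ofReal_le_exc (t₀ := 0) h1
      rw [shift_of_gt (by linarith), add_zero, add_zero] at h2
      refine le_trans ?_ (le_add_of_nonneg_left zero_le)
      gcongr
      refine le_trans (ENNReal.ofReal_le_ofReal ?_) h2
      have := (hcon s hs1).le
      gcongr
    rw [htop] at hlt
    exact not_top_lt hlt
  have hd : S.plus.r₀ / 4 ≤ ‖U t' - U t‖ := by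
    have := infDist_sub_le S.plus.F (U t) (U t')
    rw [norm_sub_rev] at this
    linarith
  have h1 := h.h1Loc.ofReal_norm_sub_sq_le hc (le_of_lt htt')
  have h2 : ∫⁻ x in Ioc t t', kin c U x ≤ S.shiftedEnergy c U 0 :=
    le_trans (lintegral_mono fun x => le_self_add) (setLIntegral_le_shiftedEnergy c U 0 (Ioc t t'))
  have h3 := (h1.trans h2).trans_lt h.lt
  rw [ENNReal.ofReal_lt_ofReal_iff_of_nonneg (by positivity)] at h3
  have h4 : c / 2 * (c * t) * (S.plus.r₀ / 4) ^ 2 ≤ c / 2 * Real.exp (c * t) * ‖U t' - U t‖ ^ 2 := by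
    have := Real.add_one_le_exp (c * t)
    gcongr
    linarith
  rw [lt_div_iff₀ hc] at h3
  rw [le_div_iff₀ (by positivity)]
  nlinarith

theorem norm_sub_le_of_isometric_fderiv {Q : L → L} (hQ : Differentiable ℝ Q)
    (hQ' : ∀ x y, ‖fderiv ℝ Q x y‖ = ‖y‖) (v w : L) : ‖Q v - Q w‖ ≤ ‖v - w‖ := by
  have := Convex.norm_image_sub_le_of_norm_fderiv_le (f := Q) (𝕜 := ℝ) (s := univ) (C := 1)
    (x := w) (y := v) (fun x _ => hQ x)
    (fun x _ => ContinuousLinearMap.opNorm_le_bound _ zero_le_one fun y => by rw [hQ', one_mul])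
    convex_univ trivial trivial
  simpa using this

/-- Compactness needs an anchor. If F⁺ is bounded, every point near it is; otherwise the inverse
projection sends the nearest point of U T to a fixed point of F⁺. It is nonexpansive and preserves
the potential, so a profile stays a profile. The bound R depends neither on the speed nor on the
curve. -/
theorem exists_bounded_profile (hU : S.Unbalanced) (hI : S.ProjectionsInverse) :
    ∃ R : ℝ, ∀ (c : ℝ) (U : ℝ → L), S.Profile c U → ∀ T : ℝ,
      Metric.infDist (U T) S.plus.F ≤ S.plus.r₀ / 2 →
      ∃ V, S.Profile c V ∧ (∀ t, Metric.infDist (V t) S.plus.F = Metric.infDist (U t) S.plus.F) ∧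
        ‖V T‖ ≤ R := by
  obtain ⟨z, hz⟩ := hU.wellPlus.nonempty
  have hr := hU.wellPlus.r₀_pos
  rcases hI S.plus (by simp) with hb | hQ
  · obtain ⟨R, hR⟩ := hb.exists_norm_le
    refine ⟨R + S.plus.r₀, fun c U h T hT => ⟨U, h, fun _ => rfl, ?_⟩⟩
    obtain ⟨w, hw, hd⟩ := (Metric.infDist_lt_iff ⟨z, hz⟩).1 (show _ < S.plus.r₀ by linarith)
    rw [dist_eq_norm] at hd
    calc ‖U T‖ = ‖w + (U T - w)‖ := by congr 1; abel
      _ ≤ ‖w‖ + ‖U T - w‖ := norm_add_le _ _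
      _ ≤ _ := add_le_add (hR w hw) hd.le
  · refine ⟨‖z‖ + S.plus.r₀, fun c U h T hT => ?_⟩
    obtain ⟨Q, hQ1, hQ2, hQ3, hQ4, hQ5⟩ := hQ (U T)
      (show Metric.infDist (U T) S.plus.F ≤ S.plus.r₀ by linarith) z hz
    have hQL := norm_sub_le_of_isometric_fderiv hQ3 hQ4
    obtain ⟨hV1, hV2⟩ := h.h1Loc.of_norm_sub_le (V := fun t => Q (U t)) fun s t => hQL _ _
    refine ⟨fun t => Q (U t), ⟨hV1, ?_, fun t ht => ?_, ?_, ?_⟩, fun t => hQ2 _, ?_⟩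
    · obtain ⟨T', hT'⟩ := h.tail
      exact ⟨T', fun t ht => by rw [hQ2]; exact hT' t ht⟩
    · rw [hQ5]; exact h.nonneg t ht
    · simp only [hQ5]; exact h.mem_closure
    · exact (shiftedEnergy_mono hV2 fun t => (hQ5 _).le).trans_lt h.lt
    · have h1 : Q (U T) ∈ tube S.plus.F S.plus.r₀ := by
        change Metric.infDist _ _ ≤ _
        rw [hQ2]; linarith
      have h2 := (proj_spec hU.wellPlus.uniqueProj h1).2.1
      rw [hQ1, hQ2, dist_eq_norm] at h2
      calc ‖Q (U T)‖ = ‖z + (Q (U T) - z)‖ := by congr 1; abel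
        _ ≤ ‖z‖ + ‖Q (U T) - z‖ := norm_add_le _ _
        _ ≤ _ := by rw [h2]; linarith

end Setting

end

/-! ### Removing excursions away from F⁻ -/

section

namespace Setting

variable {L H K : Type*}
  [NormedAddCommGroup L] [InnerProductSpace ℝ L] [CompleteSpace L]
  [NormedAddCommGroup H] [InnerProductSpace ℝ H]
  [NormedAddCommGroup K] [InnerProductSpace ℝ K] {S : Setting L H K}

/-- The energy spent before time `s` by a curve that leaves the tube around `F⁻` at time `τ`, keeps
a nonnegative potential until `s`, and is then close to `F⁻`. -/
theorem excursion_le (hP : S.ProjectionsH) (hU : S.Unbalanced) (hS : S.SmallerSpace)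
    (hL : S.LevelSets) {c : ℝ} (hc : 0 < c)
    (hcC : c * (12 * (S.minus.C ^ 2 * (S.minus.C + 1))) ≤ 1) {U : ℝ → L} (h : H1Loc U univ)
    {τ s : ℝ} (hτs : τ ≤ s) (hs0 : s ≤ 0) (hτ : S.minus.r₀ / 2 ≤ Metric.infDist (U τ) S.minus.F)
    (hs : Metric.infDist (U s) S.minus.F ≤ S.minus.r₀ / 4)
    (hnn : ∀ t ∈ Ioo τ s, 0 ≤ S.E (U t)) :
    ENNReal.ofReal (Real.exp (c * s) * (4 * (S.minus.C ^ 2 * (S.minus.C + 1) * -S.a))) ≤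
      ∫⁻ t in Iic s, (kin c U t + ENNReal.ofReal (Real.exp (c * t)) * S.exc U 0 t) := by
  obtain ⟨hη1, -, hη, hη2, hη3, hk⟩ := etaMinus_facts hU hL
  have hUc := h.continuous
  have hr := hU.wellMinus.r₀_pos
  have hC := hU.wellMinus.one_lt_C
  have ha := hU.a_neg
  have hes := Real.exp_pos (c * s)
  -- A short excursion has weights comparable to e^{cs} up to a factor e, and crossing from r₀/2 to
  -- r₀/4 costs at least η² e^{cs}. A long one keeps a shifted potential of at least -a during a
  -- time 1/c, and the speed bound makes 1/c large. With e ≤ 3, the constant 12 of that bound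
  -- becomes 4.
  rcases le_or_gt (s - τ) (1 / c) with hshort | hlong
  · obtain ⟨s', t', hs', hst, ht', hfs, hft, hmid⟩ := exists_crossing
      (f := fun t => -Metric.infDist (U t) S.minus.F)
      ((Metric.continuous_infDist_pt _).comp hUc).neg hτs
      (by linarith : -(S.minus.r₀ / 2) < -(S.minus.r₀ / 4)) (by linarith) (by linarith)
    set k := S.kappaMinus (S.minus.r₀ / 4) - S.a with hkdef
    have hd : S.minus.r₀ / 4 ≤ ‖U t' - U s'‖ := by
      have := infDist_sub_le S.minus.F (U s') (U t')
      rw [norm_sub_rev] at this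
      linarith
    have h1 := h.ofReal_norm_sub_le hc hst.le hk.le
    have h2 : ∫⁻ x in Ioc s' t', (kin c U x + ENNReal.ofReal (Real.exp (c * x)) * ENNReal.ofReal k)
        ≤ ∫⁻ t in Iic s, (kin c U t + ENNReal.ofReal (Real.exp (c * t)) * S.exc U 0 t) := by
      rw [← setLIntegral_congr Ioo_ae_eq_Ioc]
      refine le_trans (setLIntegral_mono' measurableSet_Ioo fun x hx => ?_)
        (lintegral_mono_set (s := Ioo s' t') fun x hx => hx.2.le.trans ht')
      have hx1 := hmid x hx
      have := ofReal_le_exc (t₀ := 0) (U := U) (t := x) (le_energy_of_infDist hP hU hS hL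
        (by linarith [hx1.2]) (by linarith [hx1.1])).1
      rw [shift_of_le (by linarith [hx.2]), ← sub_eq_add_neg] at this
      gcongr
    refine le_trans (ENNReal.ofReal_le_ofReal ?_) (h1.trans h2)
    have he : Real.exp (c * s) * (Real.exp 1)⁻¹ ≤ Real.exp (c * s') := by
      rw [← Real.exp_neg, ← Real.exp_add]
      refine Real.exp_le_exp.2 ?_
      have : c * (s - s') ≤ c * (1 / c) := by gcongr; linarith
      rw [mul_one_div_cancel hc.ne'] at this
      linarith
    calc Real.exp (c * s) * (4 * (S.minus.C ^ 2 * (S.minus.C + 1) * -S.a))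
        ≤ Real.exp (c * s) * ((Real.exp 1)⁻¹ * (S.minus.r₀ / 4) * √(2 * k)) := by
          refine mul_le_mul_of_nonneg_left ?_ hes.le
          linarith
      _ = Real.exp (c * s) * (Real.exp 1)⁻¹ * √(2 * k) * (S.minus.r₀ / 4) := by ring
      _ ≤ Real.exp (c * s') * √(2 * k) * ‖U t' - U s'‖ := by gcongr
  · have h2 : ∫⁻ _ in Ioo (s - 1 / c) s, ENNReal.ofReal (Real.exp (c * s) * (Real.exp 1)⁻¹ * -S.a)
        ≤ ∫⁻ t in Iic s, (kin c U t + ENNReal.ofReal (Real.exp (c * t)) * S.exc U 0 t) := by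
      refine le_trans (setLIntegral_mono' measurableSet_Ioo fun x hx => ?_)
        (lintegral_mono_set (s := Ioo (s - 1 / c) s) fun x hx => hx.2.le)
      have := ofReal_le_exc (t₀ := 0) (U := U) (t := x) (r := 0) (by
        simpa using hnn x ⟨by linarith [hx.1], hx.2⟩)
      rw [shift_of_le (by linarith [hx.2]), zero_add] at this
      have he : Real.exp (c * s) * (Real.exp 1)⁻¹ ≤ Real.exp (c * x) := by
        rw [← Real.exp_neg, ← Real.exp_add]
        refine Real.exp_le_exp.2 ?_
        have : c * (s - x) ≤ c * (1 / c) := by gcongr; linarith [hx.1]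
        rw [mul_one_div_cancel hc.ne'] at this
        linarith
      refine le_trans ?_ (le_add_of_nonneg_left zero_le)
      rw [ENNReal.ofReal_mul (by positivity)]
      gcongr
    refine le_trans ?_ h2
    rw [setLIntegral_const, Real.volume_Ioo, ← ENNReal.ofReal_mul (by
      have : 0 ≤ -S.a := by linarith
      positivity)]
    refine ENNReal.ofReal_le_ofReal ?_
    rw [sub_sub_cancel]
    have h3 : Real.exp 1 ≤ 3 := by linarith [Real.exp_one_lt_d9]
    have h4 : (1 : ℝ) / 3 ≤ (Real.exp 1)⁻¹ := by
      rw [one_div]; exact inv_anti₀ (Real.exp_pos 1) h3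
    have h5 : 12 * (S.minus.C ^ 2 * (S.minus.C + 1)) ≤ 1 / c := by
      rw [le_div_iff₀ hc]; linarith
    have h6 : 0 ≤ -S.a := by linarith
    calc Real.exp (c * s) * (4 * (S.minus.C ^ 2 * (S.minus.C + 1) * -S.a))
        = Real.exp (c * s) * (1 / 3) * -S.a * (12 * (S.minus.C ^ 2 * (S.minus.C + 1))) := by ring
      _ ≤ Real.exp (c * s) * (Real.exp 1)⁻¹ * -S.a * (1 / c) := by gcongr

/-- A point of `F⁻` can be connected at low cost to a nearby point of nonpositive energy. -/
theorem exists_connection (hP : S.ProjectionsH) (hU : S.Unbalanced) (hS : S.SmallerSpace)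
    (hL : S.LevelSets) {c : ℝ} (hc : 0 < c) {v : L} (hv : S.E v ≤ 0)
    (hvd : Metric.infDist v S.minus.F ≤ S.minus.r₀) {s : ℝ} (hs : s ≤ 0) :
    ∃ W : ℝ → L, H1Loc W univ ∧ W s = v ∧
      (∀ t ≤ s, Metric.infDist (W t) S.minus.F ≤ S.minus.r₀ / 2) ∧
      ∫⁻ t in Iic s, (kin c W t + ENNReal.ofReal (Real.exp (c * t)) * S.exc W 0 t) ≤
        ENNReal.ofReal (Real.exp (c * s) * (4 * (S.minus.C ^ 2 * (S.minus.C + 1) * -S.a))) := by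
  obtain ⟨-, -, hη, hη2, -, -⟩ := etaMinus_facts hU hL
  have hr := hU.wellMinus.r₀_pos
  have hC := hU.wellMinus.one_lt_C
  have ha := hU.a_neg
  obtain ⟨x, rfl, hx⟩ := exists_near_minus_of_nonpos hP hU hL hvd hv
  have hxt : x ∈ tube (S.FH S.minus) S.minus.r₀ :=
    hx.trans (by linarith : S.etaMinus ≤ S.minus.r₀)
  obtain ⟨hp1, hp2, -⟩ := proj_spec hP.1.uniqueProj hxt
  have hlow := hP.1.lower x hxt
  have hseg := fun θ h0 h1 => segment_to_minus hP hU hS hxt (θ := θ) h0 h1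
  set p := proj (S.FH S.minus) x with hp
  set d := ‖x - p‖ with hd
  set C := S.minus.C with hCdef
  have hC0 : 0 < C := by linarith
  -- The lower quadratic bound at a point of nonpositive energy.
  have hd2 : d ^ 2 ≤ C ^ 2 * -S.a := by
    have : (((C ^ 2)⁻¹ * d ^ 2 + S.a : ℝ) : EReal) ≤ ((0 : ℝ) : EReal) := hlow.trans (by simpa using hv)
    have : (C ^ 2)⁻¹ * d ^ 2 + S.a ≤ 0 := by exact_mod_cast this
    have h2 : (C ^ 2)⁻¹ * d ^ 2 ≤ -S.a := by linarith
    rwa [inv_mul_le_iff₀ (by positivity)] at h2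
  have hdL : ‖S.ι (x - p)‖ ≤ d := hS.norm_ι_le _
  -- The curve rests at p until b, where the shifted density vanishes, then runs along the segment
  -- in time 1/C. Its cost is at most e^{cs}(C²d²/2 + C²d²)/C = (3/2) C d² e^{cs}, which fits the
  -- lower bound of `excursion_le` because d² ≤ C²(-a).
  set b := s - 1 / C with hb
  have hbs : b < s := by rw [hb]; linarith [one_div_pos.2 hC0]
  set A : ℝ → L := fun t => S.ι p + (t - b) • (C • S.ι (x - p)) with hA
  set W := glue (fun _ => S.ι p) A b with hW
  have hAb : S.ι p = A b := by simp [hA]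
  have hWs : ∀ t, b ≤ t → W t = S.ι (p + (C * (t - b)) • (x - p)) := fun t ht => by
    rw [hW, glue_of_ge _ _ ht, map_add, map_smul]
    change S.ι p + (t - b) • C • S.ι (x - p) = _
    rw [smul_smul, mul_comm]
  have hθ : ∀ t, b ≤ t → t ≤ s → 0 ≤ C * (t - b) ∧ C * (t - b) ≤ 1 := fun t h1 h2 => by
    refine ⟨mul_nonneg hC0.le (by linarith), ?_⟩
    have h3 : t - b ≤ 1 / C := by rw [hb]; linarith
    calc C * (t - b) ≤ C * (1 / C) := by gcongr
      _ = 1 := mul_one_div_cancel hC0.ne'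
  refine ⟨W, (h1Loc_const _).glue (h1Loc_affine _ _ _) hAb, ?_, fun t ht => ?_, ?_⟩
  · rw [hWs s hbs.le, hb, sub_sub_cancel, mul_one_div_cancel hC0.ne', one_smul]
    congr 1; abel
  · rcases lt_or_ge t b with h1 | h1
    · rw [hW, glue_of_lt _ _ h1]
      have : Metric.infDist (S.ι p) S.minus.F = 0 := Metric.infDist_zero_of_mem hp1
      rw [this]; positivity
    · rw [hWs t h1]
      have := (hseg _ (hθ t h1 ht).1 (hθ t h1 ht).2).2
      linarith
  · have h1 : ∫⁻ t in Iic s, (kin c W t + ENNReal.ofReal (Real.exp (c * t)) * S.exc W 0 t) ≤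
        ∫⁻ t in Iic s, (Icc b s).indicator
          (fun _ => ENNReal.ofReal (Real.exp (c * s) * (3 / 2 * C ^ 2 * d ^ 2))) t := by
      have hne : ∀ᵐ t : ℝ, t ≠ b := by simp [ae_iff, measure_singleton]
      refine lintegral_mono_ae ((ae_restrict_iff' measurableSet_Iic).2 ?_)
      filter_upwards [hne] with t htb hts
      have hts : t ≤ s := hts
      have ht0 : t ≤ 0 := hts.trans hs
      rcases lt_or_gt_of_ne htb with h1 | h1
      · have hk : kin c W t = 0 := by
          rw [kin, hW, deriv_glue_of_lt _ _ h1]; simp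
        have hE : S.E (W t) = (S.a : EReal) := by
          rw [hW, glue_of_lt _ _ h1]; exact hU.wellMinus.energy_eq _ hp1
        rw [hk, exc_coe hE, shift_of_le ht0]; simp
      · rw [indicator_of_mem (s := Icc b s) ⟨h1.le, hts⟩]
        have hder : deriv W t = C • S.ι (x - p) := by
          rw [hW, deriv_glue_of_gt _ _ h1, hA]
          have : HasDerivAt (fun t : ℝ => S.ι p + (t - b) • (C • S.ι (x - p)))
              ((1 : ℝ) • (C • S.ι (x - p))) t :=
            (((hasDerivAt_id' t).sub_const b).smul_const _).const_add _
          rw [this.deriv, one_smul]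
        have hE := exc_le_ofReal (U := W) (t₀ := 0) (t := t) (by
          rw [hWs t h1.le]; exact (hseg _ (hθ t h1.le hts).1 (hθ t h1.le hts).2).1)
        rw [shift_of_le ht0] at hE
        have hkin : kin c W t ≤ ENNReal.ofReal (Real.exp (c * s) * (C ^ 2 * d ^ 2 / 2)) := by
          rw [kin_eq, hder, norm_smul, Real.norm_of_nonneg hC0.le]
          refine ENNReal.ofReal_le_ofReal ?_
          rw [mul_pow]
          gcongr
        have hexc : ENNReal.ofReal (Real.exp (c * t)) * S.exc W 0 t ≤
            ENNReal.ofReal (Real.exp (c * s) * (C ^ 2 * d ^ 2)) := by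
          rw [ENNReal.ofReal_mul (Real.exp_pos _).le]
          refine mul_le_mul' (ENNReal.ofReal_le_ofReal (by gcongr))
            (hE.trans (ENNReal.ofReal_le_ofReal (by linarith)))
        refine (add_le_add hkin hexc).trans ?_
        rw [← ENNReal.ofReal_add (by positivity) (by positivity)]
        exact ENNReal.ofReal_le_ofReal (by linarith)
    refine h1.trans ?_
    rw [lintegral_indicator measurableSet_Icc, Measure.restrict_restrict measurableSet_Icc,
      inter_eq_left.2 (Icc_subset_Iic_self : Icc b s ⊆ Iic s), setLIntegral_const, Real.volume_Icc,
      ← ENNReal.ofReal_mul (by positivity)]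
    refine ENNReal.ofReal_le_ofReal ?_
    rw [hb, sub_sub_cancel, mul_assoc]
    refine mul_le_mul_of_nonneg_left ?_ (Real.exp_pos _).le
    calc 3 / 2 * C ^ 2 * d ^ 2 * (1 / C) = 3 / 2 * C * d ^ 2 := by field_simp
      _ ≤ 3 / 2 * C * (C ^ 2 * -S.a) := by gcongr
      _ ≤ 4 * (C ^ 2 * (C + 1) * -S.a) := by
        have : 0 ≤ C ^ 2 * -S.a := by
          have : 0 ≤ -S.a := by linarith
          positivity
        nlinarith

/-- A profile can be modified before time `0`, without increasing its energy, so that it stays in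
the tube around `F⁻` until time `0`. -/
theorem Profile.exists_staying (hP : S.ProjectionsH) (hU : S.Unbalanced) (hS : S.SmallerSpace)
    (hL : S.LevelSets) {c : ℝ} (hc : 0 < c) {U : ℝ → L} (h : S.Profile c U) :
    ∃ V : ℝ → L, H1Loc V univ ∧ (∀ t ≥ 0, V t = U t) ∧
      (∀ t ≤ 0, Metric.infDist (V t) S.minus.F ≤ S.minus.r₀ / 2) ∧
      S.shiftedEnergy c V 0 ≤ S.shiftedEnergy c U 0 := by
  by_cases hall : ∀ t ≤ 0, Metric.infDist (U t) S.minus.F ≤ S.minus.r₀ / 2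
  · exact ⟨U, h.h1Loc, fun _ _ => rfl, hall, le_rfl⟩
  push Not at hall
  obtain ⟨τ₀, hτ₀, hτ₀d⟩ := hall
  obtain ⟨-, -, hη, hη2, -, -⟩ := etaMinus_facts hU hL
  have hUc := h.h1Loc.continuous
  have hdc : Continuous fun t => Metric.infDist (U t) S.minus.F :=
    (Metric.continuous_infDist_pt _).comp hUc
  have hr := hU.wellMinus.r₀_pos
  have hcC := h.speed_le hP hU hS hL hc
  -- The last time up to 0 at which the curve is at distance at least r₀/2 from F⁻.
  obtain ⟨τ, ⟨⟨hτ1, hτ2⟩, hτd⟩, hτmax⟩ := (isCompact_Icc (a := τ₀) (b := 0)).inter_right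
    (isClosed_Ici.preimage hdc) |>.exists_isGreatest
      ⟨τ₀, ⟨le_rfl, hτ₀⟩, (hτ₀d.le : S.minus.r₀ / 2 ≤ _)⟩
  have hτd : S.minus.r₀ / 2 ≤ Metric.infDist (U τ) S.minus.F := hτd
  set N := {t | S.E (U t) < 0} ∩ Ioi τ with hN
  have hτ0 : τ < 0 := by
    refine lt_of_le_of_ne hτ2 ?_
    rintro rfl
    have := (near_minus_of_mem_closure hP hU hS hL hUc h.mem_closure).2
    linarith
  have hNne : N.Nonempty := by
    obtain ⟨t, ht1, ht2⟩ := mem_closure_iff.1 h.mem_closure (Ioi τ) isOpen_Ioi hτ0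
    exact ⟨t, ht2, ht1⟩
  have hNbdd : BddBelow N := ⟨τ, fun t ht => le_of_lt ht.2⟩
  -- The first return of negative potential after τ. Replacing the curve before s suffices, since by
  -- maximality of τ it stays in the half tube between s and 0.
  set s := sInf N with hs
  have hsN : s ∈ closure {t | S.E (U t) < 0} :=
    closure_mono inter_subset_left (csInf_mem_closure hNne hNbdd)
  obtain ⟨hsE, hsd⟩ := near_minus_of_mem_closure hP hU hS hL hUc hsN
  have hτs : τ ≤ s := le_csInf hNne fun t ht => le_of_lt ht.2
  have hs0 : s ≤ 0 := by
    obtain ⟨t, ht⟩ := hNne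
    refine (csInf_le hNbdd ht).trans ?_
    by_contra! hlt
    exact absurd (h.nonneg t hlt) (not_le.2 ht.1)
  have hnn : ∀ t ∈ Ioo τ s, 0 ≤ S.E (U t) := fun t ht => by
    by_contra! hlt
    exact absurd (csInf_le hNbdd ⟨hlt, ht.1⟩) (not_le.2 ht.2)
  have hτs' : τ < s := by
    refine lt_of_le_of_ne hτs fun heq => ?_
    rw [← heq] at hsd; linarith
  have hold := excursion_le hP hU hS hL hc hcC h.h1Loc hτs hs0 hτd (by linarith) hnn
  obtain ⟨W, hW1, hW2, hW3, hW4⟩ := exists_connection hP hU hS hL hc hsE (by linarith) hs0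
  refine ⟨glue W U s, hW1.glue h.h1Loc hW2, fun t ht => glue_of_ge _ _ (hs0.trans ht),
    fun t ht => ?_, ?_⟩
  · rcases lt_or_ge t s with h1 | h1
    · rw [glue_of_lt _ _ h1]; exact hW3 t h1.le
    · rw [glue_of_ge _ _ h1]
      by_contra! hlt
      exact absurd (hτmax ⟨⟨by linarith, ht⟩, hlt.le⟩) (not_le.2 (hτs'.trans_le h1))
  -- Split at s: before it, the cost of the connection is at most the cost of the excursion, with
  -- the same intermediate constant; after it, nothing changes.
  · rw [shiftedEnergy, shiftedEnergy, ← lintegral_add_compl _ (measurableSet_Iic (a := s)),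
      ← lintegral_add_compl (fun t => kin c U t + _) (measurableSet_Iic (a := s)), compl_Iic]
    refine add_le_add (le_trans (le_of_eq ?_) (hW4.trans hold)) (le_of_eq ?_)
    · rw [← setLIntegral_congr Iio_ae_eq_Iic, ← setLIntegral_congr Iio_ae_eq_Iic]
      refine setLIntegral_congr_fun measurableSet_Iio fun t ht => ?_
      simp only [kin, exc, deriv_glue_of_lt W U ht, glue_of_lt W U ht]
    · refine setLIntegral_congr_fun measurableSet_Ioi fun t ht => ?_
      simp only [kin, exc, deriv_glue_of_gt W U ht, glue_of_ge W U (le_of_lt ht)]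

end Setting

end

/-! ### Weakly closed tubes and the set of speeds of negative curves -/

section

theorem WeakTendsto.bounded {X : Type*} [NormedAddCommGroup X] [InnerProductSpace ℝ X]
    [CompleteSpace X] {u : ℕ → X} {v : X} (h : WeakTendsto u v) : ∃ C, ∀ n, ‖u n‖ ≤ C := by
  obtain ⟨C, hC⟩ := banach_steinhaus (g := fun n => innerSL ℝ (u n)) fun y => by
    obtain ⟨C, hC⟩ := (h y).norm.bddAbove_range
    exact ⟨C, fun n => hC ⟨n, rfl⟩⟩
  exact ⟨C, fun n => by simpa using hC n⟩

namespace Setting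

variable {L H K : Type*}
  [NormedAddCommGroup L] [InnerProductSpace ℝ L] [CompleteSpace L]
  [NormedAddCommGroup H] [InnerProductSpace ℝ H]
  [NormedAddCommGroup K] [InnerProductSpace ℝ K] {S : Setting L H K}

theorem E_ι (hU : S.Unbalanced) (hS : S.SmallerSpace) (x : H) : S.E (S.ι x) = (S.EH x : EReal) := by
  have h1 : S.ι x ∈ range S.ι := ⟨x, rfl⟩
  rw [hS.range_eq] at h1
  have h1 : S.E (S.ι x) < ⊤ := h1
  rcases hU.E_cases (S.ι x) with h | ⟨e, -, h⟩
  · exact absurd h h1.ne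
  · rw [EH, h, EReal.toReal_coe]

/-- The tubes around the sets of wells are weakly sequentially closed. -/
theorem infDist_le_of_weakTendsto (hS : S.SmallerSpace) (hK : S.Compactness)
    {w : Well L} (hw : w ∈ ({S.minus, S.plus} : Set (Well L))) {ℓ : ℝ} (hwell : S.WellL w ℓ)
    {u : ℕ → L} {v : L} (huv : WeakTendsto u v) {r : ℝ}
    (hr : ∀ n, Metric.infDist (u n) w.F ≤ r) : Metric.infDist v w.F ≤ r := by
  obtain ⟨C, hC⟩ := huv.bounded
  -- Almost nearest points p n form a bounded subset of F, so a subsequence converges strongly. Then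
  -- u - p converges weakly, and the norm is weakly lower semicontinuous. Convexity of the tube is
  -- not needed.
  have hex : ∀ n : ℕ, ∃ p ∈ w.F, ‖u n - p‖ < r + 1 / ((n : ℝ) + 1) := fun n => by
    obtain ⟨p, hp, hd⟩ := (Metric.infDist_lt_iff hwell.nonempty).1
      ((hr n).trans_lt (lt_add_of_pos_right r (by positivity : 0 < 1 / ((n : ℝ) + 1))))
    exact ⟨p, hp, by rwa [dist_eq_norm] at hd⟩
  choose p hp hpd using hex
  have hx : ∀ n, ∃ x, S.ι x = p n := fun n => exists_preimage hS (by
    rw [hwell.energy_eq _ (hp n)]; exact EReal.coe_lt_top _)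
  choose x hx using hx
  have hbdd : Bornology.IsBounded (range p) := by
    refine isBounded_iff_forall_norm_le.2 ⟨C + (r + 1), ?_⟩
    rintro _ ⟨n, rfl⟩
    have h1 : 1 / ((n : ℝ) + 1) ≤ 1 := by
      rw [div_le_one (by positivity)]; linarith [n.cast_nonneg (α := ℝ)]
    calc ‖p n‖ = ‖u n - (u n - p n)‖ := by congr 1; abel
      _ ≤ ‖u n‖ + ‖u n - p n‖ := norm_sub_le _ _
      _ ≤ _ := by linarith [hC n, (hpd n).le]
  have hcpt := hK w hw (range p) (by rintro _ ⟨n, rfl⟩; exact hp n) hbdd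
  obtain ⟨y, -, φ, hφ, hy⟩ := hcpt.tendsto_subseq (x := x) fun n =>
    subset_closure (show S.ι (x n) ∈ range p from ⟨n, (hx n).symm⟩)
  have hpy : Tendsto (p ∘ φ) atTop (𝓝 (S.ι y)) := by
    have := (S.ι.continuous.tendsto y).comp hy
    refine this.congr fun n => ?_
    simp [hx]
  have hyF : S.ι y ∈ w.F := hwell.closed.mem_of_tendsto hpy (Eventually.of_forall fun n => hp _)
  refine (Metric.infDist_le_dist_of_mem hyF).trans ?_
  rw [dist_eq_norm]
  refine le_of_forall_pos_le_add fun ε hε => ?_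
  refine ((huv.comp hφ).sub_of_tendsto hpy).norm_le (Eventually.frequently ?_)
  have h2 := (tendsto_one_div_add_atTop_nhds_zero_nat (𝕜 := ℝ)).comp hφ.tendsto_atTop
  filter_upwards [h2.eventually (gt_mem_nhds hε)] with n hn
  have h3 := hpd (φ n)
  simp only [Function.comp_apply] at hn ⊢
  linarith

/-- An affine ramp on [0, 1] from a point of F⁻ to a point of F⁺ has finite cost M up to the weight
e^c, because E is continuous on `H`. Outside [0, 1] the shifted density vanishes, and the threshold
-a e^c/c exceeds e^c M once c is small; c = -a/(2M) is small enough. -/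
theorem exists_negativeCurve (hU : S.Unbalanced) (hS : S.SmallerSpace) :
    ∃ c > 0, ∃ U, S.NegativeCurve c U := by
  obtain ⟨v, hv⟩ := hU.wellMinus.nonempty
  obtain ⟨w, hw⟩ := hU.wellPlus.nonempty
  have ha := hU.a_neg
  have hr := hU.wellPlus.r₀_pos
  have hEv := hU.wellMinus.energy_eq v hv
  have hEw := hU.wellPlus.energy_eq w hw
  obtain ⟨x, rfl⟩ := exists_preimage hS (v := v) (by rw [hEv]; exact EReal.coe_lt_top _)
  obtain ⟨y, rfl⟩ := exists_preimage hS (v := w) (by rw [hEw]; exact EReal.coe_lt_top _)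
  have hcont : Continuous fun t : ℝ => S.EH (x + t • (y - x)) :=
    hS.contDiff.continuous.comp (by fun_prop)
  obtain ⟨m, hm⟩ := (isCompact_Icc (a := (0 : ℝ)) (b := 1)).bddAbove_image hcont.continuousOn
  have hm' : ∀ t ∈ Icc (0 : ℝ) 1, S.EH (x + t • (y - x)) ≤ max m 0 := fun t ht =>
    (hm ⟨t, ht, rfl⟩).trans (le_max_left _ _)
  set d := S.ι y - S.ι x with hd
  set M := ‖d‖ ^ 2 / 2 + (max m 0 + -S.a) with hM
  have hm0 : 0 ≤ max m 0 := le_max_right _ _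
  have hM0 : 0 < M := by
    have : 0 ≤ ‖d‖ ^ 2 / 2 := by positivity
    linarith
  set c := -S.a / (2 * M) with hc
  have hc0 : 0 < c := div_pos (by linarith) (by linarith)
  set A : ℝ → L := fun t => S.ι x + (t - 0) • d with hA
  set W := glue (fun _ => S.ι x) A 0 with hW
  have hWA : H1Loc W univ := (h1Loc_const _).glue (h1Loc_affine _ _ _) (by simp)
  have hW1 : W 1 = S.ι y := by
    rw [hW, glue_of_ge _ _ zero_le_one]; simp [hA, hd]
  set U := glue W (fun _ => S.ι y) 1 with hUdef
  have hUH : H1Loc U univ := hWA.glue (h1Loc_const _) hW1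
  have hU1 : ∀ t ≥ 1, U t = S.ι y := fun t ht => glue_of_ge _ _ ht
  refine ⟨c, hc0, U, hUH, ⟨1, fun t ht => ?_⟩, ?_⟩
  · rw [hU1 t ht, Metric.infDist_zero_of_mem hw]; positivity
  · rw [energyPos_lt_energyNeg_iff hU hc0 hUH.continuous (t₀ := 1) fun t ht => by
      rw [hU1 t (le_of_lt ht), hEw]; simp]
    have hpt : ∀ᵐ t : ℝ, kin c U t + ENNReal.ofReal (Real.exp (c * t)) * S.exc U 1 t ≤
        (Icc (0 : ℝ) 1).indicator (fun _ => ENNReal.ofReal (Real.exp (c * 1) * M)) t := by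
      have hne : ∀ᵐ t : ℝ, t ≠ 0 ∧ t ≠ 1 := by
        have h0 : ∀ᵐ t : ℝ, t ≠ 0 := by simp [ae_iff, measure_singleton]
        have h1 : ∀ᵐ t : ℝ, t ≠ 1 := by simp [ae_iff, measure_singleton]
        exact h0.and h1
      filter_upwards [hne] with t ⟨ht0, ht1⟩
      rcases lt_or_gt_of_ne ht1 with h1 | h1
      · rcases lt_or_gt_of_ne ht0 with h0 | h0
        · have hE : S.E (U t) = (S.a : EReal) := by
            rw [hUdef, glue_of_lt _ _ h1, hW, glue_of_lt _ _ h0, hEv]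
          rw [exc_coe hE, shift_of_le h1.le, kin, hUdef, deriv_glue_of_lt _ _ h1, hW,
            deriv_glue_of_lt _ _ h0]
          simp
        · rw [indicator_of_mem (s := Icc (0 : ℝ) 1) ⟨h0.le, h1.le⟩]
          have hder : deriv U t = d := by
            rw [hUdef, deriv_glue_of_lt _ _ h1, hW, deriv_glue_of_gt _ _ h0, hA]
            have : HasDerivAt (fun t : ℝ => S.ι x + (t - 0) • d) ((1 : ℝ) • d) t :=
              (((hasDerivAt_id' t).sub_const 0).smul_const _).const_add _
            rw [this.deriv, one_smul]
          have hUt : U t = S.ι (x + t • (y - x)) := by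
            rw [hUdef, glue_of_lt _ _ h1, hW, glue_of_ge _ _ h0.le, map_add, map_smul, map_sub]
            simp [hA, hd]
          have hE := exc_coe (t₀ := 1) (t := t) (U := U) (by rw [hUt]; exact E_ι hU hS _)
          rw [hE, shift_of_le h1.le, kin, hder, ← mul_add, ENNReal.ofReal_mul (by positivity)]
          have hle := hm' t ⟨h0.le, h1.le⟩
          have he : Real.exp (c * t) ≤ Real.exp (c * 1) :=
            Real.exp_le_exp.2 (mul_le_mul_of_nonneg_left h1.le hc0.le)
          refine mul_le_mul' (ENNReal.ofReal_le_ofReal he) ?_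
          rw [hM, ENNReal.ofReal_add (p := ‖d‖ ^ 2 / 2) (by positivity) (by linarith)]
          exact add_le_add le_rfl (ENNReal.ofReal_le_ofReal (by linarith))
      · have hE : S.E (U t) = ((0 : ℝ) : EReal) := by rw [hU1 t h1.le, hEw]
        rw [exc_coe hE, shift_of_gt h1, kin, hUdef, deriv_glue_of_gt _ _ h1]
        simp
    refine (lintegral_mono_ae hpt).trans_lt ?_
    rw [lintegral_indicator measurableSet_Icc, setLIntegral_const, Real.volume_Icc, sub_zero,
      ENNReal.ofReal_one, mul_one]
    have hexp := Real.exp_pos (c * 1)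
    rw [ENNReal.ofReal_lt_ofReal_iff_of_nonneg (by positivity), lt_div_iff₀ hc0]
    have : M * c = -S.a / 2 := by rw [hc]; field_simp
    rw [mul_assoc, this]
    nlinarith

/-- Curves with negative energy can be replaced by curves with uniform control. -/
theorem exists_controlled (hP : S.ProjectionsH) (hU : S.Unbalanced) (hS : S.SmallerSpace)
    (hL : S.LevelSets) (hI : S.ProjectionsInverse) {c₁ : ℝ} (hc₁ : 0 < c₁) :
    ∃ R T : ℝ, 0 < T ∧ ∀ c ≥ c₁, (∃ U, S.NegativeCurve c U) → ∃ V : ℝ → L, H1Loc V univ ∧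
      (∀ t ≤ 0, Metric.infDist (V t) S.minus.F ≤ S.minus.r₀ / 2) ∧
      (∀ t ≥ T, Metric.infDist (V t) S.plus.F ≤ S.plus.r₀ / 2) ∧
      S.shiftedEnergy c V 0 ≤ ENNReal.ofReal (-S.a / c) ∧ ‖V 0‖ ≤ R := by
  have hr := hU.wellPlus.r₀_pos
  have ha := hU.a_neg
  have hA : 0 < -S.a := by linarith
  obtain ⟨R, hR⟩ := exists_bounded_profile hU hI
  -- The bound of `Profile.tail_bound` at the smallest speed allowed, which dominates those at
  -- larger speeds.
  set T := 32 * -S.a / (c₁ ^ 3 * S.plus.r₀ ^ 2) + 1 with hT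
  have hT0 : 0 < T := by positivity
  refine ⟨R + √(2 * -S.a / c₁ ^ 2), T, hT0, fun c hcc hneg => ?_⟩
  have hc : 0 < c := hc₁.trans_le hcc
  obtain ⟨U₀, hU₀⟩ := hneg
  obtain ⟨U, hprof⟩ := hU₀.exists_profile hU hc
  have htail : ∀ V, S.Profile c V → ∀ t ≥ T, Metric.infDist (V t) S.plus.F ≤ S.plus.r₀ / 2 := by
    intro V hV t ht
    by_contra! hlt
    have h1 := hV.tail_bound hU hc (hT0.trans_le ht) hlt
    have h2 : 32 * -S.a / (c ^ 3 * S.plus.r₀ ^ 2) ≤ 32 * -S.a / (c₁ ^ 3 * S.plus.r₀ ^ 2) := by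
      gcongr
    linarith
  -- The value is bounded at time T, where the curve is near F⁺. Removing excursions keeps that
  -- value, and the kinetic energy on (0, T] carries the bound back to time 0.
  obtain ⟨V, hV, -, hVR⟩ := hR c U hprof T (htail U hprof T le_rfl)
  obtain ⟨W, hW1, hW2, hW3, hW4⟩ := hV.exists_staying hP hU hS hL hc
  have hWE := hW4.trans hV.lt.le
  refine ⟨W, hW1, hW3, fun t ht => ?_, hWE, ?_⟩
  · rw [hW2 t (hT0.le.trans ht)]; exact htail V hV t ht
  · have h1 := hW1.ofReal_norm_sub_sq_le hc hT0.le
    have h2 : ∫⁻ x in Ioc 0 T, kin c W x ≤ S.shiftedEnergy c W 0 :=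
      le_trans (lintegral_mono fun x => le_self_add) (setLIntegral_le_shiftedEnergy c W 0 (Ioc 0 T))
    have h3 := (h1.trans h2).trans hWE
    rw [ENNReal.ofReal_le_ofReal_iff (by positivity), mul_zero, Real.exp_zero, mul_one,
      le_div_iff₀ hc] at h3
    have h4 : ‖W T - W 0‖ ^ 2 ≤ 2 * -S.a / c₁ ^ 2 := by
      calc ‖W T - W 0‖ ^ 2 ≤ 2 * -S.a / c ^ 2 := by
            rw [le_div_iff₀ (by positivity)]; nlinarith
        _ ≤ 2 * -S.a / c₁ ^ 2 := by gcongr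
    have h5 := Real.le_sqrt_of_sq_le h4
    rw [hW2 T hT0.le] at h5
    calc ‖W 0‖ = ‖V T - (V T - W 0)‖ := by congr 1; abel
      _ ≤ ‖V T‖ + ‖V T - W 0‖ := norm_sub_le _ _
      _ ≤ _ := add_le_add hVR h5

/-- Negativity of the infimum of the energy is stable under a small increase of the speed. -/
theorem NegativeCurve.exists_faster (hU : S.Unbalanced) {c : ℝ} (hc : 0 < c) {U : ℝ → L}
    (h : S.NegativeCurve c U) : ∃ c' > c, ∃ V, S.NegativeCurve c' V := by
  obtain ⟨V, hV⟩ := h.exists_profile hU hc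
  have hA : 0 < -S.a := by linarith [hU.a_neg]
  have hlt := hV.lt
  set g := (S.shiftedEnergy c V 0).toReal with hg
  have hgE : S.shiftedEnergy c V 0 = ENNReal.ofReal g := (ENNReal.ofReal_toReal hlt.ne_top).symm
  have hg0 : 0 ≤ g := ENNReal.toReal_nonneg
  rw [hgE, ENNReal.ofReal_lt_ofReal_iff_of_nonneg hg0] at hlt
  -- Rescaling by l multiplies the shifted energy by at most l and divides the threshold by l. The
  -- strict inequality g < -a/c leaves room for some l > 1 with l² g < -a/c.
  have hcont : Tendsto (fun l : ℝ => l ^ 2 * g) (𝓝[>] 1) (𝓝 ((1 : ℝ) ^ 2 * g)) :=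
    (Continuous.tendsto (by fun_prop) 1).mono_left nhdsWithin_le_nhds
  rw [one_pow, one_mul] at hcont
  obtain ⟨l, hl1, hl2⟩ := ((hcont.eventually (gt_mem_nhds hlt)).and self_mem_nhdsWithin).exists
  have hl : 1 < l := hl2
  have hl0 : 0 < l := by linarith
  have hlc : 0 < l * c := by positivity
  have hH := hV.h1Loc.comp_affine hl0 0
  refine ⟨l * c, by nlinarith, fun t => V (l * t + 0), hH, ?_, ?_⟩
  · obtain ⟨T, hT⟩ := hV.tail
    refine ⟨max T 0, fun t ht => hT _ ?_⟩
    have h1 : T ≤ t := (le_max_left _ _).trans ht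
    have h2 : 0 ≤ t := (le_max_right _ _).trans ht
    nlinarith
  · rw [energyPos_lt_energyNeg_iff hU hlc hH.continuous (t₀ := 0) fun t ht =>
      hV.nonneg _ (by rw [add_zero]; exact mul_pos hl0 ht)]
    refine (shiftedEnergy_comp_affine_le V hl.le 0 0).trans_lt ?_
    simp only [mul_zero, add_zero, neg_zero, Real.exp_zero, one_mul, mul_one]
    rw [hgE, ← ENNReal.ofReal_mul (by positivity),
      ENNReal.ofReal_lt_ofReal_iff_of_nonneg (by positivity), lt_div_iff₀ hlc]
    rw [lt_div_iff₀ hc] at hl1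
    linarith

theorem energy_nonneg_of_not_negative (hU : S.Unbalanced) {c : ℝ} (hc : 0 < c)
    (hneg : ¬ ∃ U, S.NegativeCurve c U) {V : ℝ → L} (hV : V ∈ S.X) : 0 ≤ S.energy c V := by
  obtain ⟨hV1, T, -, hT, -⟩ := hV
  have hnn : ∀ t > T, 0 ≤ S.E (V t) := fun t ht => nonneg_of_mem_plus hU (hT t (le_of_lt ht))
  refine energy_nonneg_of_le_shiftedEnergy hU hc hV1.continuous hnn ?_
  by_contra! hlt
  exact hneg ⟨V, hV1, ⟨T, hT⟩, (energyPos_lt_energyNeg_iff hU hc hV1.continuous hnn).2 hlt⟩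

end Setting

end

/-! ### Weak limits and the minimizer at the critical speed -/

section

section WeakLimit

variable {L : Type*} [NormedAddCommGroup L] [InnerProductSpace ℝ L] [CompleteSpace L]

theorem memLp_indicator_of_continuous {f : ℝ → L} (hf : Continuous f) (s t : ℝ) :
    MemLp ((Ioc s t).indicator f) 2 volume := by
  rw [memLp_indicator_iff_restrict measurableSet_Ioc]
  obtain ⟨C, hC⟩ := isCompact_Icc.exists_bound_of_continuousOn hf.continuousOn (s := Icc s t)
  exact MemLp.of_bound hf.aestronglyMeasurable C
    ((ae_restrict_iff' measurableSet_Ioc).2 (ae_of_all _ fun x hx => hC x (Ioc_subset_Icc_self hx)))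

/-- Weak convergence will be available for f = e^{cx/2} U'. Testing f against the inverse weight on
(s, t] recovers the increments of U, so the curves converge weakly at every time. -/
theorem integral_inner_weighted {c s t : ℝ} (hst : s ≤ t) {u f : ℝ → L}
    (hu : IntervalIntegrable u volume s t) (hf : ∀ x, u x = Real.exp (-(c / 2 * x)) • f x) (y : L) :
    ∫ x, inner ℝ (f x) ((Ioc s t).indicator (fun x => Real.exp (-(c / 2 * x)) • y) x) =
      (inner ℝ (∫ x in s..t, u x) y : ℝ) := by
  have h1 : (fun x => (inner ℝ (f x)
      ((Ioc s t).indicator (fun x => Real.exp (-(c / 2 * x)) • y) x) : ℝ)) =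
      (Ioc s t).indicator fun x => inner ℝ y (u x) := by
    funext x
    by_cases hx : x ∈ Ioc s t
    · rw [indicator_of_mem hx, indicator_of_mem hx, hf, real_inner_smul_right, real_inner_smul_right,
        real_inner_comm]
    · simp [hx]
  rw [h1, integral_indicator measurableSet_Ioc, intervalIntegral.integral_of_le hst,
    real_inner_comm]
  exact integral_inner ((intervalIntegrable_iff_integrableOn_Ioc_of_le hst).1 hu) y

theorem integrable_of_lintegral_kin {c : ℝ} {U : ℝ → L} (h : ∫⁻ t, kin c U t ≠ ⊤) :
    Integrable (fun t => Real.exp (c * t) * (‖deriv U t‖ ^ 2 / 2)) ∧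
      ENNReal.ofReal (∫ t, Real.exp (c * t) * (‖deriv U t‖ ^ 2 / 2)) = ∫⁻ t, kin c U t := by
  have hm := measurable_norm_deriv U
  simp_rw [kin_eq] at h ⊢
  have hi := (lintegral_ofReal_ne_top_iff_integrable (Measurable.aestronglyMeasurable (by fun_prop))
    (ae_of_all _ fun t => by positivity)).1 h
  exact ⟨hi, ofReal_integral_eq_lintegral_ofReal hi (ae_of_all _ fun t => by positivity)⟩

/-- Weak sequential compactness of sequences of curves with bounded weighted kinetic energy. -/
theorem exists_weak_limit_curve {c : ℝ} {W : ℕ → ℝ → L} (hW : ∀ n, H1Loc (W n) univ) {R B : ℝ}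
    (hR : ∀ n, ‖W n 0‖ ≤ R) (hB : ∀ n, ∫⁻ t, kin c (W n) t ≤ ENNReal.ofReal B) :
    ∃ V : ℝ → L, H1Loc V univ ∧ ∃ φ : ℕ → ℕ, StrictMono φ ∧
      (∀ t, WeakTendsto (fun n => W (φ n) t) (V t)) ∧
      ∃ κ : ℝ, 0 ≤ κ ∧
        Tendsto (fun n => ∫⁻ t, kin c (W (φ n)) t) atTop (𝓝 (ENNReal.ofReal κ)) ∧
        ∫⁻ t, kin c V t ≤ ENNReal.ofReal κ := by
  obtain ⟨w₀, φ₁, hφ₁, hw₀⟩ := exists_weakTendsto_subseq (fun n => W n 0) hR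
  -- The kinetic energy is half the squared norm of f in the unweighted `L²`, so a single extraction
  -- works on the whole line.
  set f : ℕ → ℝ → L := fun n x => Real.exp (c / 2 * x) • deriv (W (φ₁ n)) x with hf
  have hfsq : ∀ n x, ‖f n x‖ ^ 2 = 2 * (Real.exp (c * x) * (‖deriv (W (φ₁ n)) x‖ ^ 2 / 2)) := by
    intro n x
    rw [hf, norm_smul, mul_pow, Real.norm_of_nonneg (Real.exp_pos _).le, ← Real.exp_nat_mul]
    push_cast
    rw [show 2 * (c / 2 * x) = c * x by ring]
    ring
  have hkin : ∀ n, ∫⁻ t, kin c (W n) t ≠ ⊤ := fun n => ((hB n).trans_lt ENNReal.ofReal_lt_top).ne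
  have hfm : ∀ n, MemLp (f n) 2 volume := fun n => by
    have hmeas : AEStronglyMeasurable (f n) volume :=
      (Continuous.aestronglyMeasurable (by fun_prop)).smul
        (hW (φ₁ n)).locallyIntegrable.aestronglyMeasurable
    rw [memLp_two_iff_integrable_sq_norm hmeas]
    simp_rw [hfsq]
    exact (integrable_of_lintegral_kin (hkin _)).1.const_mul 2
  have hfint : ∀ n, ENNReal.ofReal ((∫ x, ‖f n x‖ ^ 2) / 2) = ∫⁻ t, kin c (W (φ₁ n)) t := fun n => by
    simp_rw [hfsq]
    rw [integral_const_mul, mul_div_cancel_left₀ _ two_ne_zero]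
    exact (integrable_of_lintegral_kin (hkin _)).2
  have hfB : ∀ n, ∫ x, ‖f n x‖ ^ 2 ≤ 2 * max B 0 := fun n => by
    have h1 := (hfint n).le.trans ((hB _).trans (ENNReal.ofReal_le_ofReal (le_max_left B 0)))
    rw [ENNReal.ofReal_le_ofReal_iff (le_max_right _ _)] at h1
    linarith
  obtain ⟨g, hg, φ₂, hφ₂, hweak, κ, hκ, hgκ⟩ := exists_weak_subseq_L2 hfm hfB
  set g' : ℝ → L := fun x => Real.exp (-(c / 2 * x)) • g x with hg'
  have hg'm : ∀ s t : ℝ, MemLp g' 2 (volume.restrict (Icc s t)) := fun s t => by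
    obtain ⟨C, hC⟩ := isCompact_Icc.exists_bound_of_continuousOn (s := Icc s t)
      (f := fun x : ℝ => Real.exp (-(c / 2 * x))) (Continuous.continuousOn (by fun_prop))
    refine MemLp.of_le_mul (c := C) (hg.restrict (Icc s t))
      ((Continuous.aestronglyMeasurable (by fun_prop)).smul (hg.restrict _).aestronglyMeasurable)
      ((ae_restrict_iff' measurableSet_Icc).2 (ae_of_all _ fun x hx => ?_))
    rw [hg', norm_smul]
    gcongr
    exact hC x hx
  have hint : ∀ s t, IntervalIntegrable g' volume s t := fun s t => by
    rw [intervalIntegrable_iff]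
    have h1 : IntegrableOn g' (Icc (min s t) (max s t)) := (hg'm _ _).integrable (by norm_num)
    exact h1.mono_set Ioc_subset_Icc_self
  set V : ℝ → L := fun t => w₀ + ∫ x in (0 : ℝ)..t, g' x with hV
  have hVH : H1Loc V univ := h1Loc_of_primitive hg'm fun t => by simp [hV]
  have hVsub : ∀ s t, V t - V s = ∫ x in s..t, g' x := fun s t => by
    rw [hV, add_sub_add_left_eq_sub, intervalIntegral.integral_interval_sub_left (hint _ _) (hint _ _)]
  have hder : ∀ᵐ t, deriv V t = g' t := by
    filter_upwards [LocallyIntegrable.ae_hasDerivAt_integral (locallyIntegrable_of_memLp_Icc hg'm)]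
      with t ht
    exact ((ht 0).const_add w₀).deriv
  have hincr : ∀ s t, s ≤ t → ∀ y, Tendsto
      (fun n => (inner ℝ (W (φ₁ (φ₂ n)) t - W (φ₁ (φ₂ n)) s) y : ℝ)) atTop
      (𝓝 (inner ℝ (V t - V s) y)) := fun s t hst y => by
    have h1 := hweak _ (memLp_indicator_of_continuous (f := fun x => Real.exp (-(c / 2 * x)) • y)
      (by fun_prop) s t)
    rw [integral_inner_weighted hst (hint s t) (fun x => rfl) y, ← hVsub] at h1
    refine h1.congr fun n => ?_
    rw [integral_inner_weighted hst ((hW (φ₁ (φ₂ n))).intervalIntegrable s t) (fun x => ?_) y,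
      ← (hW (φ₁ (φ₂ n))).sub_eq]
    rw [hf, smul_smul, ← Real.exp_add, neg_add_cancel, Real.exp_zero, one_smul]
  have hV0 : V 0 = w₀ := by simp [hV]
  refine ⟨V, hVH, φ₁ ∘ φ₂, hφ₁.comp hφ₂, fun t y => ?_, κ / 2, ?_, ?_, ?_⟩
  · have h0 : Tendsto (fun n => (inner ℝ (W (φ₁ (φ₂ n)) 0) y : ℝ)) atTop (𝓝 (inner ℝ (V 0) y)) := by
      rw [hV0]; exact hw₀.comp hφ₂ y
    rcases le_total 0 t with ht | ht
    · have := h0.add (hincr 0 t ht y)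
      simpa [inner_sub_left] using this
    · have := h0.sub (hincr t 0 ht y)
      simpa [inner_sub_left] using this
  · have : 0 ≤ κ := le_trans (integral_nonneg fun x => by positivity) hgκ
    positivity
  · simp only [Function.comp_apply, ← hfint]
    exact ENNReal.tendsto_ofReal (hκ.div_const 2)
  · have h1 : ∫⁻ t, kin c V t = ∫⁻ t, ENNReal.ofReal (‖g t‖ ^ 2 / 2) := by
      refine lintegral_congr_ae ?_
      filter_upwards [hder] with t ht
      rw [kin_eq, ht, hg', norm_smul, mul_pow, Real.norm_of_nonneg (Real.exp_pos _).le,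
        ← Real.exp_nat_mul, mul_div_assoc, ← mul_assoc, ← Real.exp_add]
      push_cast
      rw [show c * t + 2 * -(c / 2 * t) = 0 by ring, Real.exp_zero, one_mul]
    have hgi : Integrable (fun x => ‖g x‖ ^ 2) := (memLp_two_iff_integrable_sq_norm hg.1).1 hg
    rw [h1, ← ofReal_integral_eq_lintegral_ofReal (hgi.div_const 2)
      (ae_of_all _ fun x => by positivity), integral_div]
    exact ENNReal.ofReal_le_ofReal (by linarith)

end WeakLimit

namespace Setting

variable {L H K : Type*}
  [NormedAddCommGroup L] [InnerProductSpace ℝ L] [CompleteSpace L]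
  [NormedAddCommGroup H] [InnerProductSpace ℝ H]
  [NormedAddCommGroup K] [InnerProductSpace ℝ K] {S : Setting L H K}

/-- The map from the potential to its weighted shifted positive part is nondecreasing and
continuous, the shift being finite, so it commutes with the liminf in weak lower semicontinuity. -/
theorem exc_le_liminf (hU : S.Unbalanced) (c : ℝ) {W : ℕ → ℝ → L} {V : ℝ → L} {t t₀ : ℝ}
    (h : WeakTendsto (fun n => W n t) (V t)) :
    ENNReal.ofReal (Real.exp (c * t)) * S.exc V t₀ t ≤
      liminf (fun n => ENNReal.ofReal (Real.exp (c * t)) * S.exc (W n) t₀ t) atTop := by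
  set F : EReal → ENNReal := fun x =>
    ENNReal.ofReal (Real.exp (c * t)) * (x + ((S.shift t₀ t : ℝ) : EReal)).toENNReal with hF
  have hmono : Monotone F := fun x y hxy => by
    simp only [hF]
    gcongr
    exact EReal.toENNReal_le_toENNReal (by gcongr)
  have hcont : Continuous F := by
    refine (ENNReal.continuous_const_mul ENNReal.ofReal_ne_top).comp
      (Continuous.ereal_toENNReal ?_)
    refine continuous_iff_continuousAt.2 fun x => ?_
    have := EReal.continuousAt_add (p := (x, ((S.shift t₀ t : ℝ) : EReal)))
      (Or.inr (EReal.coe_ne_bot _)) (Or.inr (EReal.coe_ne_top _))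
    exact this.comp (f := fun x : EReal => (x, ((S.shift t₀ t : ℝ) : EReal)))
      (Continuous.continuousAt (by fun_prop))
  have h1 : F (S.E (V t)) ≤ F (liminf (fun n => S.E (W n t)) atTop) := hmono (hU.wlsc _ _ h)
  refine h1.trans (le_of_eq ?_)
  exact hmono.map_liminf_of_continuousAt _ hcont.continuousAt

theorem exists_limit_profile (hU : S.Unbalanced) (hS : S.SmallerSpace) (hK : S.Compactness)
    {c : ℝ} {W : ℕ → ℝ → L} {R T : ℝ} {μ : ℕ → ℝ} {m : ℝ} (hW : ∀ n, H1Loc (W n) univ)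
    (hR : ∀ n, ‖W n 0‖ ≤ R)
    (hminus : ∀ n, ∀ t ≤ 0, Metric.infDist (W n t) S.minus.F ≤ S.minus.r₀ / 2)
    (hplus : ∀ n, ∀ t ≥ T, Metric.infDist (W n t) S.plus.F ≤ S.plus.r₀ / 2)
    (hE : ∀ n, S.shiftedEnergy c (W n) 0 ≤ ENNReal.ofReal (μ n)) (hμ : Tendsto μ atTop (𝓝 m)) :
    ∃ V, V ∈ S.X ∧ S.shiftedEnergy c V 0 ≤ ENNReal.ofReal m := by
  obtain ⟨B, hB⟩ := hμ.bddAbove_range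
  have hkX : ∀ n, S.shiftedEnergy c (W n) 0 = (∫⁻ t, kin c (W n) t) +
      ∫⁻ t, ENNReal.ofReal (Real.exp (c * t)) * S.exc (W n) 0 t := fun n =>
    lintegral_add_left (measurable_kin c (W n)) _
  have hkB : ∀ n, ∫⁻ t, kin c (W n) t ≤ ENNReal.ofReal B := fun n => by
    have h1 : ∫⁻ t, kin c (W n) t ≤ S.shiftedEnergy c (W n) 0 := by rw [hkX]; exact le_self_add
    exact h1.trans ((hE n).trans (ENNReal.ofReal_le_ofReal (hB ⟨n, rfl⟩)))
  obtain ⟨V, hV, φ, hφ, hweak, κ, hκ0, hκ, hVκ⟩ := exists_weak_limit_curve hW hR hkB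
  refine ⟨V, ⟨hV, max T 1, le_max_right _ _, fun t ht => ?_, fun t ht => ?_⟩, ?_⟩
  · exact infDist_le_of_weakTendsto hS hK (by simp) hU.wellPlus (hweak t) fun n =>
      hplus _ t ((le_max_left _ _).trans ht)
  · refine infDist_le_of_weakTendsto hS hK (by simp) hU.wellMinus (hweak t) fun n =>
      hminus _ t ?_
    have := le_max_right T 1
    linarith
  -- Fatou's lemma bounds the limit potential part by the liminf of μ minus the kinetic energies,
  -- which is m - κ because these converge to κ. Adding the kinetic part of V, at most κ, gives m.
  · have hX : ∫⁻ t, ENNReal.ofReal (Real.exp (c * t)) * S.exc V 0 t ≤ ENNReal.ofReal m -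
        ENNReal.ofReal κ := by
      calc ∫⁻ t, ENNReal.ofReal (Real.exp (c * t)) * S.exc V 0 t
          ≤ ∫⁻ t, liminf (fun n => ENNReal.ofReal (Real.exp (c * t)) * S.exc (W (φ n)) 0 t) atTop :=
            lintegral_mono fun t => exc_le_liminf hU c (W := fun n => W (φ n)) (hweak t)
        _ ≤ liminf (fun n => ∫⁻ t, ENNReal.ofReal (Real.exp (c * t)) * S.exc (W (φ n)) 0 t) atTop :=
            lintegral_liminf_le fun n => by
              have := hU.measurable_exc (hW (φ n)).continuous 0
              fun_prop
        _ ≤ liminf (fun n => ENNReal.ofReal (μ (φ n)) - ∫⁻ t, kin c (W (φ n)) t) atTop := by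
            refine liminf_le_liminf (Eventually.of_forall fun n => ?_)
            refine ENNReal.le_sub_of_add_le_left ((hkB _).trans_lt ENNReal.ofReal_lt_top).ne ?_
            rw [← hkX]; exact hE _
        _ = ENNReal.ofReal m - ENNReal.ofReal κ :=
            (ENNReal.Tendsto.sub (ENNReal.tendsto_ofReal (hμ.comp hφ.tendsto_atTop)) hκ
              (Or.inl ENNReal.ofReal_ne_top)).liminf_eq
    have hκm : ENNReal.ofReal κ ≤ ENNReal.ofReal m := by
      refine le_of_tendsto_of_tendsto' hκ (ENNReal.tendsto_ofReal (hμ.comp hφ.tendsto_atTop))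
        fun n => ?_
      refine le_trans ?_ (hE (φ n))
      rw [hkX]; exact le_self_add
    calc S.shiftedEnergy c V 0 = (∫⁻ t, kin c V t) +
          ∫⁻ t, ENNReal.ofReal (Real.exp (c * t)) * S.exc V 0 t :=
          lintegral_add_left (measurable_kin c V) _
      _ ≤ ENNReal.ofReal κ + (ENNReal.ofReal m - ENNReal.ofReal κ) := add_le_add hVκ hX
      _ = ENNReal.ofReal m := add_tsub_cancel_of_le hκm

/-- There is a speed for which the infimum of the energy over `X` is zero and is attained. -/
theorem exists_speed_minimizer (hP : S.ProjectionsH) (hU : S.Unbalanced) (hS : S.SmallerSpace)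
    (hL : S.LevelSets) (hI : S.ProjectionsInverse) (hK : S.Compactness) :
    ∃ c > 0, (∀ V ∈ S.X, 0 ≤ S.energy c V) ∧ ∃ U ∈ S.X, S.energy c U = 0 := by
  have hA : 0 < -S.a := by linarith [hU.a_neg]
  set N := {c : ℝ | 0 < c ∧ ∃ U, S.NegativeCurve c U} with hN
  have hNne : N.Nonempty := by
    obtain ⟨c, hc, h⟩ := exists_negativeCurve hU hS
    exact ⟨c, hc, h⟩
  have hC := hU.wellMinus.one_lt_C
  have hNbdd : BddAbove N := by
    refine ⟨1 / (12 * (S.minus.C ^ 2 * (S.minus.C + 1))), ?_⟩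
    rintro c ⟨hc, U, h⟩
    obtain ⟨V, hV⟩ := h.exists_profile hU hc
    rw [le_div_iff₀ (by positivity)]
    exact hV.speed_le hP hU hS hL hc
  set c := sSup N with hcdef
  have hc : 0 < c := by
    obtain ⟨c', h'⟩ := hNne
    exact h'.1.trans_le (le_csSup hNbdd h')
  -- A negative curve at the supremum would give one at a larger speed.
  have hnot : ¬ ∃ U, S.NegativeCurve c U := by
    rintro ⟨U, h⟩
    obtain ⟨c', hc', h'⟩ := h.exists_faster hU hc
    exact absurd (le_csSup hNbdd (show c' ∈ N from ⟨hc.trans hc', h'⟩)) (not_le.2 hc')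
  have hnn : ∀ V ∈ S.X, 0 ≤ S.energy c V := fun V hV => energy_nonneg_of_not_negative hU hc hnot hV
  refine ⟨c, hc, hnn, ?_⟩
  obtain ⟨u, -, hulim, huN⟩ := exists_seq_tendsto_sSup hNne hNbdd
  obtain ⟨N₀, hN₀⟩ := eventually_atTop.1 (hulim.eventually (lt_mem_nhds (half_lt_self hc)))
  -- Dropping finitely many terms keeps the speeds above c/2, so that R and T are uniform.
  set v : ℕ → ℝ := fun n => u (n + N₀) with hv
  have hvlim : Tendsto v atTop (𝓝 c) := (tendsto_add_atTop_iff_nat N₀).2 hulim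
  have hvN : ∀ n, v n ∈ N := fun n => huN _
  have hvhalf : ∀ n, c / 2 ≤ v n := fun n => (hN₀ _ (Nat.le_add_left _ _)).le
  obtain ⟨R, T, hT, hctrl⟩ := exists_controlled hP hU hS hL hI (half_pos hc)
  choose V hV1 hV2 hV3 hV4 hV5 using fun n => hctrl (v n) (hvhalf n) (hvN n).2
  have hv0 : ∀ n, 0 < v n := fun n => (hvN n).1
  have hl : ∀ n, 1 ≤ c / v n := fun n => by
    rw [one_le_div (hv0 n)]; exact le_csSup hNbdd (hvN n)
  have hlv : ∀ n, c / v n * v n = c := fun n => div_mul_cancel₀ _ (hv0 n).ne'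
  -- All curves are rescaled in time by c / v n ≥ 1 to the common speed c. The rescaled energy
  -- bounds tend to -a/c, the threshold at speed c, and time dilation by a factor at least 1
  -- preserves both tail conditions.
  obtain ⟨U, hUX, hUE⟩ := exists_limit_profile hU hS hK (c := c) (R := R) (T := T)
    (W := fun n t => V n (c / v n * t + 0)) (μ := fun n => c / v n * (-S.a / v n)) (m := -S.a / c)
    (fun n => (hV1 n).comp_affine (by linarith [hl n]) 0)
    (fun n => by simpa using hV5 n)
    (fun n t ht => hV2 n _ (by
      rw [add_zero]; exact mul_nonpos_of_nonneg_of_nonpos (by linarith [hl n]) ht))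
    (fun n t ht => hV3 n _ (by
      have h1 : T ≤ t := ht
      nlinarith [hl n]))
    (fun n => by
      have h1 := shiftedEnergy_comp_affine_le (S := S) (c := v n) (V n) (hl n) 0 0
      rw [hlv] at h1
      simp only [mul_zero, add_zero, neg_zero, Real.exp_zero, one_mul] at h1
      simp only [add_zero]
      refine h1.trans ?_
      rw [ENNReal.ofReal_mul (by linarith [hl n])]
      gcongr
      exact hV4 n)
    (by
      have := ((tendsto_const_nhds (x := c)).div hvlim hc.ne').mul
        ((tendsto_const_nhds (x := -S.a)).div hvlim hc.ne')
      rwa [div_self hc.ne', one_mul] at this)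
  refine ⟨U, hUX, le_antisymm ?_ (hnn U hUX)⟩
  refine energy_nonpos_of_shiftedEnergy_le hU hc hUX.1.continuous (t₀ := 0) ?_
  simpa using hUE

end Setting

end

/-! ### From minimizer to regular solution -/

section

variable {L H K : Type*} [NormedAddCommGroup L] [InnerProductSpace ℝ L] [CompleteSpace L]
  [NormedAddCommGroup H] [InnerProductSpace ℝ H] [NormedAddCommGroup K] [InnerProductSpace ℝ K]
  {S : Setting L H K}

theorem H1Loc.mono {U : ℝ → L} {I J : Set ℝ} (h : H1Loc U J) (hIJ : I ⊆ J) : H1Loc U I := by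
  obtain ⟨g, hg⟩ := h
  exact ⟨g, fun s hs t ht hst => hg s (hIJ hs) t (hIJ ht) hst⟩

theorem h1Loc_of_contDiff {U : ℝ → L} (h : ContDiff ℝ 1 U) : H1Loc U univ := by
  have hd : Continuous (deriv U) := h.continuous_deriv le_rfl
  refine h1Loc_of_primitive (g := deriv U) (fun s t => ?_) fun t => ?_
  · rw [Measure.restrict_congr_set Ioc_ae_eq_Icc.symm, ← memLp_indicator_iff_restrict measurableSet_Ioc]
    exact memLp_indicator_of_continuous hd s t
  · rw [intervalIntegral.integral_deriv_eq_sub (fun x _ => h.differentiable one_ne_zero x)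
      (hd.intervalIntegrable _ _)]
    abel

theorem H1Loc.add {U V : ℝ → L} (hU : H1Loc U univ) (hV : H1Loc V univ) :
    H1Loc (fun t => U t + V t) univ := by
  refine h1Loc_of_primitive (g := fun t => deriv U t + deriv V t)
    (fun s t => (hU.memLp s t).add (hV.memLp s t)) fun t => ?_
  rw [intervalIntegral.integral_add (hU.intervalIntegrable _ _) (hV.intervalIntegrable _ _),
    ← hU.sub_eq, ← hV.sub_eq]
  abel

namespace Setting

theorem exists_nonneg_of_mem_X (hU : S.Unbalanced) {U : ℝ → L} (h : U ∈ S.X) :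
    ∃ T, 1 ≤ T ∧ ∀ t > T, 0 ≤ S.E (U t) := by
  obtain ⟨-, T, hT, h1, -⟩ := h
  exact ⟨T, hT, fun t ht => nonneg_of_mem_plus hU (h1 t (le_of_lt ht))⟩

theorem energyNeg_ne_top_of_mem_X (hU : S.Unbalanced) {c : ℝ} (hc : 0 < c) {U : ℝ → L}
    (h : U ∈ S.X) (I : Set ℝ) : S.energyNeg c U I ≠ ⊤ := by
  obtain ⟨T, -, hT⟩ := exists_nonneg_of_mem_X hU h
  exact energyNeg_ne_top hU hc hT I

theorem energyNeg_le_energyPos_iff (hU : S.Unbalanced) {c : ℝ} (hc : 0 < c) {U : ℝ → L}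
    (h : U ∈ S.X) : S.energyNeg c U univ ≤ S.energyPos c U univ ↔ 0 ≤ S.energy c U := by
  have hn := energyNeg_ne_top_of_mem_X hU hc h univ
  rw [energy, energyOn, EReal.sub_nonneg (Or.inr (by simpa using hn)) (Or.inr (by simp)),
    EReal.coe_ennreal_le_coe_ennreal_iff]

theorem energyPos_eq_energyNeg (hU : S.Unbalanced) {c : ℝ} (hc : 0 < c) {U : ℝ → L}
    (h : U ∈ S.X) (h0 : S.energy c U = 0) : S.energyPos c U univ = S.energyNeg c U univ := by
  refine le_antisymm ?_ ((energyNeg_le_energyPos_iff hU hc h).2 h0.ge)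
  have := h0.le
  rwa [energy, energyOn, EReal.sub_nonpos, EReal.coe_ennreal_le_coe_ennreal_iff] at this

theorem infDist_trunc_le {F : Set L} (hne : F.Nonempty)
    (hexp : ∀ v₁ v₂, ‖S.trunc v₁ - S.trunc v₂‖ ≤ ‖v₁ - v₂‖) (hfix : ∀ v ∈ F, S.trunc v = v)
    (v : L) : Metric.infDist (S.trunc v) F ≤ Metric.infDist v F := by
  refine le_of_forall_pos_lt_add fun ε hε => ?_
  obtain ⟨w, hw, hvw⟩ := (Metric.infDist_lt_iff hne).1 (lt_add_of_pos_right (Metric.infDist v F) hε)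
  refine (Metric.infDist_le_dist_of_mem hw).trans_lt (lt_of_le_of_lt ?_ hvw)
  rw [dist_eq_norm, dist_eq_norm]
  nth_rw 1 [← hfix w hw]
  exact hexp v w

/-- A minimizer at level zero takes its values in the set of fixed points of the truncation. -/
theorem trunc_eq_of_minimizer (hU : S.Unbalanced) (hR : S.Regularity) {c : ℝ} (hc : 0 < c)
    (hmin : ∀ V ∈ S.X, 0 ≤ S.energy c V) {U : ℝ → L} (h : U ∈ S.X) (h0 : S.energy c U = 0) :
    ∀ t, U t = S.trunc (U t) := by
  obtain ⟨hH, T, hT, hplus, hminus⟩ := id h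
  have hUc := hH.continuous
  obtain ⟨hV, hVd⟩ := hH.of_norm_sub_le (V := fun t => S.trunc (U t)) fun s t => hR.nonexpansive _ _
  have hVc := hV.continuous
  have hVX : (fun t => S.trunc (U t)) ∈ S.X :=
    ⟨hV, T, hT, fun t ht => (infDist_trunc_le hU.wellPlus.nonempty hR.nonexpansive hR.fix_plus _).trans
      (hplus t ht), fun t ht => (infDist_trunc_le hU.wellMinus.nonempty hR.nonexpansive
      hR.fix_minus _).trans (hminus t ht)⟩
  have hUp : ∀ t > T, 0 ≤ S.E (U t) := fun t ht => nonneg_of_mem_plus hU (hplus t (le_of_lt ht))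
  have hVp : ∀ t > T, 0 ≤ S.E (S.trunc (U t)) := fun t ht => nonneg_of_mem_plus hU
    ((infDist_trunc_le hU.wellPlus.nonempty hR.nonexpansive hR.fix_plus _).trans
      (hplus t (le_of_lt ht)))
  set m := ENNReal.ofReal (-S.a * Real.exp (c * T) / c) with hm
  have hUm : S.shiftedEnergy c U T = m := by
    have h1 := energyPos_add_eq hU hc hUc hUp
    rw [energyPos_eq_energyNeg hU hc h h0, add_comm] at h1
    exact (ENNReal.add_right_inj (energyNeg_ne_top_of_mem_X hU hc h univ)).1 h1
  have hVm : m ≤ S.shiftedEnergy c (fun t => S.trunc (U t)) T := by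
    have h1 := energyPos_add_eq hU hc hVc hVp
    have h2 := (energyNeg_le_energyPos_iff hU hc hVX).2 (hmin _ hVX)
    have h3 : S.energyNeg c (fun t => S.trunc (U t)) univ + m ≤ S.energyNeg c (fun t => S.trunc (U t)) univ +
        S.shiftedEnergy c (fun t => S.trunc (U t)) T := by
      rw [add_comm _ (S.shiftedEnergy _ _ _), h1]; gcongr
    exact (ENNReal.add_le_add_iff_left (energyNeg_ne_top_of_mem_X hU hc hVX univ)).1 h3
  have hkle : ∀ᵐ t, kin c (fun t => S.trunc (U t)) t ≤ kin c U t := by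
    filter_upwards [hVd] with t ht
    unfold kin
    gcongr
  have hele : ∀ t, S.exc (fun t => S.trunc (U t)) T t ≤ S.exc U T t := fun t =>
    EReal.toENNReal_le_toENNReal (add_le_add (hR.energy_le _) le_rfl)
  have hle : ∀ᵐ t, kin c (fun t => S.trunc (U t)) t +
      ENNReal.ofReal (Real.exp (c * t)) * S.exc (fun t => S.trunc (U t)) T t ≤
      kin c U t + ENNReal.ofReal (Real.exp (c * t)) * S.exc U T t := by
    filter_upwards [hkle] with t ht
    exact add_le_add ht (mul_le_mul' le_rfl (hele t))
  have hmt : m ≠ ⊤ := ENNReal.ofReal_ne_top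
  have hVle : S.shiftedEnergy c (fun t => S.trunc (U t)) T ≤ m := by
    rw [← hUm]; exact lintegral_mono_ae hle
  -- The truncated curve has pointwise smaller density, but its shifted energy cannot be below m, so
  -- the densities agree almost everywhere. As each term decreases separately, the potential parts
  -- agree too.
  have hae := ae_eq_of_ae_le_of_lintegral_le hle (hVle.trans_lt hmt.lt_top).ne
    (measurable_shiftedDensity hU c hUc T).aemeasurable
    (show S.shiftedEnergy c U T ≤ S.shiftedEnergy c (fun t => S.trunc (U t)) T by rwa [hUm])
  have hfin : ∀ᵐ t, kin c U t + ENNReal.ofReal (Real.exp (c * t)) * S.exc U T t < ⊤ :=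
    ae_lt_top (measurable_shiftedDensity hU c hUc T)
      (show S.shiftedEnergy c U T ≠ ⊤ by rw [hUm]; exact hmt)
  have key : ∀ᵐ t, S.trunc (U t) = U t := by
    filter_upwards [hae, hfin, hkle] with t h1 h2 h3
    have he0 : ENNReal.ofReal (Real.exp (c * t)) ≠ 0 := by simpa using Real.exp_pos _
    have hkt : kin c U t ≠ ⊤ := ((ENNReal.add_lt_top.1 h2).1).ne
    have hxt : ENNReal.ofReal (Real.exp (c * t)) * S.exc U T t ≠ ⊤ := ((ENNReal.add_lt_top.1 h2).2).ne
    have hexc : S.exc (fun t => S.trunc (U t)) T t = S.exc U T t := by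
      refine le_antisymm (hele t) ?_
      have h4 : ENNReal.ofReal (Real.exp (c * t)) * S.exc U T t ≤
          ENNReal.ofReal (Real.exp (c * t)) * S.exc (fun t => S.trunc (U t)) T t := by
        refine (ENNReal.add_le_add_iff_left hkt).1 ?_
        rw [← h1]
        exact add_le_add h3 le_rfl
      exact (ENNReal.mul_le_mul_iff_right he0 ENNReal.ofReal_ne_top).1 h4
    rcases hU.E_cases (U t) with h5 | ⟨e, hae', h5⟩
    · rw [exc_top h5] at hxt
      exact absurd (ENNReal.mul_top he0) hxt
    · refine (hR.energy_eq_iff _ (by rw [h5]; exact EReal.coe_lt_top e)).1 ?_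
      rcases hU.E_cases (S.trunc (U t)) with h6 | ⟨e', hae'', h6⟩
      · rw [exc_top (U := fun t => S.trunc (U t)) h6, exc_coe h5] at hexc
        exact absurd hexc.symm ENNReal.ofReal_ne_top
      · rw [exc_coe (U := fun t => S.trunc (U t)) h6, exc_coe h5] at hexc
        -- Equal positive parts give equal potentials only where the shifted values are nonnegative;
        -- this holds before T by the shift and after T by nearness to F⁺.
        have hsh : ∀ x, S.a ≤ x → (0 ≤ S.E (U t) → T < t → 0 ≤ x) → 0 ≤ x + S.shift T t := by
          intro x hx hx'
          rcases le_or_gt t T with h7 | h7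
          · rw [shift_of_le h7]; linarith
          · rw [shift_of_gt h7, add_zero]; exact hx' (hUp t h7) h7
        have h8 := hsh e hae' (fun h9 _ => by rw [h5] at h9; exact_mod_cast h9)
        have h10 := hsh e' hae'' (fun _ h9 => by
          have := hVp t h9; rw [h6] at this; exact_mod_cast this)
        rw [ENNReal.ofReal_eq_ofReal_iff h10 h8] at hexc
        rw [h5, h6]
        congr 1
        linarith
  -- Both curves are continuous, so equality almost everywhere is equality everywhere.
  intro t
  have := (Continuous.ae_eq_iff_eq volume hVc hUc).1 key
  exact (congrFun this t).symm

theorem add_mem_X {U φ : ℝ → L} (h : U ∈ S.X) (hφ : ContDiff ℝ 1 φ) {α β : ℝ}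
    (hs : ∀ t ∉ Ioo α β, φ t = 0) : (fun t => U t + φ t) ∈ S.X := by
  obtain ⟨hH, T, hT, hplus, hminus⟩ := h
  refine ⟨hH.add (h1Loc_of_contDiff hφ), max T (max β (-α)), hT.trans (le_max_left _ _),
    fun t ht => ?_, fun t ht => ?_⟩
  · have h1 : β ≤ t := ((le_max_left _ _).trans (le_max_right _ _)).trans ht
    simp only [hs t fun h => absurd h.2 (not_lt.2 h1), add_zero]
    exact hplus t ((le_max_left _ _).trans ht)
  · have h1 : t ≤ α := by
      have := (le_max_right β (-α)).trans (le_max_right T _)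
      linarith
    simp only [hs t fun h => absurd h.1 (not_lt.2 h1), add_zero]
    refine hminus t ?_
    have := le_max_left T (max β (-α))
    linarith

theorem density_congr {c : ℝ} {U V : ℝ → L} {t : ℝ} (h : U =ᶠ[𝓝 t] V) :
    S.density c U t = S.density c V t := by
  rw [density, density, h.deriv_eq, h.eq_of_nhds]

/-- A minimizer at level zero is a local minimizer on every bounded interval. -/
theorem isLocalMinimizer_of_minimizer (hU : S.Unbalanced) {c : ℝ} (hc : 0 < c)
    (hmin : ∀ V ∈ S.X, 0 ≤ S.energy c V) {U : ℝ → L} (h : U ∈ S.X) (h0 : S.energy c U = 0)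
    (α β : ℝ) : S.IsLocalMinimizer c U α β := by
  have hn := energyNeg_ne_top_of_mem_X hU hc h
  have hpn := energyPos_eq_energyNeg hU hc h h0
  have hp : ∀ I, S.energyPos c U I ≠ ⊤ := fun I =>
    ((lintegral_mono_set (subset_univ I)).trans_lt (show S.energyPos c U univ < ⊤ by
      rw [hpn]; exact (hn univ).lt_top)).ne
  have split : ∀ f : ℝ → ENNReal, ∫⁻ t in univ, f t =
      (∫⁻ t in Ioo α β, f t) + ∫⁻ t in (Ioo α β)ᶜ, f t := fun f => by
    rw [Measure.restrict_univ, lintegral_add_compl _ measurableSet_Ioo]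
  -- Any δ works: a compactly supported perturbation stays in X, where U is a global minimizer.
  refine ⟨h.1.mono (subset_univ _), Or.inr (hn _), ?_, ?_, 1, one_pos, fun φ hφ _ hsupp _ => ?_⟩
  · rw [energyOn, ← ENNReal.ofReal_toReal (hp _), ← ENNReal.ofReal_toReal (hn _)]
    simp only [EReal.coe_ennreal_ofReal]
    rw [← EReal.coe_sub]
    exact EReal.coe_ne_top _
  · rw [energyOn, ← ENNReal.ofReal_toReal (hp _), ← ENNReal.ofReal_toReal (hn _)]
    simp only [EReal.coe_ennreal_ofReal]
    rw [← EReal.coe_sub]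
    exact EReal.coe_ne_bot _
  have hVX : (fun t => U t + S.ι (φ t)) ∈ S.X :=
    add_mem_X (φ := fun t => S.ι (φ t)) h (S.ι.contDiff.comp hφ) (α := α) (β := β) fun t ht => by
      rw [image_eq_zero_of_notMem_tsupport fun h' => ht (hsupp h'), map_zero]
  have hnV := energyNeg_ne_top_of_mem_X hU hc hVX
  refine ⟨Or.inr (hnV _), ?_⟩
  have hcongr : ∀ t ∈ (Ioo α β)ᶜ, S.density c (fun t => U t + S.ι (φ t)) t = S.density c U t := by
    intro t ht
    refine density_congr ?_
    have : φ =ᶠ[𝓝 t] 0 := notMem_tsupport_iff_eventuallyEq.1 fun h' => ht (hsupp h')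
    filter_upwards [this] with x hx
    rw [hx]; simp
  have hposc : S.energyPos c (fun t => U t + S.ι (φ t)) (Ioo α β)ᶜ = S.energyPos c U (Ioo α β)ᶜ :=
    setLIntegral_congr_fun measurableSet_Ioo.compl fun t ht => by simp only [hcongr t ht]
  have hnegc : S.energyNeg c (fun t => U t + S.ι (φ t)) (Ioo α β)ᶜ = S.energyNeg c U (Ioo α β)ᶜ :=
    setLIntegral_congr_fun measurableSet_Ioo.compl fun t ht => by simp only [hcongr t ht]
  have h1 := (energyNeg_le_energyPos_iff hU hc hVX).2 (hmin _ hVX)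
  unfold energyOn
  by_cases hpV : S.energyPos c (fun t => U t + S.ι (φ t)) (Ioo α β) = ⊤
  · rw [hpV, ← ENNReal.ofReal_toReal (hnV _)]
    simp
  have e1 : S.energyPos c (fun t => U t + S.ι (φ t)) univ = S.energyPos c (fun t => U t + S.ι (φ t))
    (Ioo α β) + S.energyPos c U (Ioo α β)ᶜ := by rw [← hposc]; exact split _
  have e2 : S.energyNeg c (fun t => U t + S.ι (φ t)) univ = S.energyNeg c (fun t => U t + S.ι (φ t))
    (Ioo α β) + S.energyNeg c U (Ioo α β)ᶜ := by rw [← hnegc]; exact split _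
  have e3 : S.energyPos c U univ = S.energyPos c U (Ioo α β) + S.energyPos c U (Ioo α β)ᶜ := split _
  have e4 : S.energyNeg c U univ = S.energyNeg c U (Ioo α β) + S.energyNeg c U (Ioo α β)ᶜ := split _
  -- Outside the interval both curves have the same finite contributions, so the comparison on the
  -- whole line reduces to one on the interval after cancellation.
  rw [e1, e2] at h1
  rw [e3, e4] at hpn
  have hx3 := hp (Ioo α β)
  have hx5 := hp (Ioo α β)ᶜ
  have hx4 := hn (Ioo α β)
  have hx6 := hn (Ioo α β)ᶜ
  have hx2 := hnV (Ioo α β)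
  generalize S.energyPos c (fun t => U t + S.ι (φ t)) (Ioo α β) = x1 at *
  generalize S.energyNeg c (fun t => U t + S.ι (φ t)) (Ioo α β) = x2 at *
  generalize S.energyPos c U (Ioo α β) = x3 at *
  generalize S.energyNeg c U (Ioo α β) = x4 at *
  generalize S.energyPos c U (Ioo α β)ᶜ = x5 at *
  generalize S.energyNeg c U (Ioo α β)ᶜ = x6 at *
  lift x1 to NNReal using hpV
  lift x2 to NNReal using hx2
  lift x3 to NNReal using hx3
  lift x4 to NNReal using hx4
  lift x5 to NNReal using hx5
  lift x6 to NNReal using hx6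
  simp only [EReal.coe_nnreal_eq_coe_real]
  have h1' : (x2 : ℝ) + x6 ≤ x1 + x5 := by exact_mod_cast h1
  have hpn' : (x3 : ℝ) + x5 = x4 + x6 := by exact_mod_cast hpn
  rw [← EReal.coe_sub, ← EReal.coe_sub]
  exact EReal.coe_le_coe_iff.2 (by linarith)

/-- Regularity on all symmetric bounded intervals gives regularity on the line. -/
theorem regularOn_univ {U : ℝ → L} (h : ∀ r > 0, S.RegularOn U (Ioo (-r) r)) :
    S.RegularOn U univ := by
  have hr : ∀ t : ℝ, t ∈ Ioo (-(|t| + 1)) (|t| + 1) := fun t =>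
    ⟨by linarith [neg_abs_le t], by linarith [le_abs_self t]⟩
  have hpos : ∀ t : ℝ, 0 < |t| + 1 := fun t => by positivity
  have h1 : ∀ r > 0, ContDiffOn ℝ 2 U (Ioo (-r) r) := fun r hr => (h r hr).1
  choose V hV hVU using fun r hr => (h r hr).2.1
  choose W hW hWU using fun r hr => (h r hr).2.2
  -- The lifts to `H` and `K` found on different intervals agree by injectivity of the inclusions,
  -- so pointwise chosen lifts are locally the regular ones.
  have hex : ∀ t, ∃ x : H, S.ι x = U t := fun t => ⟨_, hVU _ (hpos t) t (hr t)⟩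
  have hex' : ∀ t, ∃ x : K, S.ι (S.κ x) = U t := fun t => ⟨_, hWU _ (hpos t) t (hr t)⟩
  choose v hv using hex
  choose w hw using hex'
  refine ⟨fun t _ => ?_, ⟨v, fun t _ => ?_, fun t _ => hv t⟩, w, fun t _ => ?_, fun t _ => hw t⟩
  · exact ((h1 _ (hpos t)).contDiffAt (Ioo_mem_nhds (hr t).1 (hr t).2)).contDiffWithinAt
  · refine ContDiffAt.contDiffWithinAt ?_
    refine ((hV _ (hpos t)).contDiffAt (Ioo_mem_nhds (hr t).1 (hr t).2)).congr_of_eventuallyEq ?_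
    filter_upwards [Ioo_mem_nhds (hr t).1 (hr t).2] with s hs
    exact S.ι_injective (by rw [hv, hVU _ (hpos t) s hs])
  · refine ContinuousAt.continuousWithinAt ?_
    refine ((hW _ (hpos t)).continuousAt (Ioo_mem_nhds (hr t).1 (hr t).2)).congr ?_
    filter_upwards [Ioo_mem_nhds (hr t).1 (hr t).2] with s hs
    exact S.κ_injective (S.ι_injective (by rw [hw, hWU _ (hpos t) s hs]))

theorem solvesOn_univ {c : ℝ} {U : ℝ → L} (h : ∀ r > 0, S.SolvesOn c U (Ioo (-r) r)) :
    S.SolvesOn c U univ := fun t _ =>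
  h (|t| + 1) (by positivity) t ⟨by linarith [neg_abs_le t], by linarith [le_abs_self t]⟩

end Setting

end

/-! ### Scalar identities for the kinetic and potential parts of a wave -/

section

/-- The kinetic part `k` and the potential part `e` of a solution of the wave equation with speed
`c` and finite energy, whose potential is nonnegative from time `T` on. -/
structure WaveBalance (c a T : ℝ) (k e : ℝ → ℝ) : Prop where
  k_continuous : Continuous k
  e_continuous : Continuous e
  k_nonneg : ∀ t, 0 ≤ k t
  a_neg : a < 0
  le_e : ∀ t, a ≤ e t
  T_nonneg : 0 ≤ T
  e_nonneg : ∀ t ≥ T, 0 ≤ e t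
  hasDerivAt : ∀ t, HasDerivAt (fun t => k t / 2 - e t) (-(c * k t)) t
  integrable : Integrable fun t => (k t / 2 + e t) * Real.exp (c * t)

namespace WaveBalance

variable {c a T : ℝ} {k e : ℝ → ℝ}

theorem hasDerivAt_mul_exp (h : WaveBalance c a T k e) (b d t : ℝ) :
    HasDerivAt (fun t => (k t / 2 - e t + b) * Real.exp (d * t))
      ((-(c * k t) + d * (k t / 2 - e t + b)) * Real.exp (d * t)) t := by
  have h1 := ((hasDerivAt_id' t).const_mul d).exp
  refine (((h.hasDerivAt t).add_const b).mul h1).congr_deriv ?_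
  ring

theorem antitone (h : WaveBalance c a T k e) (hc : 0 < c) : Antitone fun t => k t / 2 - e t := by
  refine antitone_of_deriv_nonpos (fun t => (h.hasDerivAt t).differentiableAt) fun t => ?_
  rw [(h.hasDerivAt t).deriv]
  have := mul_nonneg hc.le (h.k_nonneg t)
  linarith

/-- (k/2 - e + a) e^{2ct} has derivative -2c(e - a) e^{2ct} ≤ 0. Were it positive at t₀, it would
stay above some p > 0 before t₀, so k e^{ct}/2 would be at least p e^{-ct}. This is not integrable
at -∞, contradicting finite energy. -/
theorem le_neg (h : WaveBalance c a T k e) (hc : 0 < c) (t₀ : ℝ) : k t₀ / 2 - e t₀ ≤ -a := by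
  by_contra! hlt
  have hanti : Antitone fun t => (k t / 2 - e t + a) * Real.exp (2 * c * t) := by
    refine antitone_of_deriv_nonpos
      (fun t => (h.hasDerivAt_mul_exp a (2 * c) t).differentiableAt) fun t => ?_
    rw [(h.hasDerivAt_mul_exp a (2 * c) t).deriv]
    have := mul_nonneg hc.le (sub_nonneg.2 (h.le_e t))
    exact mul_nonpos_of_nonpos_of_nonneg (by linarith) (Real.exp_pos _).le
  set p := (k t₀ / 2 - e t₀ + a) * Real.exp (2 * c * t₀) with hp
  have hp0 : 0 < p := mul_pos (by linarith) (Real.exp_pos _)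
  have hint : IntegrableOn (fun t => (k t / 2 + e t) * Real.exp (c * t) + (-a) * Real.exp (c * t))
      (Iic t₀) :=
    h.integrable.integrableOn.add ((integrableOn_exp_mul_Iic hc t₀).const_mul (-a))
  have hconst : IntegrableOn (fun _ : ℝ => p * Real.exp (-(c * t₀))) (Iic t₀) := by
    refine Integrable.mono' hint aestronglyMeasurable_const ?_
    refine (ae_restrict_iff' measurableSet_Iic).2 (ae_of_all _ fun t ht => ?_)
    have ht : t ≤ t₀ := ht
    rw [Real.norm_of_nonneg (by positivity)]
    have h1 : p ≤ (k t / 2 - e t + a) * Real.exp (2 * c * t) := hanti ht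
    have h2 := h.le_e t
    have h3 : Real.exp (2 * c * t) = Real.exp (c * t) * Real.exp (c * t) := by
      rw [← Real.exp_add]; congr 1; ring
    have h4 : p ≤ (k t / 2) * (Real.exp (c * t) * Real.exp (c * t)) := by
      rw [← h3]
      exact h1.trans (mul_le_mul_of_nonneg_right (by linarith) (Real.exp_pos _).le)
    calc p * Real.exp (-(c * t₀)) ≤ p * Real.exp (-(c * t)) := by
          gcongr
      _ ≤ (k t / 2) * (Real.exp (c * t) * Real.exp (c * t)) * Real.exp (-(c * t)) := by gcongr
      _ = (k t / 2) * Real.exp (c * t) := by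
          rw [Real.exp_neg]; field_simp
      _ ≤ _ := by
          rw [← add_mul]
          gcongr
          linarith
  rw [integrableOn_const_iff enorm_ne_top] at hconst
  rcases hconst with h1 | h1
  · have : 0 < p * Real.exp (-(c * t₀)) := by positivity
    exact this.ne' (enorm_eq_zero.1 h1)
  · simp at h1

/-- Integrating (k/2 - e)' = -c k from t to T bounds the integral of k uniformly in t, since k/2 - e
≤ -a at the left end. -/
theorem integrableOn_k (h : WaveBalance c a T k e) (hc : 0 < c) : IntegrableOn k (Iic T) := by
  refine integrableOn_Iic_of_intervalIntegral_norm_bounded ((-a - (k T / 2 - e T)) / c) T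
    (a := fun t : ℝ => t) (l := atBot)
    (fun t => (h.k_continuous.integrableOn_Icc).mono_set Ioc_subset_Icc_self) tendsto_id
    (Eventually.of_forall fun t => ?_)
  have h1 : ∫ x in t..T, -(c * k x) = (k T / 2 - e T) - (k t / 2 - e t) :=
    intervalIntegral.integral_eq_sub_of_hasDerivAt (fun x _ => h.hasDerivAt x)
      (by have := h.k_continuous; exact Continuous.intervalIntegrable (by fun_prop) _ _)
  rw [intervalIntegral.integral_neg, intervalIntegral.integral_const_mul] at h1
  have h2 : ∫ x in t..T, ‖k x‖ = ∫ x in t..T, k x := by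
    congr 1; funext x; exact Real.norm_of_nonneg (h.k_nonneg x)
  rw [h2, le_div_iff₀ hc]
  have := h.le_neg hc t
  linarith

theorem integrable_of_Iic_Ioi {f : ℝ → ℝ} (h1 : IntegrableOn f (Iic T)) (h2 : IntegrableOn f (Ioi T)) :
    Integrable f := by
  rw [← integrableOn_univ, ← Iic_union_Ioi (a := T)]
  exact h1.union h2

/-- Before T the weight is bounded and k itself is integrable; after T the potential is nonnegative
and e^{dt} ≤ e^{ct}, so the finite energy at speed c dominates. -/
theorem integrable_k (h : WaveBalance c a T k e) (hc : 0 < c) {d : ℝ} (hd : 0 < d) (hdc : d ≤ c) :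
    Integrable fun t => k t * Real.exp (d * t) := by
  have hk := h.k_continuous
  refine integrable_of_Iic_Ioi (T := T) ?_ ?_
  · refine Integrable.mono' ((h.integrableOn_k hc).mul_const (Real.exp (d * T)))
      (Continuous.aestronglyMeasurable (by fun_prop)) ?_
    refine (ae_restrict_iff' measurableSet_Iic).2 (ae_of_all _ fun t ht => ?_)
    have ht : t ≤ T := ht
    have := h.k_nonneg t
    rw [Real.norm_of_nonneg (by positivity)]
    gcongr
  · refine Integrable.mono' (h.integrable.integrableOn.const_mul 2)
      (Continuous.aestronglyMeasurable (by fun_prop)) ?_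
    refine (ae_restrict_iff' measurableSet_Ioi).2 (ae_of_all _ fun t ht => ?_)
    have ht : T < t := ht
    have ht0 : 0 ≤ t := h.T_nonneg.trans ht.le
    have h1 := h.k_nonneg t
    have h2 := h.e_nonneg t ht.le
    rw [Real.norm_of_nonneg (by positivity), ← mul_assoc]
    have : Real.exp (d * t) ≤ Real.exp (c * t) := by gcongr
    exact mul_le_mul (by linarith) this (Real.exp_pos _).le (by linarith)

theorem integrable_sub (h : WaveBalance c a T k e) (hc : 0 < c) {d : ℝ} (hd : 0 < d) (hdc : d ≤ c) :
    Integrable fun t => (k t / 2 - e t) * Real.exp (d * t) := by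
  have hk := h.k_continuous
  have he := h.e_continuous
  refine integrable_of_Iic_Ioi (T := T) ?_ ?_
  · refine Integrable.mono' ((integrableOn_exp_mul_Iic hd T).const_mul (|k T / 2 - e T| + -a))
      (Continuous.aestronglyMeasurable (by fun_prop)) ?_
    refine (ae_restrict_iff' measurableSet_Iic).2 (ae_of_all _ fun t ht => ?_)
    have h1 : k T / 2 - e T ≤ k t / 2 - e t := h.antitone hc ht
    have h2 := h.le_neg hc t
    have h3 := h.a_neg
    have h4 := neg_abs_le (k T / 2 - e T)
    have h5 := abs_nonneg (k T / 2 - e T)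
    rw [norm_mul, Real.norm_of_nonneg (Real.exp_pos _).le, Real.norm_eq_abs]
    gcongr
    exact abs_le.2 ⟨by linarith, by linarith⟩
  · refine Integrable.mono' h.integrable.integrableOn
      (Continuous.aestronglyMeasurable (by fun_prop)) ?_
    refine (ae_restrict_iff' measurableSet_Ioi).2 (ae_of_all _ fun t ht => ?_)
    have ht : T < t := ht
    have ht0 : 0 ≤ t := h.T_nonneg.trans ht.le
    have h1 := h.k_nonneg t
    have h2 := h.e_nonneg t ht.le
    rw [norm_mul, Real.norm_of_nonneg (Real.exp_pos _).le, Real.norm_eq_abs]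
    have : Real.exp (d * t) ≤ Real.exp (c * t) := by gcongr
    exact mul_le_mul (abs_le.2 ⟨by linarith, by linarith⟩) this (Real.exp_pos _).le (by linarith)

theorem integrable_density (h : WaveBalance c a T k e) (hc : 0 < c) {d : ℝ} (hd : 0 < d)
    (hdc : d ≤ c) : Integrable fun t => (k t / 2 + e t) * Real.exp (d * t) := by
  refine ((h.integrable_k hc hd hdc).sub (h.integrable_sub hc hd hdc)).congr (ae_of_all _ fun t => ?_)
  simp only [Pi.sub_apply]
  ring

/-- The energy of a solution with respect to a smaller speed. -/
theorem integral_density (h : WaveBalance c a T k e) (hc : 0 < c) {d : ℝ} (hd : 0 < d)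
    (hdc : d ≤ c) : d * ∫ t, (k t / 2 + e t) * Real.exp (d * t) =
      (d - c) * ∫ t, k t * Real.exp (d * t) := by
  have h1 := (h.integrable_k hc hd hdc).const_mul (d - c)
  have h2 := (h.integrable_density hc hd hdc).const_mul d
  have h3 : ∫ t, (((d - c) * (k t * Real.exp (d * t))) -
      d * ((k t / 2 + e t) * Real.exp (d * t))) = 0 := by
    refine integral_eq_zero_of_hasDerivAt_of_integrable
      (f := fun t => (k t / 2 - e t) * Real.exp (d * t)) (fun t => ?_) (h1.sub h2)
      (h.integrable_sub hc hd hdc)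
    have := h.hasDerivAt_mul_exp 0 d t
    simp only [add_zero] at this
    refine this.congr_deriv ?_
    ring
  rw [integral_sub h1 h2, integral_const_mul, integral_const_mul] at h3
  linarith

theorem integral_density_neg (h : WaveBalance c a T k e) (hc : 0 < c) {d : ℝ} (hd : 0 < d)
    (hdc : d < c) {t₀ : ℝ} (hk : k t₀ ≠ 0) : ∫ t, (k t / 2 + e t) * Real.exp (d * t) < 0 := by
  have h1 := h.integral_density hc hd hdc.le
  have hkc := h.k_continuous
  have h2 : 0 < ∫ t, k t * Real.exp (d * t) := by
    have hnn : ∀ t, 0 ≤ k t * Real.exp (d * t) := fun t => mul_nonneg (h.k_nonneg t) (Real.exp_pos _).le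
    refine (integral_nonneg hnn).lt_of_ne fun h3 => hk ?_
    rw [eq_comm, integral_eq_zero_iff_of_nonneg hnn (h.integrable_k hc hd hdc.le)] at h3
    have h4 : (fun t => k t * Real.exp (d * t)) = fun _ => (0 : ℝ) :=
      (Continuous.ae_eq_iff_eq volume (by fun_prop) continuous_const).1 h3
    have h5 := congrFun h4 t₀
    simpa using h5
  by_contra! h3
  have h4 := mul_nonneg hd.le h3
  have h5 := mul_neg_of_neg_of_pos (sub_neg.2 hdc) h2
  linarith

/-- The tail of the energy. -/
theorem integral_Ioi (h : WaveBalance c a T k e) (hc : 0 < c) (t₀ : ℝ) :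
    c * ∫ t in Ioi t₀, (k t / 2 + e t) * Real.exp (c * t) =
      (k t₀ / 2 - e t₀) * Real.exp (c * t₀) := by
  have hd : ∀ t, HasDerivAt (fun t => (k t / 2 - e t) * Real.exp (c * t))
      (-c * ((k t / 2 + e t) * Real.exp (c * t))) t := fun t => by
    have := h.hasDerivAt_mul_exp 0 c t
    simp only [add_zero] at this
    refine this.congr_deriv ?_
    ring
  have h1 := (h.integrable.const_mul (-c)).integrableOn (s := Ioi t₀)
  have h2 := tendsto_zero_of_hasDerivAt_of_integrableOn_Ioi (a := t₀) (fun t _ => hd t) h1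
    (h.integrable_sub hc hc le_rfl).integrableOn
  have h3 := integral_Ioi_of_hasDerivAt_of_tendsto' (a := t₀) (fun t _ => hd t) h1 h2
  rw [integral_const_mul] at h3
  linarith

/-- Exponential decay of the tail of the energy. -/
theorem integral_Ioi_le (h : WaveBalance c a T k e) (hc : 0 < c) :
    ∃ B, 0 ≤ B ∧ ∀ t ≥ T, ∫ s in Ioi t, (k s / 2 + e s) * Real.exp (c * s) ≤ B * Real.exp (-(c * t)) := by
  -- With the weight e^{2ct} the kinetic terms cancel and the derivative is -2c e e^{2ct}, which is
  -- nonpositive after T. Since the tail energy is (k/2 - e) e^{ct}/c, it decays like e^{-ct}.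
  have hanti : AntitoneOn (fun t => (k t / 2 - e t) * Real.exp (2 * c * t)) (Ici T) := by
    have hd : ∀ t, HasDerivAt (fun t => (k t / 2 - e t) * Real.exp (2 * c * t))
        (-(2 * c * e t) * Real.exp (2 * c * t)) t := fun t => by
      have := h.hasDerivAt_mul_exp 0 (2 * c) t
      simp only [add_zero] at this
      refine this.congr_deriv ?_
      ring
    refine antitoneOn_of_deriv_nonpos (convex_Ici T)
      (fun t _ => (hd t).continuousAt.continuousWithinAt)
      (fun t _ => (hd t).differentiableAt.differentiableWithinAt) fun t ht => ?_
    rw [interior_Ici] at ht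
    rw [(hd t).deriv]
    have := mul_nonneg hc.le (h.e_nonneg t (le_of_lt ht))
    exact mul_nonpos_of_nonpos_of_nonneg (by linarith) (Real.exp_pos _).le
  set B := (k T / 2 - e T) * Real.exp (2 * c * T) with hB
  have key : ∀ t ≥ T, ∫ s in Ioi t, (k s / 2 + e s) * Real.exp (c * s) ≤
      B / c * Real.exp (-(c * t)) := fun t ht => by
    have h1 := h.integral_Ioi hc t
    have h2 : (k t / 2 - e t) * Real.exp (2 * c * t) ≤ B := hanti self_mem_Ici ht ht
    have h3 : Real.exp (2 * c * t) = Real.exp (c * t) * Real.exp (c * t) := by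
      rw [← Real.exp_add]; congr 1; ring
    rw [h3, ← mul_assoc, ← h1] at h2
    rw [Real.exp_neg, div_mul_eq_mul_div, le_div_iff₀ hc, ← div_eq_mul_inv,
      le_div_iff₀ (Real.exp_pos _)]
    linarith
  refine ⟨B / c, ?_, key⟩
  have h1 := key T le_rfl
  have h2 : 0 ≤ ∫ s in Ioi T, (k s / 2 + e s) * Real.exp (c * s) :=
    setIntegral_nonneg measurableSet_Ioi fun t ht => by
      have h1 := h.k_nonneg t
      have h2 := h.e_nonneg t (le_of_lt ht)
      positivity
  exact nonneg_of_mul_nonneg_left (h2.trans h1) (Real.exp_pos _)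

end WaveBalance

end

/-! ### Uniqueness of the speed and exponential convergence -/

section

variable {L H K : Type*} [NormedAddCommGroup L] [InnerProductSpace ℝ L] [CompleteSpace L]
  [NormedAddCommGroup H] [InnerProductSpace ℝ H] [NormedAddCommGroup K] [InnerProductSpace ℝ K]
  {S : Setting L H K}

theorem integrable_of_lintegral_ofReal {f : ℝ → ℝ} (hf : Continuous f)
    (h1 : ∫⁻ t, ENNReal.ofReal (f t) ≠ ⊤) (h2 : ∫⁻ t, ENNReal.ofReal (-f t) ≠ ⊤) :
    Integrable f := by
  refine ⟨hf.aestronglyMeasurable, ?_⟩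
  refine lt_of_le_of_lt (b := ∫⁻ t, (ENNReal.ofReal (f t) + ENNReal.ofReal (-f t)))
    (lintegral_mono fun t => ?_) ?_
  · rw [Real.enorm_eq_ofReal_abs]
    rcases abs_choice (f t) with h | h <;> rw [h]
    · exact le_self_add
    · exact le_add_self
  · rw [lintegral_add_left (by have := hf.measurable; fun_prop)]
    exact ENNReal.add_lt_top.2 ⟨h1.lt_top, h2.lt_top⟩

namespace Setting

theorem energyPos_of_coe {c : ℝ} {U : ℝ → L} {e : ℝ → ℝ} (hE : ∀ t, S.E (U t) = e t) :
    S.energyPos c U univ =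
      ∫⁻ t, ENNReal.ofReal ((‖deriv U t‖ ^ 2 / 2 + e t) * Real.exp (c * t)) := by
  rw [energyPos, Measure.restrict_univ]
  exact lintegral_congr fun t => by rw [density_of_coe (hE t), EReal.real_coe_toENNReal]

theorem energyNeg_of_coe {c : ℝ} {U : ℝ → L} {e : ℝ → ℝ} (hE : ∀ t, S.E (U t) = e t) :
    S.energyNeg c U univ =
      ∫⁻ t, ENNReal.ofReal (-((‖deriv U t‖ ^ 2 / 2 + e t) * Real.exp (c * t))) := by
  rw [energyNeg, Measure.restrict_univ]
  exact lintegral_congr fun t => by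
    rw [density_of_coe (hE t), ← EReal.coe_neg, EReal.real_coe_toENNReal]

theorem energy_eq_integral {c : ℝ} {U : ℝ → L} {e : ℝ → ℝ} (hE : ∀ t, S.E (U t) = e t)
    (hint : Integrable fun t => (‖deriv U t‖ ^ 2 / 2 + e t) * Real.exp (c * t)) :
    S.energy c U = ((∫ t, (‖deriv U t‖ ^ 2 / 2 + e t) * Real.exp (c * t) : ℝ) : EReal) := by
  have h1 : S.energyPos c U univ ≠ ⊤ := by
    rw [energyPos_of_coe hE]; exact hint.lintegral_lt_top.ne
  have h2 : S.energyNeg c U univ ≠ ⊤ := by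
    rw [energyNeg_of_coe hE]; exact hint.neg.lintegral_lt_top.ne
  rw [integral_eq_lintegral_pos_part_sub_lintegral_neg_part hint, ← energyPos_of_coe hE,
    ← energyNeg_of_coe hE, EReal.coe_sub, EReal.coe_ennreal_toReal h1, EReal.coe_ennreal_toReal h2,
    energy, energyOn]

/-- Pairing the equation with U' gives (‖U'‖²/2 - E(U))' = -c‖U'‖². The chain rule for E is applied
to the `C¹` lift of U to `H`, where E is differentiable, and `grad_eq` converts its differential
into the product of `gradE` with U'. -/
theorem exists_waveBalance (hU : S.Unbalanced) (hS : S.SmallerSpace) {c : ℝ} (hc : 0 < c) {U : ℝ → L}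
    (hX : U ∈ S.X) (hreg : S.RegularOn U univ) (hsol : S.SolvesOn c U univ)
    (hfin : S.energy c U < ⊤) :
    ∃ T, ∃ e : ℝ → ℝ, (∀ t, S.E (U t) = e t) ∧
      (∀ t ≥ T, Metric.infDist (U t) S.plus.F ≤ S.plus.r₀ / 2) ∧
      WaveBalance c S.a T (fun t => ‖deriv U t‖ ^ 2) e := by
  obtain ⟨-, T, hT, hplus, -⟩ := id hX
  obtain ⟨hU2, ⟨V, hV, hVU⟩, -⟩ := hreg
  rw [contDiffOn_univ] at hU2 hV
  have hE : ∀ t, S.E (U t) = S.EH (V t) := fun t => by rw [← hVU t trivial]; exact E_ι hU hS _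
  have hdU : ContDiff ℝ 1 (deriv U) := by
    have : ContDiff ℝ (1 + 1) U := by simpa [one_add_one_eq_two] using hU2
    exact (contDiff_succ_iff_deriv.1 this).2.2
  have hk : Continuous fun t => ‖deriv U t‖ ^ 2 := hdU.continuous.norm.pow 2
  have he : Continuous fun t => S.EH (V t) := hS.contDiff.continuous.comp hV.continuous
  have hn := energyNeg_ne_top_of_mem_X hU hc hX univ
  have hp : S.energyPos c U univ ≠ ⊤ := fun htop => by
    rw [energy, energyOn, htop, ← ENNReal.ofReal_toReal hn] at hfin
    simp at hfin
  refine ⟨T, fun t => S.EH (V t), hE, hplus, hk, he, fun t => by positivity, hU.a_neg, fun t => ?_,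
    by linarith, fun t ht => ?_, fun t => ?_, ?_⟩
  · have := hU.a_le (U t)
    rw [hE] at this
    exact_mod_cast this
  · have := nonneg_of_mem_plus hU (hplus t ht)
    rw [hE] at this
    exact_mod_cast this
  · obtain ⟨x, hx, heq⟩ := hsol t trivial
    have hxV : S.κ x = V t := S.ι_injective (by rw [hx, hVU t trivial])
    have h1 : HasDerivAt (deriv U) (deriv (deriv U) t) t :=
      (hdU.differentiable one_ne_zero t).hasDerivAt
    have h2 : HasDerivAt V (deriv V t) t := (hV.differentiable one_ne_zero t).hasDerivAt
    have h3 : HasDerivAt U (S.ι (deriv V t)) t := by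
      have := S.ι.hasFDerivAt.comp_hasDerivAt t h2
      exact this.congr_of_eventuallyEq (Eventually.of_forall fun s => (hVU s trivial).symm)
    have h4 : HasDerivAt (fun t => S.EH (V t)) (fderiv ℝ S.EH (V t) (deriv V t)) t :=
      (hS.contDiff.differentiable one_ne_zero (V t)).hasFDerivAt.comp_hasDerivAt t h2
    rw [← hxV, ← hS.grad_eq, ← h3.deriv] at h4
    refine ((h1.norm_sq.div_const 2).sub h4).congr_deriv ?_
    have h5 : (inner ℝ (deriv U t) (deriv (deriv U) t - S.gradE x) : ℝ) =
        -(c * ‖deriv U t‖ ^ 2) := by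
      rw [heq, inner_neg_right, inner_smul_right, real_inner_self_eq_norm_sq]
    rw [inner_sub_right, real_inner_comm] at h5
    rw [real_inner_comm]
    rw [real_inner_comm (S.gradE x)] at h5
    linarith
  · refine integrable_of_lintegral_ofReal (by fun_prop) ?_ ?_
    · rwa [← energyPos_of_coe hE]
    · rwa [← energyNeg_of_coe hE]

theorem exists_deriv_ne_zero (hU : S.Unbalanced) {U : ℝ → L} (hX : U ∈ S.X)
    (hd : Differentiable ℝ U) : ∃ t, deriv U t ≠ 0 := by
  by_contra! h0
  obtain ⟨-, T, hT, hplus, hminus⟩ := hX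
  have h1 := is_const_of_deriv_eq_zero hd h0 T (-T)
  have h2 := hplus T le_rfl
  have h3 := hminus (-T) le_rfl
  rw [← h1] at h3
  have := hU.wellPlus.r₀_pos
  have := hU.wellMinus.r₀_pos
  exact Set.disjoint_left.1 hU.disjoint
    (show Metric.infDist (U T) S.plus.F ≤ S.plus.r₀ by linarith)
    (show Metric.infDist (U T) S.minus.F ≤ S.minus.r₀ by linarith)

/-- A solution of finite energy has negative energy for every smaller speed. -/
theorem energy_neg_of_lt (hU : S.Unbalanced) (hS : S.SmallerSpace) {c d : ℝ} (hd : 0 < d)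
    (hdc : d < c) {U : ℝ → L} (hX : U ∈ S.X) (hreg : S.RegularOn U univ) (hsol : S.SolvesOn c U univ)
    (hfin : S.energy c U < ⊤) : S.energy d U < 0 := by
  have hc := hd.trans hdc
  obtain ⟨T, e, hE, -, h⟩ := exists_waveBalance hU hS hc hX hreg hsol hfin
  obtain ⟨t₀, ht₀⟩ := exists_deriv_ne_zero hU hX
    ((contDiffOn_univ.1 hreg.1).differentiable two_ne_zero)
  rw [energy_eq_integral hE (h.integrable_density hc hd hdc.le)]
  have := h.integral_density_neg hc hd hdc (t₀ := t₀) (by simpa using ht₀)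
  exact_mod_cast this

/-- Solutions of finite energy converge exponentially. -/
theorem exists_exponential_limit (hU : S.Unbalanced) (hS : S.SmallerSpace) {c : ℝ} (hc : 0 < c)
    {U : ℝ → L} (hX : U ∈ S.X) (hreg : S.RegularOn U univ) (hsol : S.SolvesOn c U univ)
    (hfin : S.energy c U < ⊤) :
    ∃ M : ℝ, 0 < M ∧ ∃ v ∈ S.plus.F, ∀ t : ℝ, ‖U t - v‖ ≤ M * Real.exp (-(c * t)) := by
  obtain ⟨T, e, hE, hplus, h⟩ := exists_waveBalance hU hS hc hX hreg hsol hfin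
  have hH := hX.1
  obtain ⟨B, hB0, hB⟩ := h.integral_Ioi_le hc
  set f := fun t => (‖deriv U t‖ ^ 2 / 2 + e t) * Real.exp (c * t) with hf
  have hfint : Integrable f := h.integrable
  have hkint := h.integrable_k hc hc le_rfl
  have hexp2 : ∀ t, Real.exp (c * t) * Real.exp (-(c * t)) = 1 := fun t => by
    rw [← Real.exp_add]; simp
  -- distance between two late times
  have hlate : ∀ s ≥ T, ∀ t ≥ s, ‖U t - U s‖ ≤ √(2 * B / c) * Real.exp (-(c * s)) := by
    intro s hs t hst
    have h1 := hH.norm_sub_sq_le hc hst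
    have h2 : ∫ x in s..t, Real.exp (c * x) * ‖deriv U x‖ ^ 2 ≤ 2 * (B * Real.exp (-(c * s))) := by
      rw [intervalIntegral.integral_of_le hst]
      calc ∫ x in Ioc s t, Real.exp (c * x) * ‖deriv U x‖ ^ 2
          ≤ ∫ x in Ioi s, Real.exp (c * x) * ‖deriv U x‖ ^ 2 := by
            refine setIntegral_mono_set ?_ (ae_of_all _ fun x => by positivity)
              (Ioc_subset_Ioi_self.eventuallyLE)
            exact (hkint.congr (ae_of_all _ fun x => mul_comm _ _)).integrableOn
        _ ≤ ∫ x in Ioi s, 2 * f x := by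
            refine setIntegral_mono_on
              (hkint.congr (ae_of_all _ fun x => mul_comm _ _)).integrableOn
              (hfint.const_mul 2).integrableOn measurableSet_Ioi fun x hx => ?_
            have h3 := h.e_nonneg x (hs.trans (le_of_lt hx))
            have := mul_nonneg h3 (Real.exp_pos (c * x)).le
            simp only [hf]
            linarith
        _ = 2 * ∫ x in Ioi s, f x := integral_const_mul _ _
        _ ≤ _ := by
            have := hB s hs
            gcongr
    have h4 : c * ‖U t - U s‖ ^ 2 ≤ 2 * B * (Real.exp (-(c * s)) * Real.exp (-(c * s))) := by
      have h5 := mul_le_mul_of_nonneg_right (h1.trans h2) (Real.exp_pos (-(c * s))).le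
      calc c * ‖U t - U s‖ ^ 2 = c * ‖U t - U s‖ ^ 2 * (Real.exp (c * s) * Real.exp (-(c * s))) := by
            rw [hexp2, mul_one]
        _ ≤ _ := by linarith
    refine abs_le_of_sq_le_sq' (by
      rw [mul_pow, Real.sq_sqrt (by positivity), div_mul_eq_mul_div, le_div_iff₀ hc]
      linarith) (by positivity) |>.2
  have hexp0 : Tendsto (fun t : ℝ => √(2 * B / c) * Real.exp (-(c * t))) atTop (𝓝 0) := by
    rw [← mul_zero √(2 * B / c)]
    refine Tendsto.const_mul _ ?_
    exact Real.tendsto_exp_neg_atTop_nhds_zero.comp (tendsto_id.const_mul_atTop hc)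
  have hcauchy : CauchySeq U := by
    refine Metric.cauchySeq_iff'.2 fun ε hε => ?_
    obtain ⟨s, hs⟩ := ((hexp0.eventually (gt_mem_nhds hε)).and (eventually_ge_atTop T)).exists
    exact ⟨s, fun t ht => by rw [dist_eq_norm]; exact (hlate s hs.2 t ht).trans_lt hs.1⟩
  obtain ⟨v, hv⟩ := cauchySeq_tendsto_of_complete hcauchy
  have hvlate : ∀ s ≥ T, ‖U s - v‖ ≤ √(2 * B / c) * Real.exp (-(c * s)) := fun s hs => by
    rw [norm_sub_rev]
    refine le_of_tendsto (hv.sub_const (U s)).norm ?_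
    filter_upwards [eventually_ge_atTop s] with t ht using hlate s hs t ht
  -- By coercivity the squared distance to F⁺ is dominated by the energy density, hence integrable
  -- on a half line. As it also converges, its limit is 0.
  have hvF : v ∈ S.plus.F := by
    rw [hU.wellPlus.closed.mem_iff_infDist_zero hU.wellPlus.nonempty]
    have hC : 0 < S.plus.C := one_pos.trans hU.wellPlus.one_lt_C
    have hr := hU.wellPlus.r₀_pos
    have h1 : Tendsto (fun t => Metric.infDist (U t) S.plus.F ^ 2) atTop
        (𝓝 (Metric.infDist v S.plus.F ^ 2)) :=
      ((((Metric.continuous_infDist_pt S.plus.F).tendsto v).comp hv).pow 2)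
    have h2 : IntegrableOn (fun t => Metric.infDist (U t) S.plus.F ^ 2) (Ioi T) := by
      refine Integrable.mono' (hfint.const_mul S.plus.C).integrableOn
        (Continuous.aestronglyMeasurable
          (((Metric.continuous_infDist_pt S.plus.F).comp hH.continuous).pow 2)) ?_
      refine (ae_restrict_iff' measurableSet_Ioi).2 (ae_of_all _ fun t ht => ?_)
      have ht : T < t := ht
      have h3 := hU.wellPlus.coercive (U t)
        (show Metric.infDist (U t) S.plus.F ≤ S.plus.r₀ by linarith [hplus t ht.le])
      rw [hE] at h3
      have h3 : S.plus.C⁻¹ * Metric.infDist (U t) S.plus.F ^ 2 + 0 ≤ e t := by exact_mod_cast h3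
      rw [add_zero, inv_mul_le_iff₀ hC] at h3
      rw [Real.norm_of_nonneg (by positivity)]
      refine h3.trans (mul_le_mul_of_nonneg_left ?_ hC.le)
      have h4 : 1 ≤ Real.exp (c * t) :=
        Real.one_le_exp (mul_nonneg hc.le (h.T_nonneg.trans ht.le))
      have h5 := h.e_nonneg t ht.le
      calc e t ≤ (‖deriv U t‖ ^ 2 / 2 + e t) * 1 := by
            have : 0 ≤ ‖deriv U t‖ ^ 2 / 2 := by positivity
            linarith
        _ ≤ f t := mul_le_mul_of_nonneg_left h4 (by positivity)
    have h6 := IntegrableAtFilter.eq_zero_of_tendsto (⟨Ioi T, Ioi_mem_atTop T, h2⟩ :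
      IntegrableAtFilter _ atTop volume) (fun s hs => ?_) h1
    · exact pow_eq_zero_iff two_ne_zero |>.1 h6
    · obtain ⟨b, hb⟩ := mem_atTop_sets.1 hs
      refine eq_top_mono (measure_mono (show Ici b ⊆ s from hb)) Real.volume_Ici
  set N := ∫ x, ‖deriv U x‖ ^ 2 * Real.exp (c * x) with hN
  have hN0 : 0 ≤ N := integral_nonneg fun x => by positivity
  have hearly : ∀ t ≤ T, ‖U T - U t‖ ≤ √(N / c * Real.exp (c * T)) * Real.exp (-(c * t)) := by
    intro t ht
    have h1 := hH.norm_sub_sq_le hc ht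
    have h2 : ∫ x in t..T, Real.exp (c * x) * ‖deriv U x‖ ^ 2 ≤ N := by
      rw [intervalIntegral.integral_of_le ht]
      simp_rw [mul_comm (Real.exp _)]
      exact setIntegral_le_integral hkint (ae_of_all _ fun x => by positivity)
    have h4 : c * ‖U T - U t‖ ^ 2 ≤ N * Real.exp (-(c * t)) := by
      have h5 := mul_le_mul_of_nonneg_right (h1.trans h2) (Real.exp_pos (-(c * t))).le
      calc c * ‖U T - U t‖ ^ 2 = c * ‖U T - U t‖ ^ 2 * (Real.exp (c * t) * Real.exp (-(c * t))) := by
            rw [hexp2, mul_one]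
        _ ≤ _ := by linarith
    -- For t ≤ T this turns the factor e^{-ct} in the bound on the squared distance into e^{-2ct},
    -- at the price of a constant.
    have h6 : 1 ≤ Real.exp (c * T) * Real.exp (-(c * t)) := by
      rw [← Real.exp_add]
      refine Real.one_le_exp ?_
      have := mul_le_mul_of_nonneg_left ht hc.le
      linarith
    refine abs_le_of_sq_le_sq' ?_ (by positivity) |>.2
    rw [mul_pow, Real.sq_sqrt (by positivity), div_mul_eq_mul_div, div_mul_eq_mul_div, le_div_iff₀ hc]
    calc ‖U T - U t‖ ^ 2 * c ≤ N * Real.exp (-(c * t)) * 1 := by linarith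
      _ ≤ N * Real.exp (-(c * t)) * (Real.exp (c * T) * Real.exp (-(c * t))) := by gcongr
      _ = _ := by ring
  refine ⟨√(N / c * Real.exp (c * T)) + √(2 * B / c) + 1, by positivity, v, hvF, fun t => ?_⟩
  have hpos := (Real.exp_pos (-(c * t))).le
  have hs1 := mul_nonneg (Real.sqrt_nonneg (N / c * Real.exp (c * T))) hpos
  have hs2 := mul_nonneg (Real.sqrt_nonneg (2 * B / c)) hpos
  rcases le_total T t with ht | ht
  · have := hvlate t ht
    linarith
  · have h1 := hvlate T le_rfl
    have h2 := hearly t ht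
    have h3 : ‖U t - v‖ ≤ ‖U T - U t‖ + ‖U T - v‖ := by
      have : U t - v = -(U T - U t) + (U T - v) := by abel
      rw [this]
      exact (norm_add_le _ _).trans (by rw [norm_neg])
    have h4 : √(2 * B / c) * Real.exp (-(c * T)) ≤ √(2 * B / c) * Real.exp (-(c * t)) := by gcongr
    linarith

end Setting

end

end AbstractWave

end

/-! ### The theorem -/

open AbstractWave in
theorem mainTheorem2 {L H K : Type*}
    [NormedAddCommGroup L] [InnerProductSpace ℝ L] [CompleteSpace L]
    [NormedAddCommGroup H] [InnerProductSpace ℝ H] [CompleteSpace H]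
    [NormedAddCommGroup K] [InnerProductSpace ℝ K]
    (S : Setting L H K)
    (hUnbalanced : S.Unbalanced) (hSmaller : S.SmallerSpace)
    (hCompact : S.Compactness) (hInverse : S.ProjectionsInverse) (hProjH : S.ProjectionsH)
    (hRegular : S.Regularity) (hLevel : S.LevelSets) :
    ∃ c : ℝ, 0 < c ∧ ∃ U : ℝ → L,
      -- existence
      (S.RegularOn U univ ∧ U ∈ S.X ∧ S.SolvesOn c U univ ∧
        (∃ T : ℝ, ∀ t ≤ T, U t ∈ tube S.minus.F (S.minus.r₀ / 2)) ∧
        (∃ T : ℝ, ∀ t ≥ T, U t ∈ tube S.plus.F (S.plus.r₀ / 2)) ∧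
        S.energy c U = 0 ∧ (∀ V ∈ S.X, S.energy c U ≤ S.energy c V) ∧
        ∀ t, U t = S.trunc (U t)) ∧
      -- uniqueness of the speed
      (∀ c' : ℝ, 0 < c' → (⨅ V ∈ S.X, S.energy c' V) = 0 →
        (∃ V : ℝ → L, S.RegularOn V univ ∧ V ∈ S.X ∧ S.SolvesOn c' V univ ∧ S.energy c' V < ⊤) →
          c' = c) ∧
      -- exponential convergence
      (∃ M : ℝ, 0 < M ∧ ∃ v ∈ S.plus.F, ∀ t : ℝ, ‖U t - v‖ ≤ M * Real.exp (-(c * t))) := by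
  obtain ⟨c, hc, hmin, U, hX, h0⟩ :=
    Setting.exists_speed_minimizer hProjH hUnbalanced hSmaller hLevel hInverse hCompact
  have htrunc := Setting.trunc_eq_of_minimizer hUnbalanced hRegular hc hmin hX h0
  have hloc : ∀ r > 0, S.RegularOn U (Ioo (-r) r) ∧ S.SolvesOn c U (Ioo (-r) r) := fun r hr =>
    hRegular.regular c hc (-r) r (by linarith) U
      (Setting.isLocalMinimizer_of_minimizer hUnbalanced hc hmin hX h0 (-r) r) fun t _ => htrunc t
  have hreg := Setting.regularOn_univ fun r hr => (hloc r hr).1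
  have hsol := Setting.solvesOn_univ fun r hr => (hloc r hr).2
  have hfin : S.energy c U < ⊤ := by rw [h0]; exact EReal.coe_lt_top 0
  obtain ⟨-, T, -, hplus, hminus⟩ := id hX
  refine ⟨c, hc, U, ⟨hreg, hX, hsol, ⟨-T, hminus⟩, ⟨T, hplus⟩, h0,
    fun V hV => by rw [h0]; exact hmin V hV, htrunc⟩, fun c' hc' hinf hex => ?_,
    Setting.exists_exponential_limit hUnbalanced hSmaller hc hX hreg hsol hfin⟩
  obtain ⟨V, hVreg, hVX, hVsol, hVfin⟩ := hex
  -- The wave of the larger speed would have negative energy at the smaller one, where the infimum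
  -- over X is zero.
  rcases lt_trichotomy c' c with hlt | heq | hlt
  · have h1 := Setting.energy_neg_of_lt hUnbalanced hSmaller hc' hlt hX hreg hsol hfin
    have h2 : 0 ≤ S.energy c' U := by rw [← hinf]; exact iInf₂_le U hX
    exact absurd h1 (not_lt.2 h2)
  · exact heq
  · have h1 := Setting.energy_neg_of_lt hUnbalanced hSmaller hc hlt hVX hVreg hVsol hVfin
    exact absurd h1 (not_lt.2 (hmin V hVX))
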